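/- **Setting.** Let $X$ be a compact Hausdorff space, $C^0(X)^\vee$ the space of signed Radon measures on $X$ (the dual of $C^0(X)$), and $\mathcal M\subset C^0(X)^\vee$ the set of Radon probability measures with the weak topology. Assume given: a dense linear subspace $\mathcal D\subset C^0(X)$ containing the constants; a partially ordered real vector space $\mathcal Z$ whose cone $\mathcal Z_+=\{\theta\ge 0\}$ spans $\mathcal Z$ and is closed in the finest vector space topology (a set is open, resp. closed, if its intersection with each finite-dimensional subspace is); a linear map $\mathrm{dd^c}\colon\mathcal D\to\mathcal Z$ vanishing on constants; an integer $n\ge1$ and a nonzero symmetric $n$-linear map $(\theta_1,\dots,\theta_n)\mapsto\theta_1\wedge\dots\wedge\theta_n\in C^0(X)^\vee$, with positive values on $\mathcal Z_+^n$, such that each bilinear form $(\varphi,\psi)\mapsto\int\varphi\,\mathrm{dd^c}\psi\wedge\theta_1\wedge\dots\wedge\theta_{n-1}$ on $\mathcal D$ is symmetric, and is seminegative if all $\theta_i\ge0$. Let $[\theta]$ be the class of $\theta\in\mathcal Z$ in $\mathcal Z/\mathrm{dd^c}\mathcal D$, and $\mathrm{Pos}(X)\subset\mathcal Z/\mathrm{dd^c}\mathcal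 D$ the interior, in the finest vector space topology, of the image of $\mathcal Z_+$. Fix $\omega\in\mathcal Z_+$ with $[\omega]\in\mathrm{Pos}(X)$. Set $V_\omega=\int\omega^n$, $\omega_\varphi=\omega+\mathrm{dd^c}\varphi$, $\mathcal D_\omega=\{\varphi\in\mathcal D\mid\omega_\varphi\ge0\}$, and for $\varphi,\psi\in\mathcal D_\omega$ and $\mu\in\mathcal M$ $$\mathrm{MA}_\omega(\varphi)=V_\omega^{-1}\omega_\varphi^n,\qquad \mathrm E_\omega(\varphi)=\frac1{n+1}\sum_{j=0}^nV_\omega^{-1}\int\varphi\,\omega_\varphi^j\wedge\omega^{n-j},$$ $$\mathrm J_\omega(\varphi,\psi)=\mathrm E_\omega(\varphi)-\mathrm E_\omega(\psi)+\int(\psi-\varphi)\,\mathrm{MA}_\omega(\varphi),$$ $$\mathrm J_\omega(\mu,\psi)=\sup_{\varphi\in\mathcal D_\omega}\Big\{\mathrm E_\omega(\varphi)-\mathrm E_\omega(\psi)+\int(\psi-\varphi)\,\mu\Big\}\in[0,+\infty],\qquad \mathrm J_\omega(\mu)=\mathrm J_\omega(\mu,0).$$ Let $\mathcal M^1_\omega=\{\mu\in\mathcal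 M\mid\mathrm J_\omega(\mu)<\infty\}$, with the strong topology, i.e. the coarsest refinement of the weak topology for which $\mathrm J_\omega$ is continuous. A quasi-metric is a function $\mathrm d\ge0$ that vanishes exactly on the diagonal and satisfies, for some $C>0$, $C^{-1}\mathrm d(x,y)\le\mathrm d(y,x)\le C\,\mathrm d(x,y)$ and $\mathrm d(x,y)\le C(\mathrm d(x,z)+\mathrm d(z,y))$; it defines a uniform structure (generated by the entourages $\{\mathrm d<\varepsilon\}$, $\varepsilon>0$), hence a topology and a notion of completeness. We say that $\omega$ has the *orthogonality property* if (a) for all $\varphi,\psi\in\mathcal D_\omega$ and $f\in\mathcal D$ with $\max\{\varphi,\psi\}<f$ pointwise there is $\tau\in\mathcal D_\omega$ with $\max\{\varphi,\psi\}\le\tau<f$; and (b) for all $f\in\mathcal D$ and $\varepsilon>0$ there is $\varphi_0\in\mathcal D_\omega$ with $\varphi_0<f$ such that $\int(f-\varphi)\,\mathrm{MA}_\omega(\varphi)\le\varepsilon$ for all $\varphi\in\mathcal D_\omega$ with $\varphi_0\le\varphi<f$. **Theorem.** There is a constant $C>0$ that depends only on $n$ such that the following holds, with $\alpha=2^{-n}$,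 whenever $\omega$ has the orthogonality property. 1. $\mathrm{MA}_\omega$ maps $\mathcal D_\omega$ to $\mathcal M^1_\omega$. If $\mu\in\mathcal M^1_\omega$ and $(\psi_i)$ is a maximizing sequence for $\mu$, i.e. a sequence in $\mathcal D_\omega$ with $\mathrm E_\omega(\psi_i)-\int\psi_i\,\mu\to\mathrm J_\omega(\mu)$, then $\mathrm{MA}_\omega(\psi_i)\to\mu$ strongly. In particular the image of $\mathrm{MA}_\omega\colon\mathcal D_\omega\to\mathcal M^1_\omega$ is dense in the strong topology. 2. There is a unique strongly continuous functional $\mathrm d_\omega\colon\mathcal M^1_\omega\times\mathcal M^1_\omega\to\mathbb R$ with $\mathrm d_\omega(\mathrm{MA}_\omega(\varphi),\mathrm{MA}_\omega(\psi))=\mathrm J_\omega(\varphi,\psi)$ for all $\varphi,\psi\in\mathcal D_\omega$. It satisfies: - $\mathrm d_\omega(\mu,\mathrm{MA}_\omega(\psi))=\mathrm J_\omega(\mu,\psi)$ for all $\mu\in\mathcal M^1_\omega$ and $\psi\in\mathcal D_\omega$; in particular $\mathrm d_\omega(\mu,\mathrm{MA}_\omega(0))=\mathrm J_\omega(\mu)$;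 - $\mathrm d_\omega$ is a quasi-metric, with the constant $C$; - $|\mathrm d_\omega(\mu,\nu)-\mathrm d_\omega(\mu',\nu')|\le C\max\{\mathrm d_\omega(\mu,\mu'),\mathrm d_\omega(\nu,\nu')\}^{\alpha}R^{1-\alpha}$ for all $R>0$ and all $\mu,\mu',\nu,\nu'\in\mathcal M^1_\omega$ of energy $\mathrm J_\omega\le R$; - $\left|\int(\varphi-\psi)(\mu-\nu)\right|\le C\,\mathrm J_\omega(\varphi,\psi)^{\alpha}\,\mathrm d_\omega(\mu,\nu)^{1/2}R^{1/2-\alpha}$ for all $R>0$, all $\mu,\nu\in\mathcal M^1_\omega$ with $\mathrm J_\omega(\mu),\mathrm J_\omega(\nu)\le R$, and all $\varphi,\psi\in\mathcal D_\omega$ with $\mathrm J_\omega(0,\varphi),\mathrm J_\omega(0,\psi)\le R$. 3. The topology of the quasi-metric space $(\mathcal M^1_\omega,\mathrm d_\omega)$ is the strong topology, and this space is complete. It depends only on the class $[\omega]$: if $\omega'\in\mathcal Z_+$ and $[\omega']=[\omega]$, then $\omega'$ has the orthogonality property, $\mathcal M^1_{\omega'}=\mathcal M^1_\omega$ with the same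 strong topology, and $\mathrm d_{\omega'}=\mathrm d_\omega$. -/

import Mathlib

open Filter Topology

universe u v

noncomputable section

/-- The finest vector space topology of a real vector space: a subset `A` is open (closed) iff
`A ∩ W` is open (closed) in the canonical topology of `W`, for each finite dimensional
subspace `W`. -/
@[reducible] def finestTopology (V : Type*) [AddCommGroup V] [Module ℝ V] : TopologicalSpace V :=
  ⨆ W : {W : Submodule ℝ V // FiniteDimensional ℝ W},
    TopologicalSpace.coinduced (Subtype.val : W.1 → V) (moduleTopology ℝ W.1)

/-! ### Quasi-metrics -/

/-- `d` is a quasi-metric, with the constant `C` in the quasi-symmetry and in the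
quasi-triangle inequality. -/
structure IsQuasiMetricWith {M : Type*} (C : ℝ) (d : M → M → ℝ) : Prop where
  pos : 0 < C
  nonneg : ∀ x y, 0 ≤ d x y
  quasi_symm : ∀ x y, C⁻¹ * d x y ≤ d y x ∧ d y x ≤ C * d x y
  quasi_triangle : ∀ x y z, d x y ≤ C * (d x z + d z y)
  eq_zero_iff : ∀ x y, d x y = 0 ↔ x = y

/-- The uniform structure of a quasi-metric space: the entourages are the sets that contain
`{(x, y) | d x y < ε}` for some `ε > 0`. -/
@[reducible] def IsQuasiMetricWith.uniformSpace {M : Type*} {C : ℝ} {d : M → M → ℝ}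
    (h : IsQuasiMetricWith C d) : UniformSpace M :=
  UniformSpace.ofCore <| UniformSpace.Core.mkOfBasis
    { sets := {s | ∃ ε : ℝ, 0 < ε ∧ s = {p : M × M | d p.1 p.2 < ε}}
      nonempty := ⟨_, 1, one_pos, rfl⟩
      inter_sets := by
        rintro _ _ ⟨a, ha, rfl⟩ ⟨b, hb, rfl⟩
        refine ⟨_, ⟨min a b, lt_min ha hb, rfl⟩, fun p hp => ?_⟩
        have hp' : d p.1 p.2 < min a b := hp
        exact ⟨lt_of_lt_of_le hp' (min_le_left _ _), lt_of_lt_of_le hp' (min_le_right _ _)⟩ }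
    (by
      rintro _ ⟨ε, hε, rfl⟩ x
      show d x x < ε
      rwa [(h.eq_zero_iff x x).2 rfl])
    (by
      rintro _ ⟨ε, hε, rfl⟩
      refine ⟨_, ⟨ε / C, div_pos hε h.pos, rfl⟩, fun p hp => ?_⟩
      have hp' : d p.1 p.2 < ε / C := hp
      show d p.2 p.1 < ε
      have h1 := (h.quasi_symm p.1 p.2).2
      rw [lt_div_iff₀ h.pos] at hp'
      linarith)
    (by
      rintro _ ⟨ε, hε, rfl⟩
      refine ⟨_, ⟨ε / (2 * C), div_pos hε (mul_pos two_pos h.pos), rfl⟩, ?_⟩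
      rintro ⟨x, y⟩ ⟨z, hxz, hzy⟩
      have hxz' : d x z < ε / (2 * C) := hxz
      have hzy' : d z y < ε / (2 * C) := hzy
      show d x y < ε
      have h1 := h.quasi_triangle x y z
      have hC := h.pos
      rw [lt_div_iff₀ (by positivity)] at hxz' hzy'
      linarith)

/-! ### Radon measures

Signed Radon measures on a compact Hausdorff space `X` are the elements of the topological dual
of `C(X, ℝ)`; the value `μ f` is the integral of `f` against `μ`. -/

/-- Radon probability measures on `X`, with the weak topology. -/
abbrev RadonProb (X : Type*) [TopologicalSpace X] [CompactSpace X] : Type _ :=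
  {μ : WeakDual ℝ C(X, ℝ) // (∀ f : C(X, ℝ), 0 ≤ f → 0 ≤ μ f) ∧ μ 1 = 1}

/-- The elements of `RadonProb X` are exactly the regular Borel probability measures on `X`. -/
theorem RadonProb.existsUnique_measure {X : Type*} [TopologicalSpace X] [CompactSpace X]
    [T2Space X] [MeasurableSpace X] [BorelSpace X] (μ : RadonProb X) :
    ∃! m : MeasureTheory.Measure X, m.Regular ∧ MeasureTheory.IsProbabilityMeasure m ∧
      ∀ f : C(X, ℝ), μ.1 f = ∫ x, f x ∂m := by
  let Λ : CompactlySupportedContinuousMap X ℝ →ₚ[ℝ] ℝ := PositiveLinearMap.mk₀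
    { toFun := fun g => μ.1 g.toContinuousMap
      map_add' := fun g h => map_add μ.1 g.toContinuousMap h.toContinuousMap
      map_smul' := fun c g => map_smul μ.1 c g.toContinuousMap }
    (fun g hg => μ.2.1 _ hg)
  have key : ∀ f : C(X, ℝ), μ.1 f = ∫ x, f x ∂(RealRMK.rieszMeasure Λ) := fun f =>
    (RealRMK.integral_rieszMeasure Λ ⟨f, HasCompactSupport.of_compactSpace _⟩).symm
  refine ⟨RealRMK.rieszMeasure Λ, ⟨inferInstance, ⟨?_⟩, key⟩, ?_⟩
  · have h1 := key 1
    rw [μ.2.2] at h1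
    simp only [ContinuousMap.one_apply, MeasureTheory.integral_const, smul_eq_mul, mul_one] at h1
    exact (ENNReal.toReal_eq_one_iff _).1 h1.symm
  · rintro m ⟨hm, -, hmf⟩
    exact MeasureTheory.Measure.ext_of_integral_eq_on_compactlySupported fun f => by
      have := (hmf f.toContinuousMap).symm.trans (key f.toContinuousMap)
      exact this

/-! ### The synthetic setting -/

/-- The synthetic pluripotential-theoretic data on a compact space `X`, of dimension `n`:
test functions, closed `(1,1)`-forms (the partially ordered vector space `Z`), the operator
`ddᶜ`, and the wedge product of `n` forms. -/
structure PluripotentialData (X : Type*) [TopologicalSpace X] [CompactSpace X]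
    (Z : Type*) [AddCommGroup Z] [Module ℝ Z] [PartialOrder Z] [IsOrderedAddMonoid Z]
    [IsOrderedModule ℝ Z] (n : ℕ) where
  /-- The space of test functions. -/
  testFun : Submodule ℝ C(X, ℝ)
  dense_testFun : Dense (testFun : Set C(X, ℝ))
  const_mem : ∀ c : ℝ, ContinuousMap.const X c ∈ testFun
  /-- The partial order of `Z` is nice: the positive cone spans and is closed. -/
  span_nonneg : Submodule.span ℝ {θ : Z | 0 ≤ θ} = ⊤
  isClosed_nonneg : IsClosed[finestTopology Z] {θ : Z | 0 ≤ θ}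
  /-- The operator `ddᶜ`. -/
  ddc : testFun →ₗ[ℝ] Z
  ddc_const : ∀ c : ℝ, ddc ⟨ContinuousMap.const X c, const_mem c⟩ = 0
  /-- The signed Radon measure `θ₁ ∧ ⋯ ∧ θₙ`. -/
  wedge : MultilinearMap ℝ (fun _ : Fin n => Z) (C(X, ℝ) →L[ℝ] ℝ)
  wedge_ne_zero : wedge ≠ 0
  wedge_symm : ∀ (σ : Equiv.Perm (Fin n)) (θ : Fin n → Z), wedge (fun i => θ (σ i)) = wedge θ
  wedge_nonneg : ∀ θ : Fin n → Z, (∀ i, 0 ≤ θ i) → ∀ f : C(X, ℝ), 0 ≤ f → 0 ≤ wedge θ f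
  /-- Symmetry of `(φ, ψ) ↦ ∫ φ ddᶜψ ∧ (n - 1 forms)`. By the symmetry of the wedge product,
  the position `i` of the factor `ddᶜψ` does not matter. -/
  integration_by_parts : ∀ (θ : Fin n → Z) (i : Fin n) (φ ψ : testFun),
    wedge (Function.update θ i (ddc ψ)) φ = wedge (Function.update θ i (ddc φ)) ψ
  /-- Seminegativity of this bilinear form when the `n - 1` forms are nonnegative. -/
  seminegative : ∀ (θ : Fin n → Z) (i : Fin n) (φ : testFun), (∀ j, j ≠ i → 0 ≤ θ j) →
    wedge (Function.update θ i (ddc φ)) φ ≤ 0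

namespace PluripotentialData

variable {X : Type*} [TopologicalSpace X] [CompactSpace X]
  {Z : Type*} [AddCommGroup Z] [Module ℝ Z] [PartialOrder Z] [IsOrderedAddMonoid Z]
  [IsOrderedModule ℝ Z] {n : ℕ} (S : PluripotentialData X Z n)

/-- The Bott--Chern cohomology space `Z / ddᶜ D`. -/
abbrev BottChern : Type _ := Z ⧸ LinearMap.range S.ddc

/-- The Bott--Chern class `[θ]`. -/
def bcClass (θ : Z) : S.BottChern := (LinearMap.range S.ddc).mkQ θ

/-- The positive cone: the interior of the set of classes of nonnegative forms, in the finest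
vector space topology. -/
def Pos : Set S.BottChern :=
  @interior S.BottChern (finestTopology S.BottChern) (S.bcClass '' {θ : Z | 0 ≤ θ})

/-- The form `ω_φ = ω + ddᶜφ`. -/
def twist (ω : Z) (φ : S.testFun) : Z := ω + S.ddc φ

/-- The set of `ω`-plurisubharmonic test functions. -/
def psh (ω : Z) : Set S.testFun := {φ | 0 ≤ S.twist ω φ}

/-- The measure `α ^ j ∧ β ^ (n - j)`. -/
def mixed (α β : Z) (j : ℕ) : C(X, ℝ) →L[ℝ] ℝ :=
  S.wedge fun i => if (i : ℕ) < j then α else β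

/-- The volume `V_ω = ∫ ω ^ n`. -/
def vol (ω : Z) : ℝ := S.wedge (fun _ => ω) 1

/-- The Monge--Ampère measure `MA_ω(φ) = V_ω⁻¹ ω_φ ^ n`. -/
def MA (ω : Z) (φ : S.testFun) : C(X, ℝ) →L[ℝ] ℝ :=
  (S.vol ω)⁻¹ • S.wedge fun _ => S.twist ω φ

/-- The Monge--Ampère energy
`E_ω(φ) = (n + 1)⁻¹ ∑ j = 0..n, V_ω⁻¹ ∫ φ ω_φ ^ j ∧ ω ^ (n - j)`. -/
def energy (ω : Z) (φ : S.testFun) : ℝ :=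
  ((n : ℝ) + 1)⁻¹ * ∑ j ∈ Finset.range (n + 1), (S.vol ω)⁻¹ * S.mixed (S.twist ω φ) ω j φ

/-- The Dirichlet functional `J_ω(φ, ψ)`. -/
def dirichlet (ω : Z) (φ ψ : S.testFun) : ℝ :=
  S.energy ω φ - S.energy ω ψ + S.MA ω φ ((ψ - φ : S.testFun) : C(X, ℝ))

/-- `D_{ω, R}`, the set of `ω`-psh test functions `φ` with `J_ω(0, φ) ≤ R`. -/
def pshLe (ω : Z) (R : ℝ) : Set S.testFun := {φ | φ ∈ S.psh ω ∧ S.dirichlet ω 0 φ ≤ R}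

/-- The energy `J_ω(μ, ψ) ∈ [0, +∞]` of a probability measure `μ` relative to `ψ`. -/
def measureEnergy (ω : Z) (μ : RadonProb X) (ψ : S.testFun) : EReal :=
  ⨆ φ : S.psh ω, ((S.energy ω φ.1 - S.energy ω ψ +
    μ.1 ((ψ - φ.1 : S.testFun) : C(X, ℝ)) : ℝ) : EReal)

/-- The space `M¹_ω` of probability measures `μ` of finite energy, `J_ω(μ) = J_ω(μ, 0) < ∞`. -/
structure FiniteEnergy (ω : Z) where
  /-- The underlying probability measure. -/
  prob : RadonProb X
  finite : S.measureEnergy ω prob 0 < ⊤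

variable {S} in
/-- The underlying signed Radon measure of a measure of finite energy. -/
def FiniteEnergy.radon {ω : Z} (μ : S.FiniteEnergy ω) : C(X, ℝ) →L[ℝ] ℝ := μ.prob.1

variable {S} in
/-- The real-valued energy `J_ω(μ)` of a measure of finite energy. -/
def FiniteEnergy.J {ω : Z} (μ : S.FiniteEnergy ω) : ℝ := (S.measureEnergy ω μ.prob 0).toReal

/-- The strong topology: the coarsest refinement of the weak topology for which `J_ω` is
continuous. -/
instance strongTopology (ω : Z) : TopologicalSpace (S.FiniteEnergy ω) :=
  TopologicalSpace.induced FiniteEnergy.prob inferInstance ⊓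
    TopologicalSpace.induced FiniteEnergy.J inferInstance

/-- `D_ω` admits maxima. -/
def AdmitsMaxima (ω : Z) : Prop :=
  ∀ φ ∈ S.psh ω, ∀ ψ ∈ S.psh ω, ∀ f : S.testFun,
    (∀ x, max (φ.1 x) (ψ.1 x) < f.1 x) →
      ∃ τ ∈ S.psh ω, ∀ x, max (φ.1 x) (ψ.1 x) ≤ τ.1 x ∧ τ.1 x < f.1 x

/-- The orthogonality property: `D_ω` admits maxima and, for each test function `f`, the integral
of `f - φ` against `MA_ω(φ)` tends to `0` along the directed set of all `φ ∈ D_ω` with `φ < f`. -/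
def HasOrthogonality (ω : Z) : Prop :=
  S.AdmitsMaxima ω ∧
    ∀ f : S.testFun, ∀ ε : ℝ, 0 < ε →
      ∃ φ₀ ∈ S.psh ω, (∀ x, φ₀.1 x < f.1 x) ∧
        ∀ φ ∈ S.psh ω, (∀ x, φ₀.1 x ≤ φ.1 x ∧ φ.1 x < f.1 x) →
          |S.MA ω φ ((f - φ : S.testFun) : C(X, ℝ))| ≤ ε

/-- `(ψᵢ)` is a maximizing sequence for `μ`: it consists of `ω`-psh test functions and
`E_ω(ψᵢ) - ∫ ψᵢ μ → J_ω(μ)`. -/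
def IsMaximizing {ω : Z} (μ : S.FiniteEnergy ω) (ψ : ℕ → S.testFun) : Prop :=
  (∀ i, ψ i ∈ S.psh ω) ∧
    Tendsto (fun i => S.energy ω (ψ i) - μ.radon (ψ i)) atTop (𝓝 μ.J)

/-- `d` is a functional on `M¹_ω × M¹_ω` that is continuous in the strong topology and satisfies
`d (MA_ω(φ), MA_ω(ψ)) = J_ω(φ, ψ)` for all `ω`-psh test functions `φ`, `ψ`. -/
def ExtendsDirichlet (ω : Z) (d : S.FiniteEnergy ω → S.FiniteEnergy ω → ℝ) : Prop :=
  Continuous (fun p : S.FiniteEnergy ω × S.FiniteEnergy ω => d p.1 p.2) ∧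
    ∀ φ ∈ S.psh ω, ∀ ψ ∈ S.psh ω, ∀ μ ν : S.FiniteEnergy ω,
      μ.radon = S.MA ω φ → ν.radon = S.MA ω ψ → d μ ν = S.dirichlet ω φ ψ

end PluripotentialData

end

/-!
# Measures of finite energy in the synthetic setting

Everything rests on a small calculus of Dirichlet forms. The wedge product of `n` forms is
encoded as a linear map `integ` on a commutative algebra `FormAlg` generated by the forms, so
that identities between mixed Monge--Ampère measures become identities in a commutative ring.
For `p` in the semiring `posCone` generated by the nonnegative forms, integration by parts makes
`gradForm ω p u v = -V_ω⁻¹ ∫ v ddᶜu ∧ p` symmetric and positive semidefinite, and it is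
monotone in `p`. In these terms `J_ω(φ, ψ)` is the Dirichlet form of a positive combination of
the `ω_φ ^ i ∧ ω_ψ ^ (n - 1 - i)`, evaluated on `φ - ψ`; it is therefore comparable to
`symDirichlet`, the Dirichlet form of `(ω_φ + ω_ψ) ^ (n - 1)`, which is symmetric in `φ` and `ψ`.

Three estimates with constants that depend only on `n` follow.

* Uniform concavity of the energy (`symDirichlet_le_energy_midpoint`): two near-maximizers of
  `E_ω - μ` are close to each other. For `μ = MA_ω(τ)` this is the quasi-triangle inequality,
  for general `μ` it makes every maximizing sequence Cauchy.
* Hölder estimates (`abs_MA_sub_MA_sub_le_dirichlet`, `abs_dirichlet_sub_le`): in the Dirichlet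
  form of `φ - ψ`, the factors `ω_φ + ω_ψ` are replaced one at a time by `ω_φ' + ω_ψ'`, and each
  replacement costs a square root by Cauchy--Schwarz (`gradForm_step`). After `n - 1` steps, and
  one more Cauchy--Schwarz inequality, the exponent is `2⁻ⁿ`.
* For a fixed test function `f`, the integral of `f` against `MA_ω(φ)` is `1/2`-Hölder in
  `J_ω`, uniformly in `φ` (`exists_abs_MA_sub_MA_le`).

Orthogonality enters only in `exists_MA_le_of_forall`, which says that `MA_ω(ψᵢ) → μ` weakly for
a maximizing sequence `ψᵢ`: it amounts to the differentiability of `f ↦ sup {E_ω(φ) | φ < f}`.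
With the Hölder estimates, weak convergence improves to strong convergence
(`IsMaximizing.tendsto_J`). The quasi-metric `energyDist` is the limit of `J_ω` along maximizing
sequences, and all estimates pass to the limit. Since `energyDist μ (MA_ω(ψ)) = J_ω(μ, ψ)` is
strongly continuous in `μ` and can be made arbitrarily small, the balls of `energyDist` are
strong neighbourhoods; the estimates above give the converse. Completeness comes from weak
compactness of the set of probability measures and weak lower semicontinuity of `J_ω(·, ψ)`.
Replacing `ω` by `ω + ddᶜτ` amounts to translating test functions by `τ`.
-/

noncomputable section

/-! ### The algebra of forms -/

theorem exists_perm_of_map_univ_eq {k : ℕ} {Z : Type*} {f g : Fin k → Z}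
    (h : Finset.univ.val.map f = Finset.univ.val.map g) :
    ∃ σ : Equiv.Perm (Fin k), ∀ i, g (σ i) = f i := by
  classical
  have hc : ∀ z, Nonempty ({i // f i = z} ≃ {i // g i = z}) := by
    intro z
    refine ⟨Fintype.equivOfCardEq ?_⟩
    have h1 := congrArg (Multiset.count z) h
    rw [Multiset.count_map, Multiset.count_map] at h1
    rw [Fintype.card_subtype, Fintype.card_subtype, Finset.card_def, Finset.card_def,
      Finset.filter_val, Finset.filter_val]
    simpa only [eq_comm (a := z)] using h1
  exact ⟨Equiv.ofFiberEquiv fun z => (hc z).some, fun i => Equiv.ofFiberEquiv_map _ i⟩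

open Classical in
theorem prod_map_X {Z : Type*} (L : Multiset Z) :
    (L.map (MvPolynomial.X : Z → MvPolynomial Z ℝ)).prod =
      MvPolynomial.monomial (Multiset.toFinsupp L) 1 := by
  induction L using Multiset.induction_on with
  | empty => simp
  | cons a L ih =>
    rw [Multiset.map_cons, Multiset.prod_cons, ih, ← Multiset.singleton_add, map_add,
      Multiset.toFinsupp_singleton, MvPolynomial.X, MvPolynomial.monomial_mul, one_mul]

namespace PluripotentialData

variable {X : Type*} [TopologicalSpace X] [CompactSpace X]
  {Z : Type*} [AddCommGroup Z] [Module ℝ Z] [PartialOrder Z] [IsOrderedAddMonoid Z]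
  [IsOrderedModule ℝ Z] {m : ℕ} (S : PluripotentialData X Z (m + 1))

open Classical in
/-- The wedge product of a multiset of forms; it is zero unless the multiset has `n`
elements. -/
def wedgeMultiset (L : Multiset Z) : C(X, ℝ) →L[ℝ] ℝ :=
  if h : ∃ θ : Fin (m + 1) → Z, Finset.univ.val.map θ = L then S.wedge h.choose else 0

theorem wedgeMultiset_map (θ : Fin (m + 1) → Z) :
    S.wedgeMultiset (Finset.univ.val.map θ) = S.wedge θ := by
  have h : ∃ θ' : Fin (m + 1) → Z, Finset.univ.val.map θ' = Finset.univ.val.map θ := ⟨θ, rfl⟩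
  rw [wedgeMultiset, dif_pos h]
  obtain ⟨σ, hσ⟩ := exists_perm_of_map_univ_eq h.choose_spec
  rw [← S.wedge_symm σ θ]
  congr 1
  exact funext fun i => (hσ i).symm

theorem wedgeMultiset_nonneg {L : Multiset Z} (hL : ∀ θ ∈ L, 0 ≤ θ) {f : C(X, ℝ)} (hf : 0 ≤ f) :
    0 ≤ S.wedgeMultiset L f := by
  by_cases h : ∃ θ : Fin (m + 1) → Z, Finset.univ.val.map θ = L
  · obtain ⟨θ, rfl⟩ := h
    rw [wedgeMultiset_map]
    exact S.wedge_nonneg θ (fun i => hL _ (Multiset.mem_map_of_mem _ (Finset.mem_univ i))) f hf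
  · rw [wedgeMultiset, dif_neg h]
    simp

/-- The wedge product with a given multiset `L` of forms is either given by the `n`-linear
map, or identically zero because `L` does not have `n - 1` elements. -/
theorem wedgeMultiset_cons (L : Multiset Z) :
    (∃ θ : Fin m → Z, (∀ i, θ i ∈ L) ∧
      ∀ a, S.wedgeMultiset (a ::ₘ L) = S.wedge (Fin.cons a θ : Fin (m + 1) → Z)) ∨
    ∀ a, S.wedgeMultiset (a ::ₘ L) = 0 := by
  by_cases h : ∃ θ : Fin m → Z, Finset.univ.val.map θ = L
  · obtain ⟨θ, rfl⟩ := h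
    refine Or.inl ⟨θ, fun i => Multiset.mem_map_of_mem _ (Finset.mem_univ i), fun a => ?_⟩
    rw [← wedgeMultiset_map]
    congr 1
    simp [Fin.univ_succ, Function.comp_def]
  · refine Or.inr fun a => ?_
    rw [wedgeMultiset, dif_neg]
    rintro ⟨θ, hθ⟩
    have hc : Multiset.card L = m := by
      have := congrArg Multiset.card hθ
      simpa using this.symm
    refine h ⟨fun i => L.toList.get (i.cast (by simp [hc])), ?_⟩
    rw [Fin.univ_val_map]
    conv_rhs => rw [← L.coe_toList]
    congr 1
    apply List.ext_get
    · simp [hc]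
    · intro i h1 h2
      simp

theorem wedgeMultiset_cons_add (a b : Z) (L : Multiset Z) :
    S.wedgeMultiset ((a + b) ::ₘ L) = S.wedgeMultiset (a ::ₘ L) + S.wedgeMultiset (b ::ₘ L) := by
  rcases S.wedgeMultiset_cons L with ⟨θ, -, h⟩ | h
  · rw [h, h, h, S.wedge.cons_add]
  · rw [h, h, h, add_zero]

theorem wedgeMultiset_cons_smul (c : ℝ) (a : Z) (L : Multiset Z) :
    S.wedgeMultiset ((c • a) ::ₘ L) = c • S.wedgeMultiset (a ::ₘ L) := by
  rcases S.wedgeMultiset_cons L with ⟨θ, -, h⟩ | h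
  · rw [h, h, S.wedge.cons_smul]
  · rw [h, h, smul_zero]

theorem wedgeMultiset_cons_ddc (u v : S.testFun) (L : Multiset Z) :
    S.wedgeMultiset (S.ddc u ::ₘ L) v = S.wedgeMultiset (S.ddc v ::ₘ L) u := by
  rcases S.wedgeMultiset_cons L with ⟨θ, -, h⟩ | h
  · have := S.integration_by_parts (Fin.cons 0 θ) 0 v u
    rw [h, h]
    simpa using this
  · simp [h]

theorem wedgeMultiset_cons_ddc_self (u : S.testFun) {L : Multiset Z} (hL : ∀ θ ∈ L, 0 ≤ θ) :
    S.wedgeMultiset (S.ddc u ::ₘ L) u ≤ 0 := by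
  rcases S.wedgeMultiset_cons L with ⟨θ, hθ, h⟩ | h
  · have := S.seminegative (Fin.cons 0 θ) 0 u (fun j hj => by
      obtain ⟨k, rfl⟩ := Fin.exists_succ_eq.2 hj
      simpa using hL _ (hθ k))
    rw [h]
    simpa using this
  · simp [h]

/-- The linear extension of the wedge product to polynomials in the forms. -/
def wedgePoly : MvPolynomial Z ℝ →ₗ[ℝ] (C(X, ℝ) →L[ℝ] ℝ) :=
  (MvPolynomial.basisMonomials Z ℝ).constr ℝ fun s => S.wedgeMultiset (Finsupp.toMultiset s)

theorem wedgePoly_prod (L : Multiset Z) :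
    S.wedgePoly (L.map MvPolynomial.X).prod = S.wedgeMultiset L := by
  classical
  have h := congrFun (MvPolynomial.coe_basisMonomials (σ := Z) (R := ℝ)) (Multiset.toFinsupp L)
  rw [prod_map_X, ← h, wedgePoly, Module.Basis.constr_basis, Multiset.toFinsupp_toMultiset]

theorem poly_induction {P : MvPolynomial Z ℝ → Prop}
    (prod : ∀ L : Multiset Z, P (L.map MvPolynomial.X).prod)
    (add : ∀ p q, P p → P q → P (p + q)) (smul : ∀ (c : ℝ) p, P p → P (c • p))
    (p : MvPolynomial Z ℝ) : P p := by
  induction p using MvPolynomial.induction_on' with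
  | monomial s c =>
    classical
    have := smul c _ (prod (Finsupp.toMultiset s))
    rwa [prod_map_X, Finsupp.toMultiset_toFinsupp, MvPolynomial.smul_monomial,
      smul_eq_mul, mul_one] at this
  | add p q hp hq => exact add p q hp hq

/-- The ideal of all polynomials in the forms that vanish under the wedge product, together
with all their multiples. -/
def nullIdeal : Ideal (MvPolynomial Z ℝ) where
  carrier := {p | ∀ q, S.wedgePoly (p * q) = 0}
  add_mem' := fun {a b} ha hb q => by rw [add_mul, map_add, ha q, hb q, add_zero]
  zero_mem' := fun q => by rw [zero_mul, map_zero]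
  smul_mem' := fun c p hp q => by rw [smul_eq_mul, mul_comm c p, mul_assoc]; exact hp _

/-- The commutative algebra generated by the forms: polynomials in the forms modulo the
relations that hold under the wedge product. -/
def FormAlg : Type _ := MvPolynomial Z ℝ ⧸ S.nullIdeal

instance : CommRing S.FormAlg := inferInstanceAs (CommRing (MvPolynomial Z ℝ ⧸ S.nullIdeal))

instance : Algebra ℝ S.FormAlg :=
  inferInstanceAs (Algebra ℝ (MvPolynomial Z ℝ ⧸ S.nullIdeal))

/-- The quotient map onto the algebra of forms. -/
def toFormAlg : MvPolynomial Z ℝ →ₐ[ℝ] S.FormAlg := Ideal.Quotient.mkₐ ℝ S.nullIdeal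

theorem toFormAlg_surjective : Function.Surjective S.toFormAlg :=
  Ideal.Quotient.mkₐ_surjective ℝ S.nullIdeal

theorem toFormAlg_eq_iff {p q : MvPolynomial Z ℝ} :
    S.toFormAlg p = S.toFormAlg q ↔ ∀ r, S.wedgePoly ((p - q) * r) = 0 :=
  Ideal.Quotient.eq (I := S.nullIdeal)

/-- A form, as an element of the algebra of forms. -/
def form : Z →ₗ[ℝ] S.FormAlg where
  toFun a := S.toFormAlg (MvPolynomial.X a)
  map_add' a b := by
    rw [← map_add, toFormAlg_eq_iff]
    intro r
    induction r using poly_induction with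
    | prod L =>
      have := S.wedgeMultiset_cons_add a b L
      simp only [← wedgePoly_prod, Multiset.map_cons, Multiset.prod_cons, ← map_add] at this
      rw [sub_mul, map_sub, this, ← map_sub]
      simp [add_mul]
    | add p q hp hq => rw [mul_add, map_add, hp, hq, add_zero]
    | smul c p hp => rw [mul_smul_comm, map_smul, hp, smul_zero]
  map_smul' c a := by
    rw [RingHom.id_apply, ← map_smul, toFormAlg_eq_iff]
    intro r
    induction r using poly_induction with
    | prod L =>
      have := S.wedgeMultiset_cons_smul c a L
      simp only [← wedgePoly_prod, Multiset.map_cons, Multiset.prod_cons, ← map_smul] at this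
      rw [sub_mul, map_sub, this, ← map_sub]
      simp
    | add p q hp hq => rw [mul_add, map_add, hp, hq, add_zero]
    | smul c p hp => rw [mul_smul_comm, map_smul, hp, smul_zero]

/-- The signed measure defined by an element of the algebra of forms. On products of `n` forms
it is their wedge product, on products of `k ≠ n` forms it is zero. -/
def integ : S.FormAlg →ₗ[ℝ] (C(X, ℝ) →L[ℝ] ℝ) :=
  (S.nullIdeal.restrictScalars ℝ).liftQ S.wedgePoly fun p hp => by
    simpa using (show ∀ q, S.wedgePoly (p * q) = 0 from hp) 1

theorem integ_toFormAlg (p : MvPolynomial Z ℝ) : S.integ (S.toFormAlg p) = S.wedgePoly p := rfl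

theorem integ_multiset_prod (L : Multiset Z) :
    S.integ (L.map S.form).prod = S.wedgeMultiset L := by
  rw [← wedgePoly_prod, ← integ_toFormAlg, map_multiset_prod S.toFormAlg, Multiset.map_map]
  rfl

theorem integ_prod (θ : Fin (m + 1) → Z) : S.integ (∏ i, S.form (θ i)) = S.wedge θ := by
  rw [← wedgeMultiset_map, ← integ_multiset_prod, Multiset.map_map]
  rfl

theorem formAlg_induction {P : S.FormAlg → Prop}
    (prod : ∀ L : Multiset Z, P (L.map S.form).prod)
    (add : ∀ p q, P p → P q → P (p + q)) (smul : ∀ (c : ℝ) p, P p → P (c • p))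
    (p : S.FormAlg) : P p := by
  obtain ⟨p, rfl⟩ := S.toFormAlg_surjective p
  induction p using poly_induction with
  | prod L =>
    have := prod L
    rw [map_multiset_prod, Multiset.map_map]
    exact this
  | add p q hp hq => rw [map_add]; exact add _ _ hp hq
  | smul c p hp => rw [map_smul]; exact smul _ _ hp

theorem integ_ddc_symm (u v : S.testFun) (p : S.FormAlg) :
    S.integ (S.form (S.ddc u) * p) v = S.integ (S.form (S.ddc v) * p) u := by
  induction p using formAlg_induction with
  | prod L =>
    have := S.wedgeMultiset_cons_ddc u v L
    simpa only [← integ_multiset_prod, Multiset.map_cons, Multiset.prod_cons] using this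
  | add p q hp hq => simp only [mul_add, map_add, _root_.add_apply, hp, hq]
  | smul c p hp => simp only [mul_smul_comm, map_smul, _root_.smul_apply, hp]

/-- The semiring generated by the nonnegative forms, that is, the set of sums of products of
nonnegative forms. -/
def posCone : Subsemiring S.FormAlg := Subsemiring.closure (S.form '' {θ : Z | 0 ≤ θ})

theorem form_mem_posCone {θ : Z} (h : 0 ≤ θ) : S.form θ ∈ S.posCone :=
  Subsemiring.subset_closure ⟨θ, h, rfl⟩

theorem posCone_induction {P : S.FormAlg → Prop}
    (prod : ∀ L : Multiset Z, (∀ θ ∈ L, 0 ≤ θ) → P (L.map S.form).prod)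
    (zero : P 0) (add : ∀ p q, P p → P q → P (p + q)) {p : S.FormAlg} (hp : p ∈ S.posCone) :
    P p := by
  have key : ∀ q ∈ Submonoid.closure (S.form '' {θ : Z | 0 ≤ θ}),
      ∃ L : Multiset Z, (∀ θ ∈ L, 0 ≤ θ) ∧ q = (L.map S.form).prod := by
    intro q hq
    induction hq using Submonoid.closure_induction with
    | mem q hq =>
      obtain ⟨θ, hθ, rfl⟩ := hq
      exact ⟨{θ}, by simpa using hθ, by simp⟩
    | one => exact ⟨0, by simp, by simp⟩
    | mul p q _ _ hp hq =>
      obtain ⟨L, hL, rfl⟩ := hp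
      obtain ⟨M, hM, rfl⟩ := hq
      refine ⟨L + M, fun θ hθ => ?_, by rw [Multiset.map_add, Multiset.prod_add]⟩
      rcases Multiset.mem_add.1 hθ with h | h
      exacts [hL _ h, hM _ h]
  rw [posCone, Subsemiring.mem_closure_iff] at hp
  induction hp using AddSubmonoid.closure_induction with
  | mem q hq =>
    obtain ⟨L, hL, rfl⟩ := key q hq
    exact prod L hL
  | zero => exact zero
  | add p q _ _ hp hq => exact add p q hp hq

theorem integ_nonneg {p : S.FormAlg} (hp : p ∈ S.posCone) {f : C(X, ℝ)} (hf : 0 ≤ f) :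
    0 ≤ S.integ p f := by
  refine S.posCone_induction (P := fun p => 0 ≤ S.integ p f) (fun L hL => ?_) (by simp)
    (fun p q hp hq => ?_) hp
  · rw [integ_multiset_prod]
    exact S.wedgeMultiset_nonneg hL hf
  · rw [map_add, _root_.add_apply]
    exact add_nonneg hp hq

theorem integ_ddc_self_nonpos {p : S.FormAlg} (hp : p ∈ S.posCone) (u : S.testFun) :
    S.integ (S.form (S.ddc u) * p) u ≤ 0 := by
  refine S.posCone_induction (P := fun p => S.integ (S.form (S.ddc u) * p) u ≤ 0)
    (fun L hL => ?_) (by simp) (fun p q hp hq => ?_) hp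
  · have := S.wedgeMultiset_cons_ddc_self u hL
    simpa only [← integ_multiset_prod, Multiset.map_cons, Multiset.prod_cons] using this
  · rw [mul_add, map_add, _root_.add_apply]
    exact add_nonpos hp hq

/-- Translation of the wedge product by `ddᶜ` does not change total masses. -/
theorem integ_ddc_one (u : S.testFun) (p : S.FormAlg) :
    S.integ (S.form (S.ddc u) * p) 1 = 0 := by
  have h := S.integ_ddc_symm u ⟨ContinuousMap.const X 1, S.const_mem 1⟩ p
  rw [S.ddc_const, map_zero, zero_mul, map_zero, _root_.zero_apply] at h
  exact h

end PluripotentialData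

/-! ### Complete homogeneous polynomials in two variables -/

/-- The complete homogeneous polynomial `∑ aʲ bᵏ⁻ʲ` of degree `k`. -/
def homSum {R : Type*} [CommRing R] (a b : R) (k : ℕ) : R :=
  ∑ j ∈ Finset.range (k + 1), a ^ j * b ^ (k - j)

section homSum

variable {R : Type*} [CommRing R] (a b c : R) (k : ℕ)

theorem homSum_zero : homSum a b 0 = 1 := by simp [homSum]

theorem homSum_succ : homSum a b (k + 1) = a * homSum a b k + b ^ (k + 1) := by
  rw [homSum, Finset.sum_range_succ', homSum, Finset.mul_sum]
  congr 1
  · refine Finset.sum_congr rfl fun j _ => ?_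
    rw [Nat.add_sub_add_right]
    ring
  · simp

theorem homSum_comm : homSum a b k = homSum b a k := by
  rw [homSum, ← Finset.sum_range_reflect, homSum]
  refine Finset.sum_congr rfl fun j hj => ?_
  have := Finset.mem_range.1 hj
  rw [show k + 1 - 1 - j = k - j by omega, show k - (k - j) = j by omega, mul_comm]

theorem homSum_succ' : homSum a b (k + 1) = b * homSum a b k + a ^ (k + 1) := by
  rw [homSum_comm, homSum_succ, homSum_comm]

theorem sub_mul_homSum : (a - b) * homSum a b k = a ^ (k + 1) - b ^ (k + 1) := by
  have h1 := homSum_succ a b k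
  have h2 := homSum_succ' a b k
  linear_combination h2 - h1

/-- The identity behind the cocycle formula for the energy: both differences have the same
cofactor, namely the complete homogeneous polynomial in `a`, `b`, `c`. -/
theorem exists_homSum_sub : ∃ h : R, homSum a c k - homSum a b k = (c - b) * h ∧
    homSum b c k - homSum a b k = (c - a) * h := by
  induction k with
  | zero => exact ⟨0, by simp [homSum_zero]⟩
  | succ k ih =>
    obtain ⟨h, h1, h2⟩ := ih
    refine ⟨homSum b c k + a * h, ?_, ?_⟩
    · have := sub_mul_homSum b c k
      rw [homSum_succ, homSum_succ]
      linear_combination a * h1 + this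
    · have := sub_mul_homSum a c k
      rw [homSum_succ, homSum_succ' a b]
      linear_combination (b - c + a) * h2 + (c - a) * h1 + this

/-- The polynomials `G` with `(k + 1) aᵏ - ∑ aʲ bᵏ⁻ʲ = (a - b) G`. -/
def gradSum (a b : R) : ℕ → R
  | 0 => 0
  | k + 1 => a * gradSum a b k + homSum a b k

theorem sub_mul_gradSum : (a - b) * gradSum a b k = (k + 1) * a ^ k - homSum a b k := by
  induction k with
  | zero => simp [gradSum, homSum_zero]
  | succ k ih =>
    have := sub_mul_homSum a b k
    rw [gradSum, homSum_succ]
    push_cast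
    linear_combination a * ih + this

variable {a b} {Q : Subsemiring R} (ha : a ∈ Q) (hb : b ∈ Q)
include ha hb

theorem homSum_mem : homSum a b k ∈ Q :=
  sum_mem fun _ _ => mul_mem (pow_mem ha _) (pow_mem hb _)

theorem gradSum_mem : gradSum a b k ∈ Q := by
  induction k with
  | zero => exact zero_mem _
  | succ k ih => exact add_mem (mul_mem ha ih) (homSum_mem k ha hb)

theorem pow_add_sub_pow_mem : (a + b) ^ k - b ^ k ∈ Q := by
  induction k with
  | zero => simp
  | succ k ih =>
    have : (a + b) ^ (k + 1) - b ^ (k + 1) = a * (a + b) ^ k + b * ((a + b) ^ k - b ^ k) := by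
      ring
    rw [this]
    exact add_mem (mul_mem ha (pow_mem (add_mem ha hb) _)) (mul_mem hb ih)

theorem pow_add_sub_mul_mem (l : ℕ) : (a + b) ^ (k + l) - a ^ k * b ^ l ∈ Q := by
  have h1 := pow_add_sub_pow_mem k hb ha
  have h2 := pow_add_sub_pow_mem l ha hb
  have : (a + b) ^ (k + l) - a ^ k * b ^ l =
      ((b + a) ^ k - a ^ k) * (a + b) ^ l + a ^ k * ((a + b) ^ l - b ^ l) := by ring
  rw [this]
  exact add_mem (mul_mem h1 (pow_mem (add_mem ha hb) _)) (mul_mem (pow_mem ha _) h2)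

theorem homSum_sub_pow_mem : homSum a b k - a ^ k ∈ Q := by
  cases k with
  | zero => simp [homSum_zero]
  | succ k =>
    rw [homSum_succ', add_sub_cancel_right]
    exact mul_mem hb (homSum_mem k ha hb)

theorem pow_add_sub_homSum_mem : (a + b) ^ k - homSum a b k ∈ Q := by
  induction k with
  | zero => simp [homSum_zero]
  | succ k ih =>
    have : (a + b) ^ (k + 1) - homSum a b (k + 1) =
        a * ((a + b) ^ k - homSum a b k) + b * ((a + b) ^ k - b ^ k) := by
      rw [homSum_succ]
      ring
    rw [this]
    exact add_mem (mul_mem ha ih) (mul_mem hb (pow_add_sub_pow_mem k ha hb))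

theorem two_pow_mul_homSum_sub_mem : 2 ^ k * homSum a b k - (a + b) ^ k ∈ Q := by
  induction k with
  | zero => simp [homSum_zero]
  | succ k ih =>
    have : 2 ^ (k + 1) * homSum a b (k + 1) - (a + b) ^ (k + 1) =
        (a + b) * (2 ^ k * homSum a b k - (a + b) ^ k) + 2 ^ k * (a ^ (k + 1) + b ^ (k + 1)) := by
      have h1 := homSum_succ a b k
      have h2 := homSum_succ' a b k
      linear_combination 2 ^ k * (h1 + h2)
    rw [this]
    exact add_mem (mul_mem (add_mem ha hb) ih)
      (mul_mem (by simpa using natCast_mem Q (2 ^ k))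
        (add_mem (pow_mem ha _) (pow_mem hb _)))

theorem gradSum_sub_homSum_mem : gradSum a b (k + 1) - homSum a b k ∈ Q := by
  rw [gradSum, add_sub_cancel_right]
  exact mul_mem ha (gradSum_mem k ha hb)

theorem natCast_mul_homSum_sub_gradSum_mem :
    ((k : R) + 1) * homSum a b k - gradSum a b (k + 1) ∈ Q := by
  induction k with
  | zero => simp [homSum_zero, gradSum]
  | succ k ih =>
    have : ((k + 1 : ℕ) + 1 : R) * homSum a b (k + 1) - gradSum a b (k + 1 + 1) =
        a * (((k : R) + 1) * homSum a b k - gradSum a b (k + 1)) + (k + 1 : ℕ) * b ^ (k + 1) := by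
      rw [gradSum, homSum_succ]
      push_cast
      ring
    rw [this]
    exact add_mem (mul_mem ha ih) (mul_mem (natCast_mem _ _) (pow_mem hb _))

end homSum

/-! ### Total masses -/

theorem prod_add_sub_prod_mem {R ι : Type*} [CommRing R] {Q : Subsemiring R} (s : Finset ι)
    {f g : ι → R} (hf : ∀ i, f i ∈ Q) (hg : ∀ i, g i ∈ Q) :
    ∏ i ∈ s, (f i + g i) - ∏ i ∈ s, f i ∈ Q := by
  classical
  induction s using Finset.induction_on with
  | empty => simp
  | insert a s ha ih =>
    have : ∏ i ∈ insert a s, (f i + g i) - ∏ i ∈ insert a s, f i =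
        f a * (∏ i ∈ s, (f i + g i) - ∏ i ∈ s, f i) + g a * ∏ i ∈ s, (f i + g i) := by
      rw [Finset.prod_insert ha, Finset.prod_insert ha]
      ring
    rw [this]
    exact add_mem (mul_mem (hf a) ih)
      (mul_mem (hg a) (prod_mem fun i _ => add_mem (hf i) (hg i)))

theorem continuous_sub_smul_finestTopology {V : Type*} [AddCommGroup V] [Module ℝ V] (a b : V) :
    @Continuous ℝ V _ (finestTopology V) fun t => a - t • b := by
  let W : Submodule ℝ V := Submodule.span ℝ {a, b}
  have hW : FiniteDimensional ℝ W := FiniteDimensional.span_of_finite ℝ (by simp)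
  let a' : W := ⟨a, Submodule.subset_span (by simp)⟩
  let b' : W := ⟨b, Submodule.subset_span (by simp)⟩
  let : TopologicalSpace W := moduleTopology ℝ W
  have : IsModuleTopology ℝ W := ⟨rfl⟩
  have : ContinuousSMul ℝ W := IsModuleTopology.toContinuousSMul ℝ W
  have : IsTopologicalAddGroup W := IsModuleTopology.topologicalAddGroup ℝ W
  have h1 : Continuous fun t : ℝ => a' - t • b' := by fun_prop
  have h2 : @Continuous W V _ (finestTopology V) Subtype.val := by
    rw [continuous_iff_coinduced_le]
    exact le_iSup (fun W : {W : Submodule ℝ V // FiniteDimensional ℝ W} =>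
      TopologicalSpace.coinduced (Subtype.val : W.1 → V) (moduleTopology ℝ W.1)) ⟨W, hW⟩
  let := finestTopology V
  exact h2.comp h1

theorem abs_apply_le_of_nonneg {X : Type*} [TopologicalSpace X] [CompactSpace X]
    {μ : C(X, ℝ) →L[ℝ] ℝ} (hμ : ∀ f, 0 ≤ f → 0 ≤ μ f) (f : C(X, ℝ)) : |μ f| ≤ ‖f‖ * μ 1 := by
  have h : ∀ g : C(X, ℝ), ‖g‖ = ‖f‖ → μ g ≤ ‖f‖ * μ 1 := by
    intro g hg
    have h1 := hμ (‖f‖ • 1 - g) fun x => by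
      have := (le_abs_self _).trans (g.norm_coe_le_norm x)
      simpa [hg] using this
    rw [map_sub, map_smul, smul_eq_mul] at h1
    linarith
  refine abs_le.2 ⟨?_, h f rfl⟩
  have := h (-f) (norm_neg f)
  rw [map_neg] at this
  linarith

namespace PluripotentialData

variable {X : Type*} [TopologicalSpace X] [CompactSpace X]
  {Z : Type*} [AddCommGroup Z] [Module ℝ Z] [PartialOrder Z] [IsOrderedAddMonoid Z]
  [IsOrderedModule ℝ Z]

theorem exists_nonneg_sub {n : ℕ} (S : PluripotentialData X Z n) (θ : Z) :
    ∃ θ₁ θ₂ : Z, 0 ≤ θ₁ ∧ 0 ≤ θ₂ ∧ θ = θ₁ - θ₂ := by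
  have h : θ ∈ Submodule.span ℝ {θ : Z | 0 ≤ θ} := by rw [S.span_nonneg]; trivial
  induction h using Submodule.span_induction with
  | mem x hx => exact ⟨x, 0, hx, le_rfl, by simp⟩
  | zero => exact ⟨0, 0, le_rfl, le_rfl, by simp⟩
  | add x y _ _ hx hy =>
    obtain ⟨a, b, ha, hb, rfl⟩ := hx
    obtain ⟨c, d, hc, hd, rfl⟩ := hy
    exact ⟨a + c, b + d, add_nonneg ha hc, add_nonneg hb hd, by abel⟩
  | smul c x _ hx =>
    obtain ⟨a, b, ha, hb, rfl⟩ := hx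
    rcases le_total 0 c with h | h
    · exact ⟨c • a, c • b, smul_nonneg h ha, smul_nonneg h hb, smul_sub _ _ _⟩
    · refine ⟨(-c) • b, (-c) • a, smul_nonneg (neg_nonneg.2 h) hb,
        smul_nonneg (neg_nonneg.2 h) ha, ?_⟩
      rw [smul_sub, neg_smul, neg_smul]
      abel

theorem exists_pos_wedge {n : ℕ} (S : PluripotentialData X Z n) :
    ∃ θ : Fin n → Z, (∀ i, 0 ≤ θ i) ∧ 0 < S.wedge θ 1 := by
  by_contra! hcon
  refine S.wedge_ne_zero (Module.Basis.ext_multilinear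
    (fun _ => Module.Basis.ofSpan S.span_nonneg.ge) fun v => ?_)
  have hv : ∀ i, 0 ≤ Module.Basis.ofSpan S.span_nonneg.ge (v i) := fun i =>
    Module.Basis.ofSpan_subset S.span_nonneg.ge ⟨v i, rfl⟩
  have hp := S.wedge_nonneg (fun i => Module.Basis.ofSpan S.span_nonneg.ge (v i)) hv
  have h1 := le_antisymm (hcon _ hv) (hp 1 zero_le_one)
  ext f
  have h2 := abs_apply_le_of_nonneg hp f
  rw [h1, mul_zero] at h2
  simpa using abs_nonpos_iff.1 h2

/-- As `[ω]` is an interior point, a positive multiple of any form can be subtracted from some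
`ω_φ` without losing nonnegativity. -/
theorem exists_twist_ge {n : ℕ} (S : PluripotentialData X Z n) {ω : Z}
    (h : S.bcClass ω ∈ S.Pos) (θ : Z) :
    ∃ t : ℝ, 0 < t ∧ ∃ φ : S.testFun, 0 ≤ S.twist ω φ - t • θ := by
  let := finestTopology S.BottChern
  have hc : Continuous fun t : ℝ => S.bcClass ω - t • S.bcClass θ := continuous_sub_smul_finestTopology _ _
  have h0 : ∀ᶠ t in 𝓝 (0 : ℝ), S.bcClass ω - t • S.bcClass θ ∈ S.Pos :=
    hc.continuousAt.preimage_mem_nhds (isOpen_interior.mem_nhds (by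
      rw [zero_smul, sub_zero]
      exact h))
  obtain ⟨t, ht, ht0⟩ := ((h0.filter_mono nhdsWithin_le_nhds).and
    (self_mem_nhdsWithin : Set.Ioi (0 : ℝ) ∈ 𝓝[>] 0)).exists
  obtain ⟨η, hη, hηt⟩ := interior_subset ht
  have h3 : S.bcClass η = S.bcClass (ω - t • θ) := by
    rw [hηt, bcClass, bcClass, bcClass, map_sub, map_smul]
  obtain ⟨φ, hφ⟩ := (Submodule.Quotient.eq _).1 h3
  refine ⟨t, ht0, φ, ?_⟩
  have : S.twist ω φ - t • θ = η := by
    rw [twist, hφ]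
    abel
  rw [this]
  exact hη

variable {m : ℕ} (S : PluripotentialData X Z (m + 1))

/-- The operator `ddᶜ` with values in the algebra of forms. -/
def ddcForm : S.testFun →ₗ[ℝ] S.FormAlg := S.form ∘ₗ S.ddc

/-- The form `ω_φ` as an element of the algebra of forms. -/
def twistForm (ω : Z) (φ : S.testFun) : S.FormAlg := S.form (S.twist ω φ)

theorem twistForm_eq (ω : Z) (φ : S.testFun) :
    S.twistForm ω φ = S.form ω + S.ddcForm φ := map_add _ _ _

theorem twistForm_sub (ω : Z) (φ ψ : S.testFun) :
    S.twistForm ω φ - S.twistForm ω ψ = S.ddcForm (φ - ψ) := by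
  rw [twistForm_eq, twistForm_eq, map_sub]
  abel

theorem integ_wedge_const (θ : Z) : S.integ (S.form θ ^ (m + 1)) = S.wedge fun _ => θ := by
  rw [← integ_prod]
  simp

theorem integ_mixed (α β : Z) {j : ℕ} (hj : j ≤ m + 1) :
    S.integ (S.form α ^ j * S.form β ^ (m + 1 - j)) = S.mixed α β j := by
  rw [mixed, ← integ_prod]
  congr 1
  simp only [apply_ite S.form, Finset.prod_ite, Finset.prod_const, not_lt]
  have h1 := Fin.card_filter_val_lt (n := m + 1) (m := j)
  rw [min_eq_right hj] at h1
  have h2 := Finset.card_filter_add_card_filter_not (s := (Finset.univ : Finset (Fin (m + 1))))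
    (fun i => (i : ℕ) < j)
  simp only [not_lt, Finset.card_univ, Fintype.card_fin] at h2
  rw [h1, show (Finset.univ.filter fun i : Fin (m + 1) => j ≤ (i : ℕ)).card = m + 1 - j by omega]

/-- The volume depends only on the class of `ω`. -/
theorem integ_twistForm_pow_one (ω : Z) (φ : S.testFun) :
    S.integ (S.twistForm ω φ ^ (m + 1)) 1 = S.vol ω := by
  obtain ⟨p, hp⟩ := sub_dvd_pow_sub_pow (S.twistForm ω φ) (S.form ω) (m + 1)
  have h1 : S.twistForm ω φ - S.form ω = S.form (S.ddc φ) := by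
    rw [twistForm_eq, add_sub_cancel_left]; rfl
  have h2 := S.integ_ddc_one φ p
  rw [← h1, ← hp, map_sub, integ_wedge_const, _root_.sub_apply] at h2
  exact sub_eq_zero.1 h2

/-- As some product of nonnegative forms `θᵢ` has positive mass, so does `ω_φ ^ n` as soon as
`ω_φ` dominates a positive multiple of `∑ θᵢ`. -/
theorem vol_pos {ω : Z} (h : S.bcClass ω ∈ S.Pos) : 0 < S.vol ω := by
  obtain ⟨θ, hθ, hpos⟩ := S.exists_pos_wedge
  obtain ⟨t, ht, φ, hφ⟩ := S.exists_twist_ge h (∑ i, θ i)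
  have hle : ∀ i, 0 ≤ S.twist ω φ - t • θ i := fun i => hφ.trans
    (sub_le_sub_left (smul_le_smul_of_nonneg_left
      (Finset.single_le_sum (fun j _ => hθ j) (Finset.mem_univ i)) ht.le) _)
  have h1 := prod_add_sub_prod_mem (Q := S.posCone) Finset.univ
    (f := fun i => S.form (t • θ i)) (g := fun i => S.form (S.twist ω φ - t • θ i))
    (fun i => S.form_mem_posCone (smul_nonneg ht.le (hθ i))) (fun i => S.form_mem_posCone (hle i))
  have h2 := S.integ_nonneg h1 zero_le_one
  simp only [← map_add, add_sub_cancel] at h2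
  rw [map_sub, integ_prod, integ_prod, S.wedge.map_smul_univ, ← integ_wedge_const,
    _root_.sub_apply, _root_.smul_apply] at h2
  rw [← S.integ_twistForm_pow_one ω φ, twistForm]
  have h3 : 0 < (∏ _i : Fin (m + 1), t) • (S.wedge θ) 1 :=
    mul_pos (Finset.prod_pos fun _ _ => ht) hpos
  linarith

end PluripotentialData

namespace PluripotentialData

variable {X : Type*} [TopologicalSpace X] [CompactSpace X]
  {Z : Type*} [AddCommGroup Z] [Module ℝ Z] [PartialOrder Z] [IsOrderedAddMonoid Z]
  [IsOrderedModule ℝ Z]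
variable {m : ℕ} (S : PluripotentialData X Z (m + 1))

/-! ### Dirichlet forms -/

/-- The signed measure defined by an element of the algebra of forms, normalized by `V_ω`. -/
def avg (ω : Z) : S.FormAlg →ₗ[ℝ] (C(X, ℝ) →L[ℝ] ℝ) := (S.vol ω)⁻¹ • S.integ

/-- The Dirichlet form `(u, v) ↦ -V_ω⁻¹ ∫ v ddᶜu ∧ p`, which depends linearly on `p`. -/
def gradForm (ω : Z) : S.FormAlg →ₗ[ℝ] S.testFun →ₗ[ℝ] S.testFun →ₗ[ℝ] ℝ where
  toFun p := LinearMap.mk₂ ℝ (fun u v => -S.avg ω (S.ddcForm u * p) v)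
    (fun u v w => by simp only [map_add, add_mul, _root_.add_apply]; ring)
    (fun c u w => by simp only [map_smul, smul_mul_assoc, _root_.smul_apply, smul_eq_mul]; ring)
    (fun u v w => by simp only [Submodule.coe_add, map_add]; ring)
    (fun c u w => by simp only [Submodule.coe_smul, map_smul, smul_eq_mul]; ring)
  map_add' p q := LinearMap.ext fun u => LinearMap.ext fun v => by
    change -S.avg ω (S.ddcForm u * (p + q)) v =
      -S.avg ω (S.ddcForm u * p) v + -S.avg ω (S.ddcForm u * q) v
    rw [mul_add, map_add, _root_.add_apply]
    ring
  map_smul' c p := LinearMap.ext fun u => LinearMap.ext fun v => by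
    change -S.avg ω (S.ddcForm u * (c • p)) v = c * -S.avg ω (S.ddcForm u * p) v
    rw [mul_smul_comm, map_smul, _root_.smul_apply, smul_eq_mul]
    ring

variable {S} {ω : Z}

theorem avg_ddcForm_mul (u v : S.testFun) (p : S.FormAlg) :
    S.avg ω (S.ddcForm u * p) v = -S.gradForm ω p u v := by
  simp [gradForm]

theorem avg_ddcForm_mul_one (u : S.testFun) (p : S.FormAlg) :
    S.avg ω (S.ddcForm u * p) 1 = 0 := by
  simp [avg, ddcForm, integ_ddc_one]

theorem avg_twistForm_pow_one (h : 0 < S.vol ω) (φ : S.testFun) :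
    S.avg ω (S.twistForm ω φ ^ (m + 1)) 1 = 1 := by
  simp [avg, integ_twistForm_pow_one, h.ne']

theorem gradForm_symm (p : S.FormAlg) (u v : S.testFun) :
    S.gradForm ω p u v = S.gradForm ω p v u := by
  simp [gradForm, avg, ddcForm, S.integ_ddc_symm u v]

/-- The triple form `(u, v, w) ↦ -∫ w ddᶜu ∧ ddᶜv ∧ p` is symmetric in `u` and `v`. -/
theorem gradForm_ddcForm_mul (p : S.FormAlg) (u v w : S.testFun) :
    S.gradForm ω (S.ddcForm v * p) u w = S.gradForm ω (S.ddcForm u * p) v w := by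
  simp only [gradForm, LinearMap.coe_mk, AddHom.coe_mk, LinearMap.mk₂_apply, mul_left_comm]

theorem twistForm_mem {φ : S.testFun} (hφ : φ ∈ S.psh ω) : S.twistForm ω φ ∈ S.posCone :=
  S.form_mem_posCone hφ

theorem vol_nonneg (hω : 0 ≤ ω) : 0 ≤ S.vol ω := S.wedge_nonneg _ (fun _ => hω) 1 zero_le_one

theorem avg_nonneg (hω : 0 ≤ ω) {p : S.FormAlg} (hp : p ∈ S.posCone) {f : C(X, ℝ)}
    (hf : 0 ≤ f) : 0 ≤ S.avg ω p f :=
  mul_nonneg (inv_nonneg.2 (vol_nonneg hω)) (S.integ_nonneg hp hf)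

theorem gradForm_nonneg (hω : 0 ≤ ω) {p : S.FormAlg} (hp : p ∈ S.posCone) (u : S.testFun) :
    0 ≤ S.gradForm ω p u u := by
  have h : S.gradForm ω p u u = (S.vol ω)⁻¹ * -S.integ (S.form (S.ddc u) * p) u := by
    simp [gradForm, avg, ddcForm]
  rw [h]
  exact mul_nonneg (inv_nonneg.2 (vol_nonneg hω))
    (neg_nonneg.2 (S.integ_ddc_self_nonpos hp u))

theorem gradForm_mono (hω : 0 ≤ ω) {p q : S.FormAlg} (h : q - p ∈ S.posCone) (u : S.testFun) :
    S.gradForm ω p u u ≤ S.gradForm ω q u u := by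
  have := gradForm_nonneg hω h u
  rw [map_sub, LinearMap.sub_apply, LinearMap.sub_apply] at this
  linarith

theorem abs_gradForm_le (hω : 0 ≤ ω) {p : S.FormAlg} (hp : p ∈ S.posCone) (u v : S.testFun) :
    |S.gradForm ω p u v| ≤ √(S.gradForm ω p u u) * √(S.gradForm ω p v v) := by
  rw [← Real.sqrt_mul (gradForm_nonneg hω hp u)]
  refine Real.abs_le_sqrt ?_
  have := LinearMap.BilinForm.apply_mul_apply_le_of_forall_zero_le (S.gradForm ω p)
    (gradForm_nonneg hω hp) u v
  rwa [gradForm_symm p v u, ← sq] at this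

/-! ### The Monge--Ampère energy and the Dirichlet functional -/

theorem MA_eq_avg (φ : S.testFun) : S.MA ω φ = S.avg ω (S.twistForm ω φ ^ (m + 1)) := by
  rw [MA, avg, LinearMap.smul_apply, twistForm, integ_wedge_const]

theorem energy_eq_avg (φ : S.testFun) : S.energy ω φ =
    ((m : ℝ) + 2)⁻¹ * S.avg ω (homSum (S.twistForm ω φ) (S.form ω) (m + 1)) φ := by
  have hm : ((m + 1 : ℕ) : ℝ) + 1 = m + 2 := by push_cast; ring
  rw [energy, hm, homSum, map_sum, _root_.sum_apply]
  congr 1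
  refine Finset.sum_congr rfl fun j hj => ?_
  rw [← S.integ_mixed _ _ (Nat.lt_succ_iff.1 (Finset.mem_range.1 hj)), avg, LinearMap.smul_apply,
    _root_.smul_apply, smul_eq_mul, twistForm]

theorem energy_zero : S.energy ω 0 = 0 := by
  rw [energy_eq_avg, Submodule.coe_zero, map_zero, mul_zero]

/-- The cocycle formula for the energy, which follows from integration by parts. -/
theorem energy_sub (φ ψ : S.testFun) : S.energy ω φ - S.energy ω ψ =
    ((m : ℝ) + 2)⁻¹ * S.avg ω (homSum (S.twistForm ω φ) (S.twistForm ω ψ) (m + 1))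
      ((φ - ψ : S.testFun) : C(X, ℝ)) := by
  obtain ⟨h, h1, h2⟩ := exists_homSum_sub (S.twistForm ω φ) (S.twistForm ω ψ) (S.form ω) (m + 1)
  have hφ : S.form ω - S.twistForm ω φ = -S.ddcForm φ := by rw [twistForm_eq]; abel
  have hψ : S.form ω - S.twistForm ω ψ = -S.ddcForm ψ := by rw [twistForm_eq]; abel
  have e1 := congrArg (fun p => S.avg ω p φ) h1
  have e2 := congrArg (fun p => S.avg ω p ψ) h2
  simp only [hφ, hψ, neg_mul, map_sub, map_neg, _root_.sub_apply, _root_.neg_apply,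
    avg_ddcForm_mul] at e1 e2
  rw [gradForm_symm] at e1
  rw [energy_eq_avg, energy_eq_avg, Submodule.coe_sub, map_sub]
  linear_combination ((m : ℝ) + 2)⁻¹ * (e1 - e2)

theorem dirichlet_eq_gradForm (φ ψ : S.testFun) : S.dirichlet ω φ ψ =
    ((m : ℝ) + 2)⁻¹ * S.gradForm ω (gradSum (S.twistForm ω φ) (S.twistForm ω ψ) (m + 1))
      (φ - ψ) (φ - ψ) := by
  have h1 := sub_mul_gradSum (S.twistForm ω φ) (S.twistForm ω ψ) (m + 1)
  have hm : (((m + 1 : ℕ) : S.FormAlg) + 1) * S.twistForm ω φ ^ (m + 1) =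
      ((m : ℝ) + 2) • S.twistForm ω φ ^ (m + 1) := by
    rw [Algebra.smul_def, map_add, map_natCast, map_ofNat]
    push_cast
    ring
  rw [twistForm_sub, hm] at h1
  have e1 := congrArg (fun p => S.avg ω p ((φ - ψ : S.testFun) : C(X, ℝ))) h1
  rw [avg_ddcForm_mul, map_sub (S.avg ω), map_smul (S.avg ω), _root_.sub_apply, _root_.smul_apply,
    smul_eq_mul] at e1
  have h2 : ((ψ - φ : S.testFun) : C(X, ℝ)) = -((φ - ψ : S.testFun) : C(X, ℝ)) := by
    rw [← Submodule.coe_neg, neg_sub]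
  have hm' : ((m : ℝ) + 2)⁻¹ * (m + 2) = 1 := inv_mul_cancel₀ (by positivity)
  rw [dirichlet, energy_sub, MA_eq_avg, h2, map_neg]
  linear_combination ((m : ℝ) + 2)⁻¹ * e1 +
    hm' * S.avg ω (S.twistForm ω φ ^ (m + 1)) ((φ - ψ : S.testFun) : C(X, ℝ))

/-- A symmetric variant of the Dirichlet functional: the Dirichlet form of
`(ω_φ + ω_ψ) ^ (n - 1)` on `φ - ψ`. -/
def symDirichlet (S : PluripotentialData X Z (m + 1)) (ω : Z) (φ ψ : S.testFun) : ℝ :=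
  S.gradForm ω ((S.twistForm ω φ + S.twistForm ω ψ) ^ m) (φ - ψ) (φ - ψ)

/-- The constant in the comparison of `dirichlet` and `symDirichlet`. -/
def compConst (m : ℕ) : ℝ := 2 ^ m * (m + 2)

theorem one_le_compConst (m : ℕ) : 1 ≤ compConst m := by
  have h1 : (1 : ℝ) ≤ 2 ^ m := one_le_pow₀ one_le_two
  have h2 : (0 : ℝ) ≤ m := Nat.cast_nonneg m
  unfold compConst
  nlinarith

theorem symDirichlet_comm (φ ψ : S.testFun) :
    S.symDirichlet ω φ ψ = S.symDirichlet ω ψ φ := by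
  rw [symDirichlet, symDirichlet, add_comm (S.twistForm ω φ), ← neg_sub ψ φ]
  simp only [map_neg, LinearMap.neg_apply, neg_neg]

section psh

variable (hω : 0 ≤ ω) {φ ψ τ : S.testFun} (hφ : φ ∈ S.psh ω) (hψ : ψ ∈ S.psh ω)
include hω hφ hψ

theorem symDirichlet_nonneg : 0 ≤ S.symDirichlet ω φ ψ :=
  gradForm_nonneg hω (pow_mem (add_mem (twistForm_mem hφ) (twistForm_mem hψ)) _) _

theorem dirichlet_le_symDirichlet : S.dirichlet ω φ ψ ≤ S.symDirichlet ω φ ψ := by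
  have ha := twistForm_mem hφ
  have hb := twistForm_mem hψ
  have h1 := gradForm_mono hω (natCast_mul_homSum_sub_gradSum_mem m ha hb) (φ - ψ)
  have h2 := gradForm_mono hω (pow_add_sub_homSum_mem m ha hb) (φ - ψ)
  have h3 := gradForm_nonneg hω (homSum_mem m ha hb) (φ - ψ)
  have hm : ((m : S.FormAlg) + 1) * homSum (S.twistForm ω φ) (S.twistForm ω ψ) m =
      ((m : ℝ) + 1) • homSum (S.twistForm ω φ) (S.twistForm ω ψ) m := by
    rw [Algebra.smul_def, map_add, map_natCast, map_one]
  rw [hm, map_smul, LinearMap.smul_apply, LinearMap.smul_apply, smul_eq_mul] at h1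
  rw [dirichlet_eq_gradForm, inv_mul_le_iff₀ (by positivity)]
  refine h1.trans ?_
  rw [symDirichlet]
  refine mul_le_mul (by linarith) h2 h3 (by positivity)

/-- A lower bound for the Dirichlet functional by one term of its expansion. -/
theorem gradForm_pow_le_dirichlet :
    S.gradForm ω (S.twistForm ω φ ^ m) (φ - ψ) (φ - ψ) ≤ (m + 2) * S.dirichlet ω φ ψ := by
  have ha := twistForm_mem hφ
  have hb := twistForm_mem hψ
  have h1 := gradForm_mono hω (gradSum_sub_homSum_mem m ha hb) (φ - ψ)
  have h2 := gradForm_mono hω (homSum_sub_pow_mem m ha hb) (φ - ψ)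
  rw [dirichlet_eq_gradForm, mul_inv_cancel_left₀ (by positivity)]
  exact h2.trans h1

theorem symDirichlet_le_dirichlet :
    S.symDirichlet ω φ ψ ≤ compConst m * S.dirichlet ω φ ψ := by
  have ha := twistForm_mem hφ
  have hb := twistForm_mem hψ
  have h1 := gradForm_mono hω (gradSum_sub_homSum_mem m ha hb) (φ - ψ)
  have h2 := gradForm_mono hω (two_pow_mul_homSum_sub_mem m ha hb) (φ - ψ)
  have hm : 2 ^ m * homSum (S.twistForm ω φ) (S.twistForm ω ψ) m =
      (2 ^ m : ℝ) • homSum (S.twistForm ω φ) (S.twistForm ω ψ) m := by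
    rw [Algebra.smul_def, map_pow, map_ofNat]
  rw [hm, map_smul, LinearMap.smul_apply, LinearMap.smul_apply, smul_eq_mul] at h2
  rw [dirichlet_eq_gradForm, compConst, mul_assoc, mul_inv_cancel_left₀ (by positivity)]
  exact h2.trans (mul_le_mul_of_nonneg_left h1 (by positivity))

theorem dirichlet_nonneg : 0 ≤ S.dirichlet ω φ ψ := by
  have h1 := symDirichlet_nonneg hω hφ hψ
  have h2 := symDirichlet_le_dirichlet hω hφ hψ
  exact nonneg_of_mul_nonneg_right (h1.trans h2) (by linarith [one_le_compConst m])

omit hω in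
theorem midpoint_mem_psh : (2⁻¹ : ℝ) • (φ + ψ) ∈ S.psh ω := by
  have h : S.twist ω ((2⁻¹ : ℝ) • (φ + ψ)) = (2⁻¹ : ℝ) • (S.twist ω φ + S.twist ω ψ) := by
    simp only [twist, map_smul, map_add, smul_add]
    have : ω = (2⁻¹ : ℝ) • ω + (2⁻¹ : ℝ) • ω := by rw [← add_smul]; norm_num
    nth_rewrite 1 [this]
    abel
  change 0 ≤ S.twist ω _
  rw [h]
  exact smul_nonneg (by norm_num) (add_nonneg hφ hψ)

omit hω hφ hψ in
theorem twistForm_midpoint (φ ψ : S.testFun) :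
    S.twistForm ω φ + S.twistForm ω ψ = 2 * S.twistForm ω ((2⁻¹ : ℝ) • (φ + ψ)) := by
  have : (2 : S.FormAlg) * (2⁻¹ : ℝ) • (S.ddcForm φ + S.ddcForm ψ) =
      S.ddcForm φ + S.ddcForm ψ := by
    rw [mul_smul_comm, two_mul, ← two_smul ℝ, smul_smul]
    norm_num
  rw [twistForm_eq, twistForm_eq, twistForm_eq, map_smul, map_add]
  linear_combination -this

theorem symDirichlet_le_dirichlet_midpoint :
    S.symDirichlet ω φ ψ ≤ 4 * compConst m * S.dirichlet ω ((2⁻¹ : ℝ) • (φ + ψ)) φ := by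
  have h1 := gradForm_pow_le_dirichlet hω (midpoint_mem_psh hφ hψ) hφ
  have h2 : (2⁻¹ : ℝ) • (φ + ψ) - φ = (-2⁻¹ : ℝ) • (φ - ψ) := by
    module
  have h3 : ((2 : S.FormAlg) * S.twistForm ω ((2⁻¹ : ℝ) • (φ + ψ))) ^ m =
      (2 ^ m : ℝ) • S.twistForm ω ((2⁻¹ : ℝ) • (φ + ψ)) ^ m := by
    rw [mul_pow, Algebra.smul_def, map_pow, map_ofNat]
  rw [h2] at h1
  simp only [map_smul, LinearMap.smul_apply, smul_eq_mul] at h1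
  rw [symDirichlet, twistForm_midpoint, h3, map_smul, LinearMap.smul_apply, LinearMap.smul_apply,
    smul_eq_mul, compConst]
  have h4 : (0 : ℝ) < 2 ^ m := by positivity
  nlinarith

/-- The Monge--Ampère energy is uniformly concave. -/
theorem symDirichlet_le_energy_midpoint : S.symDirichlet ω φ ψ ≤ 2 * compConst m *
    (2 * S.energy ω ((2⁻¹ : ℝ) • (φ + ψ)) - S.energy ω φ - S.energy ω ψ) := by
  have h1 := symDirichlet_le_dirichlet_midpoint hω hφ hψ
  have h2 := symDirichlet_le_dirichlet_midpoint hω hψ hφ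
  rw [symDirichlet_comm, add_comm ψ φ] at h2
  have h3 : ((φ - (2⁻¹ : ℝ) • (φ + ψ) : S.testFun) : C(X, ℝ)) =
      -((ψ - (2⁻¹ : ℝ) • (φ + ψ) : S.testFun) : C(X, ℝ)) := by
    rw [← Submodule.coe_neg]
    congr 1
    module
  have h4 : S.dirichlet ω ((2⁻¹ : ℝ) • (φ + ψ)) φ + S.dirichlet ω ((2⁻¹ : ℝ) • (φ + ψ)) ψ =
      2 * S.energy ω ((2⁻¹ : ℝ) • (φ + ψ)) - S.energy ω φ - S.energy ω ψ := by
    rw [dirichlet, dirichlet, h3, map_neg]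
    ring
  rw [← h4]
  linarith

/-- Near-maximizers of `E_ω - μ` are close to each other. -/
theorem symDirichlet_le_of_forall {μ : C(X, ℝ) →L[ℝ] ℝ} {M : ℝ}
    (hM : ∀ τ ∈ S.psh ω, S.energy ω τ - μ τ ≤ M) : S.symDirichlet ω φ ψ ≤
      2 * compConst m * ((M - (S.energy ω φ - μ φ)) + (M - (S.energy ω ψ - μ ψ))) := by
  have h1 := symDirichlet_le_energy_midpoint hω hφ hψ
  have h2 := hM _ (midpoint_mem_psh hφ hψ)
  have h3 : μ (((2⁻¹ : ℝ) • (φ + ψ) : S.testFun) : C(X, ℝ)) = 2⁻¹ * (μ φ + μ ψ) := by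
    simp [mul_add]
  rw [h3] at h2
  have h4 := one_le_compConst m
  refine h1.trans (mul_le_mul_of_nonneg_left ?_ (by linarith))
  linarith

theorem symDirichlet_triangle (hτ : τ ∈ S.psh ω) : S.symDirichlet ω φ ψ ≤
    2 * compConst m * (S.symDirichlet ω φ τ + S.symDirichlet ω τ ψ) := by
  have h1 := symDirichlet_le_of_forall hω hφ hψ (μ := S.MA ω τ)
    (M := S.energy ω τ - S.MA ω τ τ) (fun σ hσ => by
      have := dirichlet_nonneg hω hτ hσ
      rw [dirichlet, Submodule.coe_sub, map_sub] at this
      linarith)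
  have h2 := dirichlet_le_symDirichlet hω hτ hφ
  have h3 := dirichlet_le_symDirichlet hω hτ hψ
  have h4 := one_le_compConst m
  rw [symDirichlet_comm φ τ]
  refine h1.trans (mul_le_mul_of_nonneg_left ?_ (by linarith))
  rw [dirichlet, Submodule.coe_sub, map_sub] at h2 h3
  linarith

theorem dirichlet_zero_midpoint_le :
    S.dirichlet ω 0 ((2⁻¹ : ℝ) • (φ + ψ)) ≤ 2⁻¹ * (S.dirichlet ω 0 φ + S.dirichlet ω 0 ψ) := by
  have h1 := symDirichlet_le_energy_midpoint hω hφ hψ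
  have h2 := symDirichlet_nonneg hω hφ hψ
  have h3 := nonneg_of_mul_nonneg_right (h2.trans h1) (by linarith [one_le_compConst m])
  simp only [dirichlet, sub_zero, energy_zero, Submodule.coe_smul, Submodule.coe_add, map_smul,
    map_add, smul_eq_mul]
  linarith

/-- Differences of Monge--Ampère measures are controlled by the Dirichlet functional. -/
theorem abs_MA_sub_MA_le (f : S.testFun) : |(S.MA ω φ - S.MA ω ψ) f| ≤
    √(S.symDirichlet ω φ ψ) *
      √(S.gradForm ω ((S.twistForm ω φ + S.twistForm ω ψ) ^ m) f f) := by
  have ha := twistForm_mem hφ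
  have hb := twistForm_mem hψ
  have h1 : (S.MA ω φ - S.MA ω ψ) f =
      -S.gradForm ω (homSum (S.twistForm ω φ) (S.twistForm ω ψ) m) (φ - ψ) f := by
    rw [MA_eq_avg, MA_eq_avg, ← map_sub, ← sub_mul_homSum, twistForm_sub, avg_ddcForm_mul]
  rw [h1, abs_neg]
  refine (abs_gradForm_le hω (homSum_mem m ha hb) _ _).trans ?_
  exact mul_le_mul (Real.sqrt_le_sqrt (gradForm_mono hω (pow_add_sub_homSum_mem m ha hb) _))
    (Real.sqrt_le_sqrt (gradForm_mono hω (pow_add_sub_homSum_mem m ha hb) _))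
    (Real.sqrt_nonneg _) (Real.sqrt_nonneg _)

end psh

theorem zero_mem_psh (hω : 0 ≤ ω) : (0 : S.testFun) ∈ S.psh ω := by
  change 0 ≤ S.twist ω 0
  simpa [twist] using hω

/-- A test function `f` has uniformly bounded Dirichlet norm. -/
theorem exists_gradForm_le (hω : 0 ≤ ω) (f : S.testFun) : ∃ A : ℝ, ∀ φ ∈ S.psh ω, ∀ ψ ∈ S.psh ω,
    S.gradForm ω ((S.twistForm ω φ + S.twistForm ω ψ) ^ m) f f ≤ A := by
  obtain ⟨θ₁, θ₂, h₁, h₂, hf⟩ := S.exists_nonneg_sub (S.ddc f)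
  refine ⟨‖(f : C(X, ℝ))‖ * S.avg ω ((S.form θ₁ + S.form θ₂) * (2 * S.form ω) ^ m) 1,
    fun φ hφ ψ hψ => ?_⟩
  have hp := pow_mem (add_mem (twistForm_mem hφ) (twistForm_mem hψ)) m
  have hmass : S.avg ω ((S.form θ₁ + S.form θ₂) * (2 * S.form ω) ^ m) 1 =
      S.avg ω ((S.form θ₁ + S.form θ₂) * (S.twistForm ω φ + S.twistForm ω ψ) ^ m) 1 := by
    obtain ⟨q, hq⟩ := sub_dvd_pow_sub_pow (S.twistForm ω φ + S.twistForm ω ψ) (2 * S.form ω) m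
    have h1 : S.twistForm ω φ + S.twistForm ω ψ - 2 * S.form ω = S.ddcForm (φ + ψ) := by
      rw [twistForm_eq, twistForm_eq, map_add]
      ring
    have h2 := avg_ddcForm_mul_one (ω := ω) (φ + ψ) ((S.form θ₁ + S.form θ₂) * q)
    rw [mul_left_comm, ← h1, ← hq, mul_sub, map_sub, _root_.sub_apply] at h2
    linarith
  have hb := fun {θ : Z} (hθ : 0 ≤ θ) => (abs_le.1 (abs_apply_le_of_nonneg
    (fun g hg => avg_nonneg hω (mul_mem (S.form_mem_posCone hθ) hp) hg) (f : C(X, ℝ))))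
  have hb₁ := (hb h₁).1
  have hb₂ := (hb h₂).2
  have h3 := avg_ddcForm_mul (ω := ω) f f ((S.twistForm ω φ + S.twistForm ω ψ) ^ m)
  rw [ddcForm, LinearMap.comp_apply, hf, map_sub, sub_mul, map_sub, _root_.sub_apply] at h3
  rw [hmass, add_mul, map_add, _root_.add_apply]
  linarith

end PluripotentialData

/-! ### Hölder estimates for the Dirichlet functional -/

theorem rpow_mul_rpow_one_sub {a r : ℝ} (ha : 0 ≤ a) (hr : 0 < r) (e : ℝ) :
    a ^ e * r ^ (1 - e) = r * (a / r) ^ e := by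
  rw [Real.div_rpow ha hr.le, Real.rpow_sub hr, Real.rpow_one]
  ring

/-- Iterating the inequality `aₖ₊₁ ≤ aₖ + 4 (r aₖ)^(1/2)` halves the exponent of `a₀` in each
step. -/
theorem le_of_sqrt_recursion {a : ℕ → ℝ} {r : ℝ} {m : ℕ} (hr : 0 < r) (h0 : 0 ≤ a 0)
    (h0r : a 0 ≤ r) (step : ∀ k < m, a (k + 1) ≤ a k + 4 * (√r * √(a k))) {k : ℕ} (hk : k ≤ m) :
    a k ≤ 5 ^ k * (a 0 ^ ((2 : ℝ) ^ k)⁻¹ * r ^ (1 - ((2 : ℝ) ^ k)⁻¹)) := by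
  rw [rpow_mul_rpow_one_sub h0 hr]
  have hy0 : 0 ≤ a 0 / r := div_nonneg h0 hr.le
  have hy1 : a 0 / r ≤ 1 := (div_le_one hr).2 h0r
  induction k with
  | zero => simp [mul_div_cancel₀ _ hr.ne']
  | succ k ih =>
    have ih := ih (by omega)
    have h5 : (1 : ℝ) ≤ 5 ^ k := one_le_pow₀ (by norm_num)
    set z := (a 0 / r) ^ ((2 : ℝ) ^ (k + 1))⁻¹ with hz
    have hz0 : 0 ≤ z := Real.rpow_nonneg hy0 _
    have hz1 : z ≤ 1 := Real.rpow_le_one hy0 hy1 (by positivity)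
    have hzz : (a 0 / r) ^ ((2 : ℝ) ^ k)⁻¹ = z ^ 2 := by
      rw [hz, ← Real.rpow_natCast _ 2, ← Real.rpow_mul hy0]
      congr 1
      rw [pow_succ]
      push_cast
      field_simp
    rw [hzz] at ih
    have h1 : √r * √(a k) ≤ 5 ^ k * (r * z) := by
      rw [← Real.sqrt_mul hr.le]
      refine Real.sqrt_le_iff.2 ⟨by positivity, ?_⟩
      calc r * a k ≤ r * (5 ^ k * (r * z ^ 2)) := mul_le_mul_of_nonneg_left ih hr.le
        _ = 5 ^ k * (1 * (r * z) ^ 2) := by ring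
        _ ≤ 5 ^ k * (5 ^ k * (r * z) ^ 2) := by gcongr
        _ = _ := by ring
    have h2 : r * z ^ 2 ≤ r * z := by
      refine mul_le_mul_of_nonneg_left ?_ hr.le
      nlinarith
    calc a (k + 1) ≤ a k + 4 * (√r * √(a k)) := step k (by omega)
      _ ≤ 5 ^ k * (r * z) + 4 * (5 ^ k * (r * z)) := by
        refine add_le_add (ih.trans ?_) (by linarith)
        gcongr
      _ = _ := by ring

namespace PluripotentialData

variable {X : Type*} [TopologicalSpace X] [CompactSpace X]
  {Z : Type*} [AddCommGroup Z] [Module ℝ Z] [PartialOrder Z] [IsOrderedAddMonoid Z]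
  [IsOrderedModule ℝ Z]
variable {m : ℕ} {S : PluripotentialData X Z (m + 1)} {ω : Z}

theorem symDirichlet_zero_midpoint_le (hω : 0 ≤ ω) {φ ψ : S.testFun} (hφ : φ ∈ S.psh ω)
    (hψ : ψ ∈ S.psh ω) {R : ℝ} (hφR : S.symDirichlet ω 0 φ ≤ R) (hψR : S.symDirichlet ω 0 ψ ≤ R) :
    S.symDirichlet ω 0 ((2⁻¹ : ℝ) • (φ + ψ)) ≤ compConst m * R := by
  have h0 := zero_mem_psh (S := S) hω
  have h1 := dirichlet_le_symDirichlet hω h0 hφ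
  have h2 := dirichlet_le_symDirichlet hω h0 hψ
  have h3 := dirichlet_zero_midpoint_le hω hφ hψ
  refine (symDirichlet_le_dirichlet hω h0 (midpoint_mem_psh hφ hψ)).trans ?_
  refine mul_le_mul_of_nonneg_left ?_ (by linarith [one_le_compConst m])
  linarith

/-- One step of the comparison of Dirichlet norms: a factor `s = 2 ω_σ` of the mixed form is
replaced by `t = 2 ω_τ`. -/
theorem gradForm_step (hω : 0 ≤ ω) {φ ψ v : S.testFun} (hφ : φ ∈ S.psh ω) (hψ : ψ ∈ S.psh ω)
    {q t : S.FormAlg} (hq : q ∈ S.posCone) {r : ℝ}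
    (ht : t = S.twistForm ω φ + S.twistForm ω ψ + 2 * S.ddcForm v)
    (hr : S.gradForm ω ((S.twistForm ω φ + S.twistForm ω ψ) * q) v v ≤ r) :
    S.gradForm ω (t * q) (φ - ψ) (φ - ψ) ≤
      S.gradForm ω ((S.twistForm ω φ + S.twistForm ω ψ) * q) (φ - ψ) (φ - ψ) +
        4 * (√r * √(S.gradForm ω ((S.twistForm ω φ + S.twistForm ω ψ) * q) (φ - ψ) (φ - ψ))) := by
  have ha := twistForm_mem hφ
  have hb := twistForm_mem hψ
  have key : ∀ a ∈ S.posCone, S.twistForm ω φ + S.twistForm ω ψ - a ∈ S.posCone →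
      |S.gradForm ω (a * q) v (φ - ψ)| ≤
        √r * √(S.gradForm ω ((S.twistForm ω φ + S.twistForm ω ψ) * q) (φ - ψ) (φ - ψ)) := by
    intro a ha h
    have h1 : (S.twistForm ω φ + S.twistForm ω ψ) * q - a * q ∈ S.posCone := by
      rw [← sub_mul]
      exact mul_mem h hq
    refine (abs_gradForm_le hω (mul_mem ha hq) _ _).trans ?_
    exact mul_le_mul (Real.sqrt_le_sqrt ((gradForm_mono hω h1 _).trans hr))
      (Real.sqrt_le_sqrt (gradForm_mono hω h1 _)) (Real.sqrt_nonneg _) (Real.sqrt_nonneg _)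
  have k1 := (abs_le.1 (key _ ha (by rwa [add_sub_cancel_left]))).2
  have k2 := (abs_le.1 (key _ hb (by rwa [add_sub_cancel_right]))).1
  have h2 : S.gradForm ω (S.ddcForm v * q) (φ - ψ) (φ - ψ) =
      S.gradForm ω (S.twistForm ω φ * q) v (φ - ψ) -
        S.gradForm ω (S.twistForm ω ψ * q) v (φ - ψ) := by
    rw [gradForm_ddcForm_mul, ← twistForm_sub, sub_mul, map_sub (S.gradForm ω),
      LinearMap.sub_apply, LinearMap.sub_apply]
  have h3 : t * q = (S.twistForm ω φ + S.twistForm ω ψ) * q +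
      (S.ddcForm v * q + S.ddcForm v * q) := by
    rw [ht]
    ring
  rw [h3, map_add (S.gradForm ω), map_add (S.gradForm ω), LinearMap.add_apply,
    LinearMap.add_apply, LinearMap.add_apply, LinearMap.add_apply, h2]
  linarith

/-- The factor by which energy bounds are enlarged in the Hölder estimates. -/
def energyFactor (m : ℕ) : ℝ := 2 ^ (m + 2) * compConst m ^ 2

theorem one_le_energyFactor (m : ℕ) : 1 ≤ energyFactor m :=
  one_le_mul_of_one_le_of_one_le (one_le_pow₀ one_le_two) (one_le_pow₀ (one_le_compConst m))

/-- Comparison of two Dirichlet norms of `φ - ψ`: with respect to `(ω_φ' + ω_ψ') ^ (n - 1)`, and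
with respect to `(ω_φ + ω_ψ) ^ (n - 1)`. -/
theorem gradForm_pow_le (hω : 0 ≤ ω) {φ ψ φ' ψ' : S.testFun} (hφ : φ ∈ S.psh ω) (hψ : ψ ∈ S.psh ω)
    (hφ' : φ' ∈ S.psh ω) (hψ' : ψ' ∈ S.psh ω) {R : ℝ} (hR : 0 < R)
    (hφR : S.symDirichlet ω 0 φ ≤ R) (hψR : S.symDirichlet ω 0 ψ ≤ R)
    (hφR' : S.symDirichlet ω 0 φ' ≤ R) (hψR' : S.symDirichlet ω 0 ψ' ≤ R) :
    S.gradForm ω ((S.twistForm ω φ' + S.twistForm ω ψ') ^ m) (φ - ψ) (φ - ψ) ≤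
      5 ^ m * (S.symDirichlet ω φ ψ ^ ((2 : ℝ) ^ m)⁻¹ *
        (energyFactor m * R) ^ (1 - ((2 : ℝ) ^ m)⁻¹)) := by
  have hK := one_le_compConst m
  have h0 := zero_mem_psh (S := S) hω
  have ha := twistForm_mem hφ
  have hb := twistForm_mem hψ
  have ha' := twistForm_mem hφ'
  have hb' := twistForm_mem hψ'
  have hs := add_mem ha hb
  have ht := add_mem ha' hb'
  have hσp := midpoint_mem_psh hφ hψ
  have hτp := midpoint_mem_psh hφ' hψ'
  set s := S.twistForm ω φ + S.twistForm ω ψ with hs_def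
  set t := S.twistForm ω φ' + S.twistForm ω ψ' with ht_def
  have hsσ : s = 2 * S.twistForm ω ((2⁻¹ : ℝ) • (φ + ψ)) := twistForm_midpoint φ ψ
  have htτ : t = 2 * S.twistForm ω ((2⁻¹ : ℝ) • (φ' + ψ')) := twistForm_midpoint φ' ψ'
  have hσ := symDirichlet_zero_midpoint_le hω hφ hψ hφR hψR
  have hτ := symDirichlet_zero_midpoint_le hω hφ' hψ' hφR' hψR'
  set σ := (2⁻¹ : ℝ) • (φ + ψ)
  set τ := (2⁻¹ : ℝ) • (φ' + ψ')
  have hτσ : S.symDirichlet ω τ σ ≤ 4 * compConst m ^ 2 * R := by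
    have h1 := symDirichlet_triangle hω hτp hσp h0
    rw [symDirichlet_comm τ 0] at h1
    have h2 : 2 * compConst m * (S.symDirichlet ω 0 τ + S.symDirichlet ω 0 σ) ≤
        2 * compConst m * (compConst m * R + compConst m * R) :=
      mul_le_mul_of_nonneg_left (by linarith) (by linarith)
    linarith
  have hv : ∀ k ≤ m, S.gradForm ω (t ^ k * s ^ (m - k)) (τ - σ) (τ - σ) ≤ energyFactor m * R := by
    intro k hk
    have h1 := gradForm_mono hω (pow_add_sub_mul_mem k ht hs (m - k)) (τ - σ)
    rw [Nat.add_sub_cancel' hk, htτ, hsσ, ← mul_add,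
      mul_pow 2 (S.twistForm ω τ + S.twistForm ω σ)] at h1
    have h2 : (2 : S.FormAlg) ^ m * (S.twistForm ω τ + S.twistForm ω σ) ^ m =
        (2 ^ m : ℝ) • (S.twistForm ω τ + S.twistForm ω σ) ^ m := by
      rw [Algebra.smul_def, map_pow, map_ofNat]
    rw [h2, map_smul, LinearMap.smul_apply, LinearMap.smul_apply, smul_eq_mul] at h1
    rw [htτ, hsσ]
    refine h1.trans ?_
    calc (2 : ℝ) ^ m * S.symDirichlet ω τ σ ≤ 2 ^ m * (4 * compConst m ^ 2 * R) := by gcongr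
      _ = energyFactor m * R := by rw [energyFactor]; ring
  have hEpos : 0 < energyFactor m * R := mul_pos (by linarith [one_le_energyFactor m]) hR
  have hφψ : S.symDirichlet ω φ ψ ≤ energyFactor m * R := by
    have h1 := symDirichlet_triangle hω hφ hψ h0
    rw [symDirichlet_comm φ 0] at h1
    have h2 : 2 * compConst m * (S.symDirichlet ω 0 φ + S.symDirichlet ω 0 ψ) ≤
        2 * compConst m * (R + R) := mul_le_mul_of_nonneg_left (by linarith) (by linarith)
    have h3 : 4 * compConst m ≤ energyFactor m := by
      have h4 : (4 : ℝ) ≤ 2 ^ (m + 2) := by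
        have : (1 : ℝ) ≤ 2 ^ m := one_le_pow₀ one_le_two
        rw [pow_add]
        linarith
      rw [energyFactor]
      nlinarith
    nlinarith
  have ha0 : S.gradForm ω (t ^ 0 * s ^ (m - 0)) (φ - ψ) (φ - ψ) = S.symDirichlet ω φ ψ := by
    rw [pow_zero, one_mul, Nat.sub_zero]
    rfl
  have := le_of_sqrt_recursion (m := m) (k := m)
    (a := fun k => S.gradForm ω (t ^ k * s ^ (m - k)) (φ - ψ) (φ - ψ)) hEpos
    (by rw [ha0]; exact symDirichlet_nonneg hω hφ hψ) (by rw [ha0]; exact hφψ) (fun k hk => by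
      have h1 : m - k = m - (k + 1) + 1 := by omega
      have h2 := hv k hk.le
      have h3 : t ^ k * s ^ (m - k) = s * (t ^ k * s ^ (m - (k + 1))) := by
        rw [h1, pow_succ]
        ring
      have h4 : t ^ (k + 1) * s ^ (m - (k + 1)) = t * (t ^ k * s ^ (m - (k + 1))) := by ring
      rw [h3] at h2
      simp only [h3, h4]
      refine gradForm_step hω hφ hψ (mul_mem (pow_mem ht _) (pow_mem hs _)) ?_ h2
      rw [← hs_def, htτ, hsσ, ← twistForm_sub]
      ring) le_rfl
  simp only [ha0] at this
  rwa [Nat.sub_self, pow_zero, mul_one] at this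

/-- The constant in the Hölder estimates. -/
def holderConst (m : ℕ) : ℝ := 5 ^ m * energyFactor m

theorem one_le_holderConst (m : ℕ) : 1 ≤ holderConst m :=
  one_le_mul_of_one_le_of_one_le (one_le_pow₀ (by norm_num)) (one_le_energyFactor m)

theorem abs_MA_sub_MA_sub_le (hω : 0 ≤ ω) {φ ψ φ' ψ' : S.testFun} (hφ : φ ∈ S.psh ω)
    (hψ : ψ ∈ S.psh ω) (hφ' : φ' ∈ S.psh ω) (hψ' : ψ' ∈ S.psh ω) {R : ℝ} (hR : 0 < R)
    (hφR : S.symDirichlet ω 0 φ ≤ R) (hψR : S.symDirichlet ω 0 ψ ≤ R)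
    (hφR' : S.symDirichlet ω 0 φ' ≤ R) (hψR' : S.symDirichlet ω 0 ψ' ≤ R) :
    |(S.MA ω φ' - S.MA ω ψ') ((φ - ψ : S.testFun) : C(X, ℝ))| ≤
      holderConst m * S.symDirichlet ω φ ψ ^ ((2 : ℝ) ^ (m + 1))⁻¹ *
        S.symDirichlet ω φ' ψ' ^ ((1 : ℝ) / 2) * R ^ ((1 : ℝ) / 2 - ((2 : ℝ) ^ (m + 1))⁻¹) := by
  have hE := one_le_energyFactor m
  have hT := symDirichlet_nonneg hω hφ hψ
  have h1 := abs_MA_sub_MA_le hω hφ' hψ' (φ - ψ)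
  have h2 := Real.sqrt_le_sqrt (gradForm_pow_le hω hφ hψ hφ' hψ' hR hφR hψR hφR' hψR')
  have he : ((2 : ℝ) ^ (m + 1))⁻¹ = ((2 : ℝ) ^ m)⁻¹ * (1 / 2) := by
    rw [pow_succ, mul_inv]
    norm_num
  have hα0 : 0 < ((2 : ℝ) ^ m)⁻¹ := by positivity
  have hα1 : ((2 : ℝ) ^ m)⁻¹ ≤ 1 := inv_le_one_of_one_le₀ (one_le_pow₀ one_le_two)
  set α := ((2 : ℝ) ^ m)⁻¹
  have h3 : √(5 ^ m * (S.symDirichlet ω φ ψ ^ α * (energyFactor m * R) ^ (1 - α))) ≤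
      holderConst m * S.symDirichlet ω φ ψ ^ (α * (1 / 2)) * R ^ (1 / 2 - α * (1 / 2)) := by
    have e1 : √(S.symDirichlet ω φ ψ ^ α) = S.symDirichlet ω φ ψ ^ (α * (1 / 2)) := by
      rw [Real.sqrt_eq_rpow, ← Real.rpow_mul hT]
    have e2 : √(R ^ (1 - α)) = R ^ (1 / 2 - α * (1 / 2)) := by
      rw [Real.sqrt_eq_rpow, ← Real.rpow_mul hR.le]
      congr 1
      ring
    have e3 : √(energyFactor m ^ (1 - α)) ≤ energyFactor m := by
      have h5 : energyFactor m ^ (1 - α) ≤ energyFactor m := by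
        simpa using Real.rpow_le_rpow_of_exponent_le hE (by linarith : 1 - α ≤ 1)
      refine Real.sqrt_le_iff.2 ⟨by linarith, h5.trans ?_⟩
      nlinarith
    have e4 : √((5 : ℝ) ^ m) ≤ 5 ^ m := by
      have h5 : (1 : ℝ) ≤ 5 ^ m := one_le_pow₀ (by norm_num)
      refine Real.sqrt_le_iff.2 ⟨by linarith, ?_⟩
      nlinarith
    rw [Real.mul_rpow (by linarith) hR.le, Real.sqrt_mul (by positivity),
      Real.sqrt_mul (by positivity), Real.sqrt_mul (by positivity), e1, e2, holderConst]
    have e5 : 0 ≤ S.symDirichlet ω φ ψ ^ (α * (1 / 2)) * R ^ (1 / 2 - α * (1 / 2)) := by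
      positivity
    have e6 := mul_le_mul e4 e3 (Real.sqrt_nonneg _) (by positivity)
    nlinarith
  rw [he, ← Real.sqrt_eq_rpow]
  refine h1.trans ?_
  calc _ ≤ √(S.symDirichlet ω φ' ψ') *
      (holderConst m * S.symDirichlet ω φ ψ ^ (α * (1 / 2)) * R ^ (1 / 2 - α * (1 / 2))) :=
        mul_le_mul_of_nonneg_left (h2.trans h3) (Real.sqrt_nonneg _)
    _ = _ := by ring

end PluripotentialData

theorem rpow_le_rpow_mul_rpow_sub {t r α e : ℝ} (ht : 0 ≤ t) (htr : t ≤ r) (hα : 0 ≤ α)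
    (hαe : α ≤ e) : t ^ e ≤ t ^ α * r ^ (e - α) := by
  have h : t ^ e = t ^ α * t ^ (e - α) := by
    rw [← Real.rpow_add_of_nonneg ht hα (by linarith), add_sub_cancel]
  rw [h]
  exact mul_le_mul_of_nonneg_left (Real.rpow_le_rpow ht htr (by linarith))
    (Real.rpow_nonneg ht _)

theorem rpow_mul_rpow_half_le {s t r r' α : ℝ} (hα : 0 < α) (hα' : α ≤ 1 / 2) (hs : 0 ≤ s)
    (hsr : s ≤ r) (ht : 0 ≤ t) (htr : t ≤ r) (hr' : 0 < r') (hrr : r' ≤ r) :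
    s ^ α * t ^ ((1 : ℝ) / 2) * r' ^ ((1 : ℝ) / 2 - α) ≤ t ^ α * r ^ (1 - α) := by
  have hr : 0 < r := hr'.trans_le hrr
  have h1 := rpow_le_rpow_mul_rpow_sub ht htr hα.le hα'
  have h2 : r ^ α * r ^ ((1 : ℝ) / 2 - α) * r ^ ((1 : ℝ) / 2 - α) = r ^ (1 - α) := by
    rw [← Real.rpow_add hr, ← Real.rpow_add hr]
    ring_nf
  have h3 : 0 ≤ 1 / 2 - α := by linarith
  calc _ ≤ r ^ α * (t ^ α * r ^ ((1 : ℝ) / 2 - α)) * r ^ ((1 : ℝ) / 2 - α) := by gcongr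
    _ = t ^ α * (r ^ α * r ^ ((1 : ℝ) / 2 - α) * r ^ ((1 : ℝ) / 2 - α)) := by ring
    _ = _ := by rw [h2]

theorem rpow_half_mul_rpow_le {s t r r' α : ℝ} (hα' : α ≤ 1 / 2) (hs : 0 ≤ s)
    (hsr : s ≤ r) (ht : 0 ≤ t) (hr' : 0 < r') (hrr : r' ≤ r) :
    t ^ α * s ^ ((1 : ℝ) / 2) * r' ^ ((1 : ℝ) / 2 - α) ≤ t ^ α * r ^ (1 - α) := by
  have hr : 0 < r := hr'.trans_le hrr
  have h2 : r ^ ((1 : ℝ) / 2) * r ^ ((1 : ℝ) / 2 - α) = r ^ (1 - α) := by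
    rw [← Real.rpow_add hr]
    ring_nf
  have h3 : 0 ≤ 1 / 2 - α := by linarith
  rw [← h2, mul_assoc]
  gcongr

theorem mul_rpow_le_of_le {t r k M R α : ℝ} (hα : 0 ≤ α) (ht : 0 ≤ t) (hk : 1 ≤ k) (hM : 0 ≤ M)
    (hR : 0 ≤ R) (htM : t ≤ k * M) (hr : r = 4 * k ^ 2 * R) :
    t ^ α * r ^ (1 - α) ≤ 4 * k ^ 2 * (M ^ α * R ^ (1 - α)) := by
  have hk2 : k ≤ 4 * k ^ 2 := by nlinarith
  have h1 : t ^ α ≤ (4 * k ^ 2) ^ α * M ^ α := by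
    rw [← Real.mul_rpow (by positivity) hM]
    exact Real.rpow_le_rpow ht (htM.trans (mul_le_mul_of_nonneg_right hk2 hM)) hα
  rw [hr, Real.mul_rpow (by positivity) hR]
  calc _ ≤ (4 * k ^ 2) ^ α * M ^ α * ((4 * k ^ 2) ^ (1 - α) * R ^ (1 - α)) := by gcongr
    _ = (4 * k ^ 2) ^ α * (4 * k ^ 2) ^ (1 - α) * (M ^ α * R ^ (1 - α)) := by ring
    _ = _ := by rw [← Real.rpow_add (by positivity), add_sub_cancel, Real.rpow_one]

theorem inv_two_pow_succ_le_half (m : ℕ) : ((2 : ℝ) ^ (m + 1))⁻¹ ≤ 1 / 2 := by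
  rw [one_div]
  exact inv_anti₀ two_pos (le_self_pow₀ one_le_two (by omega))

namespace PluripotentialData

variable {X : Type*} [TopologicalSpace X] [CompactSpace X]
  {Z : Type*} [AddCommGroup Z] [Module ℝ Z] [PartialOrder Z] [IsOrderedAddMonoid Z]
  [IsOrderedModule ℝ Z]
variable {m : ℕ} {S : PluripotentialData X Z (m + 1)} {ω : Z}

/-- A constant, depending only on the dimension, that works in all estimates for the Dirichlet
functional. -/
def mainConst (m : ℕ) : ℝ := 8 * compConst m ^ 2 * (1 + holderConst m)

theorem compConst_le_mainConst (m : ℕ) : compConst m ≤ mainConst m := by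
  have h1 := one_le_compConst m
  have h2 := one_le_holderConst m
  have h3 : compConst m ≤ compConst m ^ 2 := by nlinarith
  rw [mainConst]
  nlinarith

theorem two_mul_compConst_sq_le_mainConst (m : ℕ) : 2 * compConst m ^ 2 ≤ mainConst m := by
  have h1 := one_le_compConst m
  have h2 := one_le_holderConst m
  rw [mainConst]
  nlinarith [sq_nonneg (compConst m)]

theorem holderConst_mul_compConst_le_mainConst (m : ℕ) :
    holderConst m * compConst m ≤ mainConst m := by
  have h1 := one_le_compConst m
  have h2 := one_le_holderConst m
  have h3 : compConst m ≤ compConst m ^ 2 := by nlinarith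
  rw [mainConst]
  nlinarith

theorem one_le_mainConst (m : ℕ) : 1 ≤ mainConst m :=
  (one_le_compConst m).trans (compConst_le_mainConst m)

theorem mainConst_pos (m : ℕ) : 0 < mainConst m := zero_lt_one.trans_le (one_le_mainConst m)

section psh

variable (hω : 0 ≤ ω) {φ ψ τ φ' ψ' : S.testFun} (hφ : φ ∈ S.psh ω) (hψ : ψ ∈ S.psh ω)
include hω hφ hψ

theorem dirichlet_symm_le : S.dirichlet ω φ ψ ≤ mainConst m * S.dirichlet ω ψ φ := by
  have h1 := dirichlet_le_symDirichlet hω hφ hψ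
  rw [symDirichlet_comm] at h1
  exact (h1.trans (symDirichlet_le_dirichlet hω hψ hφ)).trans
    (mul_le_mul_of_nonneg_right (compConst_le_mainConst m) (dirichlet_nonneg hω hψ hφ))

theorem dirichlet_triangle (hτ : τ ∈ S.psh ω) : S.dirichlet ω φ ψ ≤
    mainConst m * (S.dirichlet ω φ τ + S.dirichlet ω τ ψ) := by
  have h1 := (dirichlet_le_symDirichlet hω hφ hψ).trans (symDirichlet_triangle hω hφ hψ hτ)
  have h2 := symDirichlet_le_dirichlet hω hφ hτ
  have h3 := symDirichlet_le_dirichlet hω hτ hψ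
  have h4 := dirichlet_nonneg hω hφ hτ
  have h5 := dirichlet_nonneg hω hτ hψ
  have h6 := one_le_compConst m
  calc _ ≤ _ := h1
    _ ≤ 2 * compConst m * (compConst m * S.dirichlet ω φ τ + compConst m * S.dirichlet ω τ ψ) := by
      gcongr
    _ = 2 * compConst m ^ 2 * (S.dirichlet ω φ τ + S.dirichlet ω τ ψ) := by ring
    _ ≤ _ := mul_le_mul_of_nonneg_right (two_mul_compConst_sq_le_mainConst m) (by linarith)

theorem dirichlet_le_of_forall {μ : C(X, ℝ) →L[ℝ] ℝ} {M : ℝ}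
    (hM : ∀ τ ∈ S.psh ω, S.energy ω τ - μ τ ≤ M) : S.dirichlet ω φ ψ ≤
      mainConst m * ((M - (S.energy ω φ - μ φ)) + (M - (S.energy ω ψ - μ ψ))) := by
  have h6 := one_le_compConst m
  refine ((dirichlet_le_symDirichlet hω hφ hψ).trans
    (symDirichlet_le_of_forall hω hφ hψ hM)).trans (mul_le_mul_of_nonneg_right ?_ ?_)
  · refine le_trans ?_ (two_mul_compConst_sq_le_mainConst m)
    nlinarith
  · linarith [hM _ hφ, hM _ hψ]

theorem abs_MA_sub_MA_sub_le_dirichlet (hφ' : φ' ∈ S.psh ω) (hψ' : ψ' ∈ S.psh ω)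
    {R : ℝ} (hR : 0 < R)
    (hφR : S.dirichlet ω 0 φ ≤ R) (hψR : S.dirichlet ω 0 ψ ≤ R)
    (hφR' : S.dirichlet ω φ' 0 ≤ R) (hψR' : S.dirichlet ω ψ' 0 ≤ R) :
    |(S.MA ω φ' - S.MA ω ψ') ((φ - ψ : S.testFun) : C(X, ℝ))| ≤
      mainConst m * S.dirichlet ω φ ψ ^ ((2 : ℝ) ^ (m + 1))⁻¹ *
        S.dirichlet ω φ' ψ' ^ ((1 : ℝ) / 2) * R ^ ((1 : ℝ) / 2 - ((2 : ℝ) ^ (m + 1))⁻¹) := by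
  have h0 := zero_mem_psh (S := S) hω
  have hK := one_le_compConst m
  have hK0 : 0 ≤ compConst m := by linarith
  have hKR : 0 < compConst m * R := by positivity
  have hH := one_le_holderConst m
  have b1 := (symDirichlet_le_dirichlet hω h0 hφ).trans (mul_le_mul_of_nonneg_left hφR hK0)
  have b2 := (symDirichlet_le_dirichlet hω h0 hψ).trans (mul_le_mul_of_nonneg_left hψR hK0)
  have b3 := (symDirichlet_le_dirichlet hω hφ' h0).trans (mul_le_mul_of_nonneg_left hφR' hK0)
  have b4 := (symDirichlet_le_dirichlet hω hψ' h0).trans (mul_le_mul_of_nonneg_left hψR' hK0)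
  rw [symDirichlet_comm] at b3 b4
  refine (abs_MA_sub_MA_sub_le hω hφ hψ hφ' hψ' hKR b1 b2 b3 b4).trans ?_
  have hα := inv_two_pow_succ_le_half m
  have hα0 : 0 < ((2 : ℝ) ^ (m + 1))⁻¹ := by positivity
  set α := ((2 : ℝ) ^ (m + 1))⁻¹
  have hD := dirichlet_nonneg hω hφ hψ
  have hD' := dirichlet_nonneg hω hφ' hψ'
  have c1 : S.symDirichlet ω φ ψ ^ α ≤ compConst m ^ α * S.dirichlet ω φ ψ ^ α := by
    rw [← Real.mul_rpow hK0 hD]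
    exact Real.rpow_le_rpow (symDirichlet_nonneg hω hφ hψ)
      (symDirichlet_le_dirichlet hω hφ hψ) hα0.le
  have c2 : S.symDirichlet ω φ' ψ' ^ ((1 : ℝ) / 2) ≤
      compConst m ^ ((1 : ℝ) / 2) * S.dirichlet ω φ' ψ' ^ ((1 : ℝ) / 2) := by
    rw [← Real.mul_rpow hK0 hD']
    exact Real.rpow_le_rpow (symDirichlet_nonneg hω hφ' hψ')
      (symDirichlet_le_dirichlet hω hφ' hψ') (by norm_num)
  have c3 : compConst m ^ α * compConst m ^ ((1 : ℝ) / 2) * compConst m ^ ((1 : ℝ) / 2 - α) =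
      compConst m := by
    rw [← Real.rpow_add (by linarith), ← Real.rpow_add (by linarith)]
    ring_nf
    exact Real.rpow_one _
  rw [Real.mul_rpow hK0 hR.le]
  calc _ ≤ holderConst m * (compConst m ^ α * S.dirichlet ω φ ψ ^ α) *
        (compConst m ^ ((1 : ℝ) / 2) * S.dirichlet ω φ' ψ' ^ ((1 : ℝ) / 2)) *
        (compConst m ^ ((1 : ℝ) / 2 - α) * R ^ ((1 : ℝ) / 2 - α)) := by
        gcongr
        exact Real.rpow_nonneg (symDirichlet_nonneg hω hφ' hψ') _
    _ = holderConst m *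
        (compConst m ^ α * compConst m ^ ((1 : ℝ) / 2) * compConst m ^ ((1 : ℝ) / 2 - α)) *
        S.dirichlet ω φ ψ ^ α * S.dirichlet ω φ' ψ' ^ ((1 : ℝ) / 2) *
        R ^ ((1 : ℝ) / 2 - α) := by ring
    _ ≤ _ := by
        rw [c3]
        have := holderConst_mul_compConst_le_mainConst m
        gcongr

theorem abs_dirichlet_sub_le (hφ' : φ' ∈ S.psh ω) (hψ' : ψ' ∈ S.psh ω)
    {R : ℝ} (hR : 0 < R) (hφR : S.dirichlet ω φ 0 ≤ R) (hψR : S.dirichlet ω ψ 0 ≤ R)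
    (hφR' : S.dirichlet ω φ' 0 ≤ R) (hψR' : S.dirichlet ω ψ' 0 ≤ R) :
    |S.dirichlet ω φ ψ - S.dirichlet ω φ' ψ'| ≤
      mainConst m * max (S.dirichlet ω φ φ') (S.dirichlet ω ψ ψ') ^ ((2 : ℝ) ^ (m + 1))⁻¹ *
        R ^ (1 - ((2 : ℝ) ^ (m + 1))⁻¹) := by
  have h0 := zero_mem_psh (S := S) hω
  have hK := one_le_compConst m
  have hK0 : 0 ≤ compConst m := by linarith
  have hKR : 0 < compConst m * R := by positivity
  have hH := one_le_holderConst m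
  have bd : ∀ {χ : S.testFun}, χ ∈ S.psh ω → S.dirichlet ω χ 0 ≤ R →
      S.symDirichlet ω 0 χ ≤ compConst m * R := fun hχ h => by
    rw [symDirichlet_comm]
    exact (symDirichlet_le_dirichlet hω hχ h0).trans (mul_le_mul_of_nonneg_left h hK0)
  have b1 := bd hφ hφR
  have b2 := bd hψ hψR
  have b3 := bd hφ' hφR'
  have b4 := bd hψ' hψR'
  set R₁ := compConst m * R with hR₁
  have tri : ∀ {χ η : S.testFun}, χ ∈ S.psh ω → η ∈ S.psh ω → S.symDirichlet ω 0 χ ≤ R₁ →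
      S.symDirichlet ω 0 η ≤ R₁ → S.symDirichlet ω χ η ≤ 4 * compConst m * R₁ := by
    intro χ η hχ hη h1 h2
    have h3 := symDirichlet_triangle hω hχ hη h0
    rw [symDirichlet_comm χ 0] at h3
    refine h3.trans ?_
    have := mul_le_mul_of_nonneg_left (add_le_add h1 h2) (by linarith : 0 ≤ 2 * compConst m)
    linarith
  set R₂ := 4 * compConst m * R₁ with hR₂
  have hR₂pos : 0 < R₂ := by positivity
  have hR₁₂ : R₁ ≤ R₂ := by nlinarith
  have hα := inv_two_pow_succ_le_half m
  have hα0 : 0 < ((2 : ℝ) ^ (m + 1))⁻¹ := by positivity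
  have e1 := abs_MA_sub_MA_sub_le hω hψ hφ' hφ hφ' hKR b2 b3 b1 b3
  have e2 := abs_MA_sub_MA_sub_le hω hψ hψ' hφ' hψ hKR b2 b4 b3 b2
  set α := ((2 : ℝ) ^ (m + 1))⁻¹
  have t1 := symDirichlet_nonneg hω hφ hφ'
  have t2 := symDirichlet_nonneg hω hψ hψ'
  have t3 := symDirichlet_nonneg hω hψ hφ'
  have t4 := symDirichlet_nonneg hω hφ' hψ
  have mono : ∀ x, 0 ≤ x → x ≤ max (S.symDirichlet ω φ φ') (S.symDirichlet ω ψ ψ') →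
      holderConst m * (x ^ α * R₂ ^ (1 - α)) ≤ holderConst m *
        (max (S.symDirichlet ω φ φ') (S.symDirichlet ω ψ ψ') ^ α * R₂ ^ (1 - α)) :=
    fun x hx hxt => mul_le_mul_of_nonneg_left (mul_le_mul_of_nonneg_right
      (Real.rpow_le_rpow hx hxt hα0.le) (Real.rpow_nonneg hR₂pos.le _)) (by linarith)
  have f1 := (e1.trans_eq (by ring)).trans ((mul_le_mul_of_nonneg_left
    (rpow_mul_rpow_half_le hα0 hα t3 (tri hψ hφ' b2 b3) t1 (tri hφ hφ' b1 b3) hKR hR₁₂)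
    (by linarith : 0 ≤ holderConst m)).trans (mono _ t1 (le_max_left _ _)))
  have f2 := (e2.trans_eq (by ring)).trans ((mul_le_mul_of_nonneg_left
    (rpow_half_mul_rpow_le hα t4 (tri hφ' hψ b3 b2) t2 hKR hR₁₂)
    (by linarith : 0 ≤ holderConst m)).trans (mono _ t2 (le_max_right _ _)))
  set t := max (S.symDirichlet ω φ φ') (S.symDirichlet ω ψ ψ') with ht
  have ht0 : 0 ≤ t := t1.trans (le_max_left _ _)
  have htR : t ≤ R₂ := max_le (tri hφ hφ' b1 b3) (tri hψ hψ' b2 b4)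
  have d1 : t ≤ t ^ α * R₂ ^ (1 - α) := by
    simpa using rpow_le_rpow_mul_rpow_sub (e := 1) ht0 htR hα0.le (by linarith)
  have g1 := (dirichlet_le_symDirichlet hω hφ hφ').trans (le_max_left _ (S.symDirichlet ω ψ ψ'))
  have g2 := (dirichlet_le_symDirichlet hω hψ hψ').trans (le_max_right (S.symDirichlet ω φ φ') _)
  rw [← ht] at g1 g2
  have n1 := dirichlet_nonneg hω hφ hφ'
  have n2 := dirichlet_nonneg hω hψ hψ'
  -- exchange the two arguments one after the other
  have split : S.dirichlet ω φ ψ - S.dirichlet ω φ' ψ' =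
      (S.dirichlet ω φ φ' + (S.MA ω φ - S.MA ω φ') ((ψ - φ' : S.testFun) : C(X, ℝ))) +
      (-S.dirichlet ω ψ ψ' + (S.MA ω φ' - S.MA ω ψ) ((ψ - ψ' : S.testFun) : C(X, ℝ))) := by
    simp only [dirichlet, Submodule.coe_sub, map_sub, _root_.sub_apply]
    ring
  have total : |S.dirichlet ω φ ψ - S.dirichlet ω φ' ψ'| ≤
      2 * (1 + holderConst m) * (t ^ α * R₂ ^ (1 - α)) := by
    rw [split]
    rw [abs_le] at f1 f2 ⊢
    constructor <;> linarith
  refine total.trans ?_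
  set M := max (S.dirichlet ω φ φ') (S.dirichlet ω ψ ψ')
  have hM0 : 0 ≤ M := n1.trans (le_max_left _ _)
  have htM : t ≤ compConst m * M := max_le
    ((symDirichlet_le_dirichlet hω hφ hφ').trans
      (mul_le_mul_of_nonneg_left (le_max_left _ _) hK0))
    ((symDirichlet_le_dirichlet hω hψ hψ').trans
      (mul_le_mul_of_nonneg_left (le_max_right _ _) hK0))
  have := mul_le_mul_of_nonneg_left (mul_rpow_le_of_le hα0.le ht0 hK hM0 hR.le htM
    (by rw [hR₂, hR₁]; ring : R₂ = 4 * compConst m ^ 2 * R))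
    (by linarith : 0 ≤ 2 * (1 + holderConst m))
  refine this.trans_eq ?_
  rw [mainConst]
  ring

end psh

/-- For a fixed test function `f`, the integral of `f` against `MA_ω(φ)` is Hölder continuous
with respect to the Dirichlet functional, without any bound on the energy of `φ`. -/
theorem exists_abs_MA_sub_MA_le (hω : 0 ≤ ω) (f : S.testFun) : ∃ A : ℝ, 0 ≤ A ∧
    ∀ φ ∈ S.psh ω, ∀ ψ ∈ S.psh ω, |(S.MA ω φ - S.MA ω ψ) f| ≤ A * √(S.dirichlet ω φ ψ) := by
  obtain ⟨A, hA⟩ := exists_gradForm_le hω f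
  have hK := one_le_compConst m
  refine ⟨√(compConst m) * √A, by positivity, fun φ hφ ψ hψ => ?_⟩
  refine (abs_MA_sub_MA_le hω hφ hψ f).trans ?_
  have h1 := Real.sqrt_le_sqrt (hA φ hφ ψ hψ)
  have h2 := Real.sqrt_le_sqrt (symDirichlet_le_dirichlet hω hφ hψ)
  rw [Real.sqrt_mul (by linarith)] at h2
  calc _ ≤ √(compConst m) * √(S.dirichlet ω φ ψ) * √A := by gcongr
    _ = _ := by ring

/-! ### Orthogonality -/

theorem MA_nonneg (hω : 0 ≤ ω) {φ : S.testFun} (hφ : φ ∈ S.psh ω) {f : C(X, ℝ)} (hf : 0 ≤ f) :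
    0 ≤ S.MA ω φ f := by
  rw [MA_eq_avg]
  exact avg_nonneg hω (pow_mem (twistForm_mem hφ) _) hf

theorem MA_one (h : 0 < S.vol ω) (φ : S.testFun) : S.MA ω φ 1 = 1 := by
  rw [MA_eq_avg, avg_twistForm_pow_one h]

theorem _root_.RadonProb.abs_apply_le (μ : RadonProb X) (f : C(X, ℝ)) : |μ.1 f| ≤ ‖f‖ := by
  have h : |μ.1 f| ≤ ‖f‖ * μ.1 1 :=
    abs_apply_le_of_nonneg (μ := (μ.1 : C(X, ℝ) →L[ℝ] ℝ)) μ.2.1 f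
  rwa [μ.2.2, mul_one] at h

/-- The Monge--Ampère measure, as a Radon probability measure. -/
def probMA (hω : 0 ≤ ω) (hvol : 0 < S.vol ω) {φ : S.testFun} (hφ : φ ∈ S.psh ω) : RadonProb X :=
  ⟨S.MA ω φ, fun _ hf => MA_nonneg hω hφ hf, MA_one hvol φ⟩

/-- If `ψ` nearly maximizes `E_ω - μ`, then `MA_ω(ψ)` is weakly close to `μ`. The orthogonality
property provides competitors `φ < ψ + t f` with `E_ω(φ) ≥ E_ω(ψ) + t ∫ f MA_ω(φ) - o(t)`. -/
theorem exists_MA_le_of_forall (hω : 0 ≤ ω) (hvol : 0 < S.vol ω) (horth : S.HasOrthogonality ω)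
    {μ : RadonProb X} {M : ℝ} (hM : ∀ φ ∈ S.psh ω, S.energy ω φ - μ.1 φ ≤ M) (f : S.testFun)
    {ρ : ℝ} (hρ : 0 < ρ) : ∃ ε : ℝ, 0 < ε ∧ ∀ ψ ∈ S.psh ω, M - ε ≤ S.energy ω ψ - μ.1 ψ →
      S.MA ω ψ f ≤ μ.1 f + ρ := by
  obtain ⟨A, hA0, hA⟩ := exists_abs_MA_sub_MA_le hω f
  have hlim : Tendsto (fun t : ℝ => 2 * t + A * √(2 * t ^ 2 + 2 * t * ‖(f : C(X, ℝ))‖))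
      (𝓝[>] 0) (𝓝 0) := by
    have : Continuous fun t : ℝ => 2 * t + A * √(2 * t ^ 2 + 2 * t * ‖(f : C(X, ℝ))‖) := by
      fun_prop
    simpa using (this.tendsto 0).mono_left nhdsWithin_le_nhds
  obtain ⟨t, htρ, ht⟩ := ((hlim.eventually (gt_mem_nhds hρ)).and self_mem_nhdsWithin).exists
  have ht : 0 < t := ht
  refine ⟨t ^ 2, by positivity, fun ψ hψ hψM => ?_⟩
  obtain ⟨φ, hφ, hφlt, hφo⟩ := horth.2 (ψ + t • f) (t ^ 2) (by positivity)
  have o1 := (abs_le.1 (hφo φ hφ fun x => ⟨le_rfl, hφlt x⟩)).2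
  have o2 : μ.1 φ ≤ μ.1 ψ + t * μ.1 f := by
    have := μ.2.1 (((ψ + t • f - φ : S.testFun)) : C(X, ℝ)) fun x => by
      simpa using (hφlt x).le
    rw [Submodule.coe_sub, Submodule.coe_add, Submodule.coe_smul, map_sub, map_add, map_smul,
      smul_eq_mul] at this
    linarith
  have o3 := dirichlet_nonneg hω hφ hψ
  have o4 := hM φ hφ
  have o5 := (abs_le.1 (RadonProb.abs_apply_le μ (f : C(X, ℝ)))).2
  have o6 := (abs_le.1 (RadonProb.abs_apply_le (probMA hω hvol hφ) (f : C(X, ℝ)))).1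
  have o6 : -‖(f : C(X, ℝ))‖ ≤ S.MA ω φ f := o6
  have o7 := (abs_le.1 (hA φ hφ ψ hψ)).1
  rw [_root_.sub_apply] at o7
  have o8 : S.dirichlet ω φ ψ ≤ 2 * t ^ 2 + 2 * t * ‖(f : C(X, ℝ))‖ := by
    rw [dirichlet]
    simp only [Submodule.coe_sub, Submodule.coe_add, Submodule.coe_smul, map_sub, map_add,
      map_smul, smul_eq_mul] at o1 ⊢
    nlinarith
  have o9 := mul_le_mul_of_nonneg_left (Real.sqrt_le_sqrt o8) hA0
  have o10 : S.MA ω φ f ≤ μ.1 f + 2 * t := by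
    rw [dirichlet] at o3
    simp only [Submodule.coe_sub, Submodule.coe_add, Submodule.coe_smul, map_sub, map_add,
      map_smul, smul_eq_mul] at o1 o3
    have : t * S.MA ω φ f ≤ t * (μ.1 f + 2 * t) := by nlinarith
    exact le_of_mul_le_mul_left this ht
  linarith

end PluripotentialData

/-! ### The weak topology -/

theorem RadonProb.continuous_apply {X : Type*} [TopologicalSpace X] [CompactSpace X]
    (f : C(X, ℝ)) : Continuous fun μ : RadonProb X => μ.1 f :=
  (WeakDual.eval_continuous f).comp continuous_subtype_val

theorem RadonProb.tendsto_iff {X : Type*} [TopologicalSpace X] [CompactSpace X]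
    {ι : Type*} {l : Filter ι} {μs : ι → RadonProb X} {μ : RadonProb X} :
    Tendsto μs l (𝓝 μ) ↔ ∀ f : C(X, ℝ), Tendsto (fun i => (μs i).1 f) l (𝓝 (μ.1 f)) := by
  rw [tendsto_subtype_rng]
  exact tendsto_iff_forall_eval_tendsto_topDualPairing

/-- For probability measures, weak convergence can be tested on a dense set of functions. -/
theorem RadonProb.tendsto_of_dense {X : Type*} [TopologicalSpace X] [CompactSpace X]
    {D : Set C(X, ℝ)} (hD : Dense D) {ι : Type*} {l : Filter ι} {μs : ι → RadonProb X}
    {μ : RadonProb X} (h : ∀ f ∈ D, Tendsto (fun i => (μs i).1 f) l (𝓝 (μ.1 f))) :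
    Tendsto μs l (𝓝 μ) := by
  refine RadonProb.tendsto_iff.2 fun f => Metric.tendsto_nhds.2 fun ε hε => ?_
  obtain ⟨g, hg, hfg⟩ := hD.exists_dist_lt f (by positivity : 0 < ε / 3)
  rw [dist_eq_norm] at hfg
  filter_upwards [Metric.tendsto_nhds.1 (h g hg) (ε / 3) (by positivity)] with i hi
  rw [Real.dist_eq] at hi ⊢
  have h1 := (RadonProb.abs_apply_le (μs i) (f - g)).trans_lt hfg
  have h2 := (RadonProb.abs_apply_le μ (f - g)).trans_lt hfg
  rw [map_sub] at h1 h2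
  rw [abs_lt] at h1 h2 hi ⊢
  constructor <;> linarith

/-- By the Banach--Alaoglu theorem, the space of Radon probability measures is compact. -/
instance RadonProb.instCompactSpace {X : Type*} [TopologicalSpace X] [CompactSpace X] :
    CompactSpace (RadonProb X) := by
  refine isCompact_iff_compactSpace.1 (IsCompact.of_isClosed_subset
    (WeakDual.isCompact_closedBall (𝕜 := ℝ) (0 : StrongDual ℝ C(X, ℝ)) 1) ?_ ?_)
  · have h : {μ : WeakDual ℝ C(X, ℝ) | (∀ f : C(X, ℝ), 0 ≤ f → 0 ≤ μ f) ∧ μ 1 = 1} =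
        (⋂ f : C(X, ℝ), ⋂ _ : 0 ≤ f, {μ : WeakDual ℝ C(X, ℝ) | 0 ≤ μ f}) ∩ {μ | μ 1 = 1} := by
      ext μ
      simp
    change IsClosed {μ : WeakDual ℝ C(X, ℝ) | (∀ f : C(X, ℝ), 0 ≤ f → 0 ≤ μ f) ∧ μ 1 = 1}
    rw [h]
    exact (isClosed_iInter fun f => isClosed_iInter fun _ =>
      isClosed_le continuous_const (WeakDual.eval_continuous f)).inter
      (isClosed_eq (WeakDual.eval_continuous 1) continuous_const)
  · intro μ hμ
    rw [Set.mem_preimage, mem_closedBall_zero_iff]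
    refine ContinuousLinearMap.opNorm_le_bound _ zero_le_one fun f => ?_
    rw [one_mul]
    exact RadonProb.abs_apply_le ⟨μ, hμ⟩ f

namespace PluripotentialData

variable {X : Type*} [TopologicalSpace X] [CompactSpace X]
  {Z : Type*} [AddCommGroup Z] [Module ℝ Z] [PartialOrder Z] [IsOrderedAddMonoid Z]
  [IsOrderedModule ℝ Z]
variable {m : ℕ} {S : PluripotentialData X Z (m + 1)} {ω : Z}

/-! ### Measures of finite energy -/

theorem measureEnergy_eq_of_bddAbove (hω : 0 ≤ ω) {μ : RadonProb X}
    (hb : BddAbove (Set.range fun φ : S.psh ω => S.energy ω φ.1 - μ.1 (φ.1 : C(X, ℝ))))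
    (ψ : S.testFun) : S.measureEnergy ω μ ψ =
      (((⨆ φ : S.psh ω, (S.energy ω φ.1 - μ.1 (φ.1 : C(X, ℝ)))) -
        (S.energy ω ψ - μ.1 (ψ : C(X, ℝ))) : ℝ) : EReal) := by
  have : Nonempty (S.psh ω) := ⟨⟨0, zero_mem_psh hω⟩⟩
  have hb' : BddAbove (Set.range fun φ : S.psh ω =>
      S.energy ω φ.1 - μ.1 (φ.1 : C(X, ℝ)) - (S.energy ω ψ - μ.1 (ψ : C(X, ℝ)))) := by
    obtain ⟨M, hM⟩ := hb
    refine ⟨M - (S.energy ω ψ - μ.1 (ψ : C(X, ℝ))), ?_⟩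
    rintro _ ⟨φ, rfl⟩
    exact sub_le_sub_right (hM ⟨φ, rfl⟩) _
  rw [ciSup_sub hb, Monotone.map_ciSup_of_continuousAt continuous_coe_real_ereal.continuousAt
    EReal.coe_strictMono.monotone hb', measureEnergy]
  congr 1
  ext φ
  congr 1
  rw [Submodule.coe_sub, map_sub]
  ring

theorem measureEnergy_lt_top_iff (hω : 0 ≤ ω) {μ : RadonProb X} :
    S.measureEnergy ω μ 0 < ⊤ ↔ ∃ M : ℝ, ∀ φ ∈ S.psh ω, S.energy ω φ - μ.1 φ ≤ M := by
  constructor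
  · intro h
    refine ⟨(S.measureEnergy ω μ 0).toReal, fun φ hφ => ?_⟩
    have h1 : ((S.energy ω φ - μ.1 φ : ℝ) : EReal) ≤ S.measureEnergy ω μ 0 := by
      refine le_trans (le_of_eq ?_) (le_iSup _ (⟨φ, hφ⟩ : S.psh ω))
      congr 1
      rw [zero_sub, Submodule.coe_neg, map_neg, energy_zero]
      ring
    exact EReal.coe_le_coe_iff.1 (h1.trans (EReal.le_coe_toReal h.ne))
  · rintro ⟨M, hM⟩
    rw [measureEnergy_eq_of_bddAbove hω ⟨M, by rintro _ ⟨φ, rfl⟩; exact hM φ.1 φ.2⟩]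
    exact EReal.coe_lt_top _

namespace FiniteEnergy

variable (μ : S.FiniteEnergy ω)

/-- The energy `J_ω(μ, ψ)` of a measure of finite energy, as a real number. -/
def relJ (ψ : S.testFun) : ℝ := μ.J - (S.energy ω ψ - μ.radon ψ)

theorem relJ_zero : μ.relJ 0 = μ.J := by simp [relJ, energy_zero]

theorem bddAbove (hω : 0 ≤ ω) : BddAbove
    (Set.range fun φ : S.psh ω => S.energy ω φ.1 - μ.prob.1 (φ.1 : C(X, ℝ))) := by
  obtain ⟨M, hM⟩ := (measureEnergy_lt_top_iff hω).1 μ.finite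
  exact ⟨M, by rintro _ ⟨φ, rfl⟩; exact hM φ.1 φ.2⟩

theorem J_eq_iSup (hω : 0 ≤ ω) :
    μ.J = ⨆ φ : S.psh ω, (S.energy ω φ.1 - μ.prob.1 (φ.1 : C(X, ℝ))) := by
  rw [J, measureEnergy_eq_of_bddAbove hω (μ.bddAbove hω), EReal.toReal_coe]
  simp [energy_zero]

theorem measureEnergy_eq (hω : 0 ≤ ω) (ψ : S.testFun) :
    S.measureEnergy ω μ.prob ψ = (μ.relJ ψ : EReal) := by
  rw [measureEnergy_eq_of_bddAbove hω (μ.bddAbove hω), ← μ.J_eq_iSup hω]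
  rfl

theorem energy_sub_le_J (hω : 0 ≤ ω) {φ : S.testFun} (hφ : φ ∈ S.psh ω) :
    S.energy ω φ - μ.radon φ ≤ μ.J := by
  rw [J_eq_iSup μ hω]
  exact le_ciSup (μ.bddAbove hω) (⟨φ, hφ⟩ : S.psh ω)

theorem relJ_nonneg (hω : 0 ≤ ω) {φ : S.testFun} (hφ : φ ∈ S.psh ω) : 0 ≤ μ.relJ φ :=
  sub_nonneg.2 (μ.energy_sub_le_J hω hφ)

theorem exists_relJ_lt (hω : 0 ≤ ω) {ε : ℝ} (hε : 0 < ε) : ∃ ψ ∈ S.psh ω, μ.relJ ψ < ε := by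
  have : Nonempty (S.psh ω) := ⟨⟨0, zero_mem_psh hω⟩⟩
  have h : μ.J - ε < ⨆ φ : S.psh ω, (S.energy ω φ.1 - μ.prob.1 (φ.1 : C(X, ℝ))) := by
    rw [← J_eq_iSup μ hω]
    linarith
  obtain ⟨φ, hφ⟩ := exists_lt_of_lt_ciSup h
  refine ⟨φ.1, φ.2, ?_⟩
  change μ.J - (S.energy ω φ.1 - μ.prob.1 (φ.1 : C(X, ℝ))) < ε
  linarith

theorem dirichlet_le_relJ (hω : 0 ≤ ω) {φ ψ : S.testFun} (hφ : φ ∈ S.psh ω) (hψ : ψ ∈ S.psh ω) :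
    S.dirichlet ω φ ψ ≤ mainConst m * (μ.relJ φ + μ.relJ ψ) :=
  dirichlet_le_of_forall hω hφ hψ fun _ hτ => μ.energy_sub_le_J hω hτ

variable {μ}

theorem J_of_MA (hω : 0 ≤ ω) {φ : S.testFun} (hφ : φ ∈ S.psh ω) (h : μ.radon = S.MA ω φ) :
    μ.J = S.energy ω φ - S.MA ω φ φ := by
  have h0 := μ.energy_sub_le_J hω hφ
  rw [h] at h0
  refine le_antisymm ?_ h0
  have : Nonempty (S.psh ω) := ⟨⟨0, zero_mem_psh hω⟩⟩
  rw [J_eq_iSup μ hω]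
  refine ciSup_le fun τ => ?_
  have h1 : μ.prob.1 (τ.1 : C(X, ℝ)) = S.MA ω φ τ.1 := congrArg (fun L => L (τ.1 : C(X, ℝ))) h
  rw [h1]
  have h2 := dirichlet_nonneg hω hφ τ.2
  rw [dirichlet, Submodule.coe_sub, map_sub] at h2
  linarith

theorem relJ_of_MA (hω : 0 ≤ ω) {φ : S.testFun} (hφ : φ ∈ S.psh ω) (h : μ.radon = S.MA ω φ)
    (ψ : S.testFun) : μ.relJ ψ = S.dirichlet ω φ ψ := by
  rw [relJ, J_of_MA hω hφ h, dirichlet, h, Submodule.coe_sub, map_sub]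
  ring

theorem J_eq_dirichlet (hω : 0 ≤ ω) {φ : S.testFun} (hφ : φ ∈ S.psh ω)
    (h : μ.radon = S.MA ω φ) : μ.J = S.dirichlet ω φ 0 := by
  rw [← relJ_of_MA hω hφ h, relJ_zero]

variable (μ)

theorem continuous_prob : Continuous (FiniteEnergy.prob : S.FiniteEnergy ω → RadonProb X) :=
  continuous_iff_le_induced.2 inf_le_left

theorem continuous_J : Continuous (FiniteEnergy.J : S.FiniteEnergy ω → ℝ) :=
  continuous_iff_le_induced.2 inf_le_right

theorem continuous_radon (f : C(X, ℝ)) : Continuous fun μ : S.FiniteEnergy ω => μ.radon f :=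
  (RadonProb.continuous_apply f).comp continuous_prob

theorem continuous_relJ (ψ : S.testFun) : Continuous fun μ : S.FiniteEnergy ω => μ.relJ ψ :=
  continuous_J.sub (continuous_const.sub (continuous_radon _))

variable {μ}

theorem tendsto_of_testFun {ι : Type*} {l : Filter ι} {μs : ι → S.FiniteEnergy ω}
    (h1 : ∀ f : S.testFun, Tendsto (fun i => (μs i).radon f) l (𝓝 (μ.radon f)))
    (h2 : Tendsto (fun i => (μs i).J) l (𝓝 μ.J)) : Tendsto μs l (𝓝 μ) := by
  have hn : 𝓝 μ = comap FiniteEnergy.prob (𝓝 μ.prob) ⊓ comap FiniteEnergy.J (𝓝 μ.J) := by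
    rw [← nhds_induced, ← nhds_induced]
    exact nhds_inf (t₁ := TopologicalSpace.induced FiniteEnergy.prob inferInstance)
      (t₂ := TopologicalSpace.induced FiniteEnergy.J inferInstance)
  rw [hn, tendsto_inf, tendsto_comap_iff, tendsto_comap_iff]
  exact ⟨RadonProb.tendsto_of_dense S.dense_testFun fun f hf => h1 ⟨f, hf⟩, h2⟩

theorem ext_of_testFun {ν : S.FiniteEnergy ω} (h : ∀ f : S.testFun, μ.radon f = ν.radon f) :
    μ = ν := by
  have h1 : μ.radon = ν.radon := by
    refine ContinuousLinearMap.coeFn_injective ?_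
    exact Continuous.ext_on S.dense_testFun μ.radon.continuous ν.radon.continuous
      fun f hf => h ⟨f, hf⟩
  cases μ
  cases ν
  congr 1
  exact Subtype.ext h1

end FiniteEnergy

/-- The Monge--Ampère measure of an `ω`-psh test function, as a measure of finite energy. -/
def feMA (hω : 0 ≤ ω) (hvol : 0 < S.vol ω) {φ : S.testFun} (hφ : φ ∈ S.psh ω) :
    S.FiniteEnergy ω where
  prob := probMA hω hvol hφ
  finite := (measureEnergy_lt_top_iff hω).2 ⟨S.energy ω φ - S.MA ω φ φ, fun τ hτ => by
    have h2 := dirichlet_nonneg hω hφ hτ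
    rw [dirichlet, Submodule.coe_sub, map_sub] at h2
    have h3 : (probMA hω hvol hφ).1 τ = S.MA ω φ τ := rfl
    rw [h3]
    linarith⟩

theorem feMA_radon (hω : 0 ≤ ω) (hvol : 0 < S.vol ω) {φ : S.testFun} (hφ : φ ∈ S.psh ω) :
    (feMA hω hvol hφ).radon = S.MA ω φ := rfl

/-! ### Maximizing sequences -/

theorem IsMaximizing.tendsto_relJ {μ : S.FiniteEnergy ω} {ψ : ℕ → S.testFun}
    (h : S.IsMaximizing μ ψ) : Tendsto (fun i => μ.relJ (ψ i)) atTop (𝓝 0) := by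
  simpa [FiniteEnergy.relJ] using h.2.const_sub μ.J

theorem exists_isMaximizing (hω : 0 ≤ ω) (μ : S.FiniteEnergy ω) : ∃ ψ, S.IsMaximizing μ ψ := by
  choose ψ hψ h using fun i : ℕ => μ.exists_relJ_lt hω (Nat.one_div_pos_of_nat (n := i) (α := ℝ))
  refine ⟨ψ, hψ, ?_⟩
  have h1 : Tendsto (fun i => μ.relJ (ψ i)) atTop (𝓝 0) :=
    squeeze_zero (fun i => μ.relJ_nonneg hω (hψ i)) (fun i => (h i).le)
      tendsto_one_div_add_atTop_nhds_zero_nat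
  simpa [FiniteEnergy.relJ] using h1.const_sub μ.J

theorem IsMaximizing.exists_bound (hω : 0 ≤ ω) {μ : S.FiniteEnergy ω} {ψ : ℕ → S.testFun}
    (h : S.IsMaximizing μ ψ) : ∃ R : ℝ, 0 < R ∧ ∀ i, S.dirichlet ω (ψ i) 0 ≤ R ∧
      S.dirichlet ω 0 (ψ i) ≤ R := by
  obtain ⟨B, hB⟩ := h.tendsto_relJ.bddAbove_range
  have h0 := zero_mem_psh (S := S) hω
  have hC := mainConst_pos m
  refine ⟨max 1 (mainConst m * (B + μ.relJ 0)), by positivity, fun i => ?_⟩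
  have h1 : μ.relJ (ψ i) ≤ B := hB ⟨i, rfl⟩
  exact ⟨((μ.dirichlet_le_relJ hω (h.1 i) h0).trans
      (mul_le_mul_of_nonneg_left (by linarith) hC.le)).trans (le_max_right _ _),
    ((μ.dirichlet_le_relJ hω h0 (h.1 i)).trans
      (mul_le_mul_of_nonneg_left (by linarith) hC.le)).trans (le_max_right _ _)⟩

theorem IsMaximizing.tendsto_MA (hω : 0 ≤ ω) (hvol : 0 < S.vol ω) (horth : S.HasOrthogonality ω)
    {μ : S.FiniteEnergy ω} {ψ : ℕ → S.testFun} (h : S.IsMaximizing μ ψ) (f : S.testFun) :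
    Tendsto (fun i => S.MA ω (ψ i) f) atTop (𝓝 (μ.radon f)) := by
  have key : ∀ (g : S.testFun) (ρ : ℝ), 0 < ρ →
      ∀ᶠ i in atTop, S.MA ω (ψ i) g ≤ μ.radon g + ρ := by
    intro g ρ hρ
    obtain ⟨ε, hε, hε'⟩ := exists_MA_le_of_forall hω hvol horth (μ := μ.prob)
      (fun φ hφ => μ.energy_sub_le_J hω hφ) g hρ
    filter_upwards [h.2.eventually (lt_mem_nhds (by linarith : μ.J - ε < μ.J))] with i hi
    exact hε' _ (h.1 i) hi.le
  refine Metric.tendsto_nhds.2 fun ε hε => ?_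
  filter_upwards [key f (ε / 2) (by positivity), key (-f) (ε / 2) (by positivity)] with i h1 h2
  rw [Submodule.coe_neg, map_neg, map_neg] at h2
  rw [Real.dist_eq, abs_lt]
  constructor <;> linarith

/-- The energies of the Monge--Ampère measures of a maximizing sequence converge to the energy
of its limit. -/
theorem IsMaximizing.tendsto_J (hω : 0 ≤ ω) (hvol : 0 < S.vol ω) (horth : S.HasOrthogonality ω)
    {μ : S.FiniteEnergy ω} {ψ : ℕ → S.testFun} (h : S.IsMaximizing μ ψ) :
    Tendsto (fun i => S.dirichlet ω (ψ i) 0) atTop (𝓝 μ.J) := by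
  obtain ⟨R, hR, hψR⟩ := h.exists_bound hω
  have h0 := zero_mem_psh (S := S) hω
  have h00 : S.dirichlet ω 0 0 ≤ R := by simp [dirichlet, hR.le]
  have hC := mainConst_pos m
  have hα0 : 0 < ((2 : ℝ) ^ (m + 1))⁻¹ := by positivity
  set α := ((2 : ℝ) ^ (m + 1))⁻¹
  set A := mainConst m * R ^ α * R ^ ((1 : ℝ) / 2 - α)
  have hA : 0 ≤ A := by positivity
  -- compare `∫ ψᵢ μ` with `∫ ψᵢ MA(ψᵢ)` by means of `∫ ψᵢ MA(ψⱼ)` for `j → ∞`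
  have key : ∀ i, |S.MA ω (ψ i) (ψ i) - μ.radon (ψ i)| ≤
      A * √(mainConst m * μ.relJ (ψ i)) := by
    intro i
    have lim1 : Tendsto (fun j => |S.MA ω (ψ i) (ψ i) - S.MA ω (ψ j) (ψ i)|) atTop
        (𝓝 |S.MA ω (ψ i) (ψ i) - μ.radon (ψ i)|) :=
      ((h.tendsto_MA hω hvol horth (ψ i)).const_sub _).abs
    have lim2 : Tendsto (fun j => A * √(mainConst m * (μ.relJ (ψ i) + μ.relJ (ψ j)))) atTop
        (𝓝 (A * √(mainConst m * (μ.relJ (ψ i) + 0)))) :=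
      ((h.tendsto_relJ.const_add _).const_mul _).sqrt.const_mul _
    rw [add_zero] at lim2
    refine le_of_tendsto_of_tendsto' lim1 lim2 fun j => ?_
    have h1 := abs_MA_sub_MA_sub_le_dirichlet hω (h.1 i) h0 (h.1 i) (h.1 j) hR (hψR i).2 h00
      (hψR i).1 (hψR j).1
    rw [sub_zero, _root_.sub_apply, ← Real.sqrt_eq_rpow] at h1
    refine h1.trans ?_
    have h2 : S.dirichlet ω (ψ i) 0 ^ α ≤ R ^ α :=
      Real.rpow_le_rpow (dirichlet_nonneg hω (h.1 i) h0) (hψR i).1 hα0.le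
    have h3 := Real.sqrt_le_sqrt (μ.dirichlet_le_relJ hω (h.1 i) (h.1 j))
    calc _ ≤ mainConst m * R ^ α * √(mainConst m * (μ.relJ (ψ i) + μ.relJ (ψ j))) *
          R ^ ((1 : ℝ) / 2 - α) := by gcongr
      _ = _ := by ring
  have lim3 : Tendsto (fun i => A * √(mainConst m * μ.relJ (ψ i))) atTop (𝓝 0) := by
    simpa using (h.tendsto_relJ.const_mul (mainConst m)).sqrt.const_mul A
  have lim4 := squeeze_zero_norm (fun i => (Real.norm_eq_abs _).trans_le (key i)) lim3
  have lim5 := h.2.sub lim4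
  rw [sub_zero] at lim5
  refine lim5.congr fun i => ?_
  rw [dirichlet, zero_sub, Submodule.coe_neg, map_neg, energy_zero]
  ring

end PluripotentialData

/-! ### The uniform structure of a quasi-metric -/

namespace IsQuasiMetricWith

variable {M : Type*} {C : ℝ} {d : M → M → ℝ} (h : IsQuasiMetricWith C d)

theorem hasBasis_uniformity :
    (@uniformity M h.uniformSpace).HasBasis (fun ε : ℝ => 0 < ε) fun ε => {p | d p.1 p.2 < ε} := by
  refine ⟨fun s => ?_⟩
  constructor
  · rintro ⟨_, ⟨ε, hε, rfl⟩, hs⟩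
    exact ⟨ε, hε, hs⟩
  · rintro ⟨ε, hε, hs⟩
    exact ⟨_, ⟨ε, hε, rfl⟩, hs⟩

theorem hasBasis_nhds (x : M) : (@nhds M h.uniformSpace.toTopologicalSpace x).HasBasis
    (fun ε : ℝ => 0 < ε) fun ε => {y | d x y < ε} := by
  let _ := h.uniformSpace
  exact nhds_basis_uniformity' h.hasBasis_uniformity

theorem completeSpace_of_forall (H : ∀ f : Filter M, f.NeBot →
    (∀ ε : ℝ, 0 < ε → ∃ t ∈ f, ∀ x ∈ t, ∀ y ∈ t, d x y < ε) →
      ∃ x, ∀ ε : ℝ, 0 < ε → ∀ᶠ y in f, d x y < ε) : @CompleteSpace M h.uniformSpace := by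
  let _ := h.uniformSpace
  refine ⟨fun {f} hf => ?_⟩
  obtain ⟨x, hx⟩ := H f hf.1 fun ε hε => by
    obtain ⟨t, ht, hts⟩ := Filter.mem_prod_self_iff.1
      (hf.2 (h.hasBasis_uniformity.mem_of_mem hε))
    exact ⟨t, ht, fun x hx y hy => hts (Set.mk_mem_prod hx hy)⟩
  exact ⟨x, (h.hasBasis_nhds x).ge_iff.2 hx⟩

end IsQuasiMetricWith

namespace PluripotentialData

variable {X : Type*} [TopologicalSpace X] [CompactSpace X]
  {Z : Type*} [AddCommGroup Z] [Module ℝ Z] [PartialOrder Z] [IsOrderedAddMonoid Z]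
  [IsOrderedModule ℝ Z]
variable {m : ℕ} {S : PluripotentialData X Z (m + 1)} {ω : Z}

/-! ### The quasi-metric on measures of finite energy -/

theorem tendsto_rpow_estimate {ι : Type*} {l : Filter ι} {x : ι → ℝ} {x₀ : ℝ}
    (h : Tendsto x l (𝓝 x₀)) {α : ℝ} (hα : 0 ≤ α) (A B : ℝ) :
    Tendsto (fun i => A * x i ^ α * B) l (𝓝 (A * x₀ ^ α * B)) :=
  ((h.rpow_const (Or.inr hα)).const_mul A).mul_const B

theorem tendsto_dirichlet_sub (hω : 0 ≤ ω) {ι : Type*} {l : Filter ι} {p q p' q' : ι → S.testFun}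
    (hp : ∀ i, p i ∈ S.psh ω) (hq : ∀ i, q i ∈ S.psh ω) (hp' : ∀ i, p' i ∈ S.psh ω)
    (hq' : ∀ i, q' i ∈ S.psh ω) {R : ℝ} (hR : 0 < R) (hpR : ∀ i, S.dirichlet ω (p i) 0 ≤ R)
    (hqR : ∀ i, S.dirichlet ω (q i) 0 ≤ R) (hpR' : ∀ i, S.dirichlet ω (p' i) 0 ≤ R)
    (hqR' : ∀ i, S.dirichlet ω (q' i) 0 ≤ R)
    (hpp : Tendsto (fun i => S.dirichlet ω (p i) (p' i)) l (𝓝 0))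
    (hqq : Tendsto (fun i => S.dirichlet ω (q i) (q' i)) l (𝓝 0)) :
    Tendsto (fun i => S.dirichlet ω (p i) (q i) - S.dirichlet ω (p' i) (q' i)) l (𝓝 0) := by
  have hα : 0 < ((2 : ℝ) ^ (m + 1))⁻¹ := by positivity
  have lim := tendsto_rpow_estimate (hpp.max hqq) hα.le (mainConst m)
    (R ^ (1 - ((2 : ℝ) ^ (m + 1))⁻¹))
  rw [max_self, Real.zero_rpow hα.ne', mul_zero, zero_mul] at lim
  exact squeeze_zero_norm (fun i => (Real.norm_eq_abs _).trans_le
    (abs_dirichlet_sub_le hω (hp i) (hq i) (hp' i) (hq' i) hR (hpR i) (hqR i) (hpR' i) (hqR' i)))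
    lim

/-- A maximizing sequence for `μ`. -/
def maxSeq (hω : 0 ≤ ω) (μ : S.FiniteEnergy ω) : ℕ → S.testFun :=
  (exists_isMaximizing hω μ).choose

theorem isMaximizing_maxSeq (hω : 0 ≤ ω) (μ : S.FiniteEnergy ω) :
    S.IsMaximizing μ (maxSeq hω μ) :=
  (exists_isMaximizing hω μ).choose_spec

/-- The continuous extension of the Dirichlet functional to measures of finite energy, defined
as a limit along maximizing sequences. -/
def energyDist (hω : 0 ≤ ω) (μ ν : S.FiniteEnergy ω) : ℝ :=
  limUnder atTop fun i => S.dirichlet ω (maxSeq hω μ i) (maxSeq hω ν i)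

theorem IsMaximizing.tendsto_dirichlet (hω : 0 ≤ ω) {μ : S.FiniteEnergy ω} {ψ χ : ℕ → S.testFun}
    (h : S.IsMaximizing μ ψ) (h' : S.IsMaximizing μ χ) :
    Tendsto (fun i : ℕ × ℕ => S.dirichlet ω (ψ i.1) (χ i.2)) atTop (𝓝 0) := by
  rw [← prod_atTop_atTop_eq]
  refine squeeze_zero (fun i => dirichlet_nonneg hω (h.1 _) (h'.1 _))
    (fun i => μ.dirichlet_le_relJ hω (h.1 _) (h'.1 _)) ?_
  simpa using ((h.tendsto_relJ.comp tendsto_fst).add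
    (h'.tendsto_relJ.comp tendsto_snd)).const_mul (mainConst m)

theorem IsMaximizing.tendsto_dirichlet_diag (hω : 0 ≤ ω) {μ : S.FiniteEnergy ω}
    {ψ χ : ℕ → S.testFun} (h : S.IsMaximizing μ ψ) (h' : S.IsMaximizing μ χ) :
    Tendsto (fun i => S.dirichlet ω (ψ i) (χ i)) atTop (𝓝 0) :=
  squeeze_zero (fun i => dirichlet_nonneg hω (h.1 i) (h'.1 i))
    (fun i => μ.dirichlet_le_relJ hω (h.1 i) (h'.1 i))
    (by simpa using (h.tendsto_relJ.add h'.tendsto_relJ).const_mul (mainConst m))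

theorem dirichlet_self (φ : S.testFun) : S.dirichlet ω φ φ = 0 := by
  rw [dirichlet, sub_self, sub_self, Submodule.coe_zero, map_zero, add_zero]

theorem tendsto_energyDist (hω : 0 ≤ ω) (μ ν : S.FiniteEnergy ω) :
    Tendsto (fun i => S.dirichlet ω (maxSeq hω μ i) (maxSeq hω ν i)) atTop
      (𝓝 (energyDist hω μ ν)) := by
  have hμ := isMaximizing_maxSeq hω μ
  have hν := isMaximizing_maxSeq hω ν
  obtain ⟨R₁, hR₁, h₁⟩ := hμ.exists_bound hω
  obtain ⟨R₂, hR₂, h₂⟩ := hν.exists_bound hω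
  refine CauchySeq.tendsto_limUnder (cauchySeq_iff_tendsto_dist_atTop_0.2 ?_)
  have := tendsto_dirichlet_sub (l := (atTop : Filter (ℕ × ℕ))) hω
    (p := fun i => maxSeq hω μ i.1) (q := fun i => maxSeq hω ν i.1)
    (p' := fun i => maxSeq hω μ i.2) (q' := fun i => maxSeq hω ν i.2) (fun i => hμ.1 _)
    (fun i => hν.1 _) (fun i => hμ.1 _) (fun i => hν.1 _) (lt_max_of_lt_left hR₁ : 0 < max R₁ R₂)
    (fun i => (h₁ _).1.trans (le_max_left _ _)) (fun i => (h₂ _).1.trans (le_max_right _ _))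
    (fun i => (h₁ _).1.trans (le_max_left _ _)) (fun i => (h₂ _).1.trans (le_max_right _ _))
    (hμ.tendsto_dirichlet hω hμ) (hν.tendsto_dirichlet hω hν)
  simpa [Real.dist_eq] using this.abs

section

variable (hω : 0 ≤ ω)

theorem energyDist_nonneg (μ ν : S.FiniteEnergy ω) : 0 ≤ energyDist hω μ ν :=
  ge_of_tendsto' (tendsto_energyDist hω μ ν) fun i =>
    dirichlet_nonneg hω ((isMaximizing_maxSeq hω μ).1 i) ((isMaximizing_maxSeq hω ν).1 i)

theorem energyDist_symm_le (μ ν : S.FiniteEnergy ω) :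
    energyDist hω μ ν ≤ mainConst m * energyDist hω ν μ :=
  le_of_tendsto_of_tendsto' (tendsto_energyDist hω μ ν)
    ((tendsto_energyDist hω ν μ).const_mul _) fun i =>
    dirichlet_symm_le hω ((isMaximizing_maxSeq hω μ).1 i) ((isMaximizing_maxSeq hω ν).1 i)

theorem energyDist_triangle (μ ν ρ : S.FiniteEnergy ω) :
    energyDist hω μ ν ≤ mainConst m * (energyDist hω μ ρ + energyDist hω ρ ν) :=
  le_of_tendsto_of_tendsto' (tendsto_energyDist hω μ ν)
    (((tendsto_energyDist hω μ ρ).add (tendsto_energyDist hω ρ ν)).const_mul _) fun i =>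
    dirichlet_triangle hω ((isMaximizing_maxSeq hω μ).1 i) ((isMaximizing_maxSeq hω ν).1 i)
      ((isMaximizing_maxSeq hω ρ).1 i)

theorem energyDist_self (μ : S.FiniteEnergy ω) : energyDist hω μ μ = 0 := by
  refine tendsto_nhds_unique (tendsto_energyDist hω μ μ) ?_
  simp only [dirichlet_self]
  exact tendsto_const_nhds

variable (hvol : 0 < S.vol ω) (horth : S.HasOrthogonality ω)
include hvol horth

include hω in
theorem IsMaximizing.tendsto_dirichlet_right {μ : S.FiniteEnergy ω} {χ : ℕ → S.testFun}
    (h : S.IsMaximizing μ χ) (ψ : S.testFun) :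
    Tendsto (fun i => S.dirichlet ω (χ i) ψ) atTop (𝓝 (μ.relJ ψ)) := by
  have h4 := ((h.tendsto_J hω hvol horth).sub_const (S.energy ω ψ)).add
    (h.tendsto_MA hω hvol horth ψ)
  have h5 : μ.relJ ψ = μ.J - S.energy ω ψ + μ.radon ψ := by
    rw [FiniteEnergy.relJ]
    ring
  rw [h5]
  refine h4.congr fun i => ?_
  rw [dirichlet, dirichlet, Submodule.coe_sub, Submodule.coe_sub, map_sub, map_sub,
    Submodule.coe_zero, map_zero, energy_zero]
  ring

theorem energyDist_eq_relJ {μ ν : S.FiniteEnergy ω} {ψ : S.testFun} (hψ : ψ ∈ S.psh ω)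
    (hν : ν.radon = S.MA ω ψ) : energyDist hω μ ν = μ.relJ ψ := by
  have h1 := isMaximizing_maxSeq hω μ
  have h2 := isMaximizing_maxSeq hω ν
  have h3 : S.IsMaximizing ν fun _ => ψ := by
    refine ⟨fun _ => hψ, ?_⟩
    rw [FiniteEnergy.J_of_MA hω hψ hν, hν]
    exact tendsto_const_nhds
  have lim1 := h1.tendsto_dirichlet_right hω hvol horth ψ
  obtain ⟨R₁, hR₁, b₁⟩ := h1.exists_bound hω
  obtain ⟨R₂, hR₂, b₂⟩ := h2.exists_bound hω
  obtain ⟨R₃, hR₃, b₃⟩ := h3.exists_bound hω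
  set R := max R₁ (max R₂ R₃)
  have hR : 0 < R := lt_max_of_lt_left hR₁
  have le1 : R₁ ≤ R := le_max_left _ _
  have le2 : R₂ ≤ R := (le_max_left _ _).trans (le_max_right _ _)
  have le3 : R₃ ≤ R := (le_max_right _ _).trans (le_max_right _ _)
  have conv1 : Tendsto (fun i => S.dirichlet ω (maxSeq hω μ i) (maxSeq hω μ i)) atTop (𝓝 0) := by
    simp only [dirichlet_self]
    exact tendsto_const_nhds
  have conv2 : Tendsto (fun i => S.dirichlet ω (maxSeq hω ν i) ψ) atTop (𝓝 0) :=
    h2.tendsto_dirichlet_diag hω h3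
  have lim2 := tendsto_dirichlet_sub hω (l := atTop) h1.1 h2.1 h1.1 (fun _ : ℕ => hψ) hR
    (fun i => (b₁ i).1.trans le1) (fun i => (b₂ i).1.trans le2) (fun i => (b₁ i).1.trans le1)
    (fun i => (b₃ i).1.trans le3) conv1 conv2
  have lim3 := lim2.add lim1
  simp only [sub_add_cancel, zero_add] at lim3
  exact tendsto_nhds_unique (tendsto_energyDist hω μ ν) lim3

theorem energyDist_eq_J {μ ν : S.FiniteEnergy ω} (hν : ν.radon = S.MA ω 0) :
    energyDist hω μ ν = μ.J := by
  rw [energyDist_eq_relJ hω hvol horth (zero_mem_psh hω) hν, FiniteEnergy.relJ_zero]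

theorem exists_abs_radon_sub_le (f : S.testFun) : ∃ A : ℝ, 0 ≤ A ∧
    ∀ μ ν : S.FiniteEnergy ω, |(μ.radon - ν.radon) f| ≤ A * √(energyDist hω μ ν) := by
  obtain ⟨A, hA0, hA⟩ := exists_abs_MA_sub_MA_le hω f
  refine ⟨A, hA0, fun μ ν => ?_⟩
  have h1 := isMaximizing_maxSeq hω μ
  have h2 := isMaximizing_maxSeq hω ν
  exact le_of_tendsto_of_tendsto'
    ((h1.tendsto_MA hω hvol horth f).sub (h2.tendsto_MA hω hvol horth f)).abs
    ((tendsto_energyDist hω μ ν).sqrt.const_mul A) fun i => hA _ (h1.1 i) _ (h2.1 i)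

theorem energyDist_eq_zero_iff (μ ν : S.FiniteEnergy ω) : energyDist hω μ ν = 0 ↔ μ = ν := by
  refine ⟨fun h => FiniteEnergy.ext_of_testFun fun f => ?_, fun h => h ▸ energyDist_self hω μ⟩
  obtain ⟨A, -, hA⟩ := exists_abs_radon_sub_le hω hvol horth f
  have := hA μ ν
  rw [h, Real.sqrt_zero, mul_zero] at this
  exact sub_eq_zero.1 (abs_nonpos_iff.1 this)

theorem isQuasiMetricWith_energyDist :
    IsQuasiMetricWith (mainConst m) (energyDist hω : S.FiniteEnergy ω → S.FiniteEnergy ω → ℝ) where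
  pos := mainConst_pos m
  nonneg := energyDist_nonneg hω
  quasi_symm μ ν := ⟨by
    rw [inv_mul_le_iff₀ (mainConst_pos m)]
    exact energyDist_symm_le hω μ ν, energyDist_symm_le hω ν μ⟩
  quasi_triangle μ ν ρ := energyDist_triangle hω μ ν ρ
  eq_zero_iff := energyDist_eq_zero_iff hω hvol horth

theorem abs_energyDist_sub_le {R : ℝ} {μ μ' ν ν' : S.FiniteEnergy ω} (hR : 0 < R)
    (hμ : μ.J ≤ R) (hμ' : μ'.J ≤ R) (hν : ν.J ≤ R) (hν' : ν'.J ≤ R) :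
    |energyDist hω μ ν - energyDist hω μ' ν'| ≤
      mainConst m * max (energyDist hω μ μ') (energyDist hω ν ν') ^ ((2 : ℝ) ^ (m + 1))⁻¹ *
        R ^ (1 - ((2 : ℝ) ^ (m + 1))⁻¹) := by
  have m1 := isMaximizing_maxSeq hω μ
  have m2 := isMaximizing_maxSeq hω μ'
  have m3 := isMaximizing_maxSeq hω ν
  have m4 := isMaximizing_maxSeq hω ν'
  have hα : 0 < ((2 : ℝ) ^ (m + 1))⁻¹ := by positivity
  -- the approximating sequences have energy at most `r i`, and `r i` tends to `R`
  let r : ℕ → ℝ := fun i => max R (max (max (S.dirichlet ω (maxSeq hω μ i) 0)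
    (S.dirichlet ω (maxSeq hω μ' i) 0)) (max (S.dirichlet ω (maxSeq hω ν i) 0)
    (S.dirichlet ω (maxSeq hω ν' i) 0)))
  have hr : Tendsto r atTop (𝓝 R) := by
    have := (tendsto_const_nhds (x := R) (f := (atTop : Filter ℕ))).max
      (((m1.tendsto_J hω hvol horth).max (m2.tendsto_J hω hvol horth)).max
        ((m3.tendsto_J hω hvol horth).max (m4.tendsto_J hω hvol horth)))
    rwa [max_eq_left (max_le (max_le hμ hμ') (max_le hν hν'))] at this
  refine le_of_tendsto_of_tendsto'
    ((tendsto_energyDist hω μ ν).sub (tendsto_energyDist hω μ' ν')).abs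
    (((((tendsto_energyDist hω μ μ').max (tendsto_energyDist hω ν ν')).rpow_const
      (Or.inr hα.le)).const_mul (mainConst m)).mul (hr.rpow_const (Or.inl hR.ne'))) fun i => ?_
  refine abs_dirichlet_sub_le hω (m1.1 i) (m3.1 i) (m2.1 i) (m4.1 i)
    (lt_max_of_lt_left hR) ?_ ?_ ?_ ?_ <;> simp [r]

theorem abs_radon_sub_sub_le {R : ℝ} {μ ν : S.FiniteEnergy ω} (hR : 0 < R)
    (hμ : μ.J ≤ R) (hν : ν.J ≤ R) {φ ψ : S.testFun} (hφ : φ ∈ S.pshLe ω R) (hψ : ψ ∈ S.pshLe ω R) :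
    |(μ.radon - ν.radon) ((φ - ψ : S.testFun) : C(X, ℝ))| ≤
      mainConst m * S.dirichlet ω φ ψ ^ ((2 : ℝ) ^ (m + 1))⁻¹ *
        energyDist hω μ ν ^ ((1 : ℝ) / 2) * R ^ ((1 : ℝ) / 2 - ((2 : ℝ) ^ (m + 1))⁻¹) := by
  have m1 := isMaximizing_maxSeq hω μ
  have m2 := isMaximizing_maxSeq hω ν
  -- the approximating sequences have energy at most `r i`, and `r i` tends to `R`
  let r : ℕ → ℝ := fun i => max R (max (S.dirichlet ω (maxSeq hω μ i) 0)
    (S.dirichlet ω (maxSeq hω ν i) 0))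
  have hr : Tendsto r atTop (𝓝 R) := by
    have := (tendsto_const_nhds (x := R) (f := (atTop : Filter ℕ))).max
      ((m1.tendsto_J hω hvol horth).max (m2.tendsto_J hω hvol horth))
    rwa [max_eq_left (max_le hμ hν)] at this
  refine le_of_tendsto_of_tendsto'
    ((m1.tendsto_MA hω hvol horth (φ - ψ)).sub (m2.tendsto_MA hω hvol horth (φ - ψ))).abs
    ((((tendsto_energyDist hω μ ν).rpow_const (Or.inr (by norm_num))).const_mul
      (mainConst m * S.dirichlet ω φ ψ ^ ((2 : ℝ) ^ (m + 1))⁻¹)).mul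
        (hr.rpow_const (Or.inl hR.ne'))) fun i => ?_
  refine abs_MA_sub_MA_sub_le_dirichlet hω hφ.1 hψ.1 (m1.1 i) (m2.1 i)
    (lt_max_of_lt_left hR) (hφ.2.trans (le_max_left _ _)) (hψ.2.trans (le_max_left _ _)) ?_ ?_ <;>
    simp [r]

/-! ### The strong topology -/

theorem tendsto_of_energyDist {ι : Type*} {l : Filter ι} {μs : ι → S.FiniteEnergy ω}
    {μ : S.FiniteEnergy ω} (h : Tendsto (fun i => energyDist hω μ (μs i)) l (𝓝 0)) :
    Tendsto μs l (𝓝 μ) := by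
  have h' : Tendsto (fun i => energyDist hω (μs i) μ) l (𝓝 0) :=
    squeeze_zero (fun i => energyDist_nonneg hω _ _) (fun i => energyDist_symm_le hω _ _)
      (by simpa using h.const_mul (mainConst m))
  refine FiniteEnergy.tendsto_of_testFun (fun f => ?_) ?_
  · obtain ⟨A, -, hA⟩ := exists_abs_radon_sub_le hω hvol horth f
    rw [← tendsto_sub_nhds_zero_iff]
    exact squeeze_zero_norm (fun i => (Real.norm_eq_abs _).trans_le (hA (μs i) μ))
      (by simpa using h'.sqrt.const_mul A)
  · have h0 := zero_mem_psh (S := S) hω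
    set μ₀ := feMA hω hvol h0
    have hJ : ∀ ν : S.FiniteEnergy ω, ν.J = energyDist hω ν μ₀ := fun ν =>
      (energyDist_eq_J hω hvol horth rfl).symm
    set R := max 1 (max μ₀.J (max μ.J (mainConst m * (1 + μ.J))))
    have hR : 0 < R := lt_max_of_lt_left one_pos
    have hRμ₀ : μ₀.J ≤ R := (le_max_left _ _).trans (le_max_right _ _)
    have hRμ : μ.J ≤ R :=
      ((le_max_left _ _).trans (le_max_right _ _)).trans (le_max_right _ _)
    have hR3 : mainConst m * (1 + μ.J) ≤ R :=
      ((le_max_right _ _).trans (le_max_right _ _)).trans (le_max_right _ _)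
    have hα : 0 < ((2 : ℝ) ^ (m + 1))⁻¹ := by positivity
    have lim := tendsto_rpow_estimate h' hα.le (mainConst m) (R ^ (1 - ((2 : ℝ) ^ (m + 1))⁻¹))
    rw [Real.zero_rpow hα.ne', mul_zero, zero_mul] at lim
    rw [← tendsto_sub_nhds_zero_iff]
    refine squeeze_zero_norm' ?_ lim
    filter_upwards [h'.eventually (gt_mem_nhds one_pos)] with i hi
    have hRi : (μs i).J ≤ R := by
      rw [hJ]
      refine (energyDist_triangle hω _ _ μ).trans (le_trans ?_ hR3)
      rw [← hJ]
      exact mul_le_mul_of_nonneg_left (by linarith) (mainConst_pos m).le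
    have := abs_energyDist_sub_le hω hvol horth hR hRi hRμ hRμ₀ hRμ₀
    rwa [energyDist_self, max_eq_left (energyDist_nonneg hω _ _), ← hJ, ← hJ] at this

/-- The balls of `energyDist` are neighbourhoods in the strong topology: `μ` is close to some
`MA_ω(ψ)`, and `energyDist` to `MA_ω(ψ)` is strongly continuous. -/
theorem tendsto_energyDist_self (μ : S.FiniteEnergy ω) :
    Tendsto (fun ν => energyDist hω μ ν) (𝓝 μ) (𝓝 0) := by
  have hC := mainConst_pos m
  refine Metric.tendsto_nhds.2 fun ε hε => ?_
  obtain ⟨ψ, hψ, hψε⟩ := μ.exists_relJ_lt hω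
    (by positivity : 0 < ε / (mainConst m * (1 + mainConst m)))
  filter_upwards [(FiniteEnergy.continuous_relJ ψ).continuousAt.eventually (gt_mem_nhds hψε)]
    with ν hν
  set κ := feMA hω hvol hψ
  have h1 : energyDist hω μ κ = μ.relJ ψ := energyDist_eq_relJ hω hvol horth hψ rfl
  have h2 : energyDist hω ν κ = ν.relJ ψ := energyDist_eq_relJ hω hvol horth hψ rfl
  have h3 := energyDist_symm_le hω κ ν
  have h4 := energyDist_triangle hω μ ν κ
  rw [h2] at h3
  rw [h1] at h4
  rw [Real.dist_eq, sub_zero, abs_of_nonneg (energyDist_nonneg hω _ _)]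
  rw [lt_div_iff₀ (by positivity)] at hψε hν
  have h5 := μ.relJ_nonneg hω hψ
  have h6 := mul_le_mul_of_nonneg_left h3 hC.le
  have h7 : ∀ x : ℝ, x * (mainConst m * (1 + mainConst m)) < ε →
      (1 + mainConst m) * (mainConst m * x) < ε := fun x hx => lt_of_eq_of_lt (by ring) hx
  have h8 := h7 _ hψε
  have h9 := h7 _ hν
  have h10 : mainConst m * (μ.relJ ψ + mainConst m * ν.relJ ψ) ≤
      max ((1 + mainConst m) * (mainConst m * μ.relJ ψ))
        ((1 + mainConst m) * (mainConst m * ν.relJ ψ)) := by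
    rcases le_total (μ.relJ ψ) (ν.relJ ψ) with h | h
    · refine le_max_of_le_right ?_
      have := mul_le_mul_of_nonneg_left h hC.le
      linarith
    · refine le_max_of_le_left ?_
      have := mul_le_mul_of_nonneg_left h (mul_pos hC hC).le
      linarith
  have h11 := max_lt h8 h9
  linarith

theorem continuous_energyDist :
    Continuous fun p : S.FiniteEnergy ω × S.FiniteEnergy ω => energyDist hω p.1 p.2 := by
  refine continuous_iff_continuousAt.2 fun ⟨μ, ν⟩ => ?_
  have hα : 0 < ((2 : ℝ) ^ (m + 1))⁻¹ := by positivity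
  set R := max 1 (max μ.J ν.J) + 1 with hR_def
  have hR : 0 < R := by positivity
  have hμR : μ.J < R := by linarith [(le_max_left μ.J ν.J).trans (le_max_right 1 _)]
  have hνR : ν.J < R := by linarith [(le_max_right μ.J ν.J).trans (le_max_right 1 _)]
  have l1 : Tendsto (fun p : S.FiniteEnergy ω × S.FiniteEnergy ω => p.1) (𝓝 (μ, ν)) (𝓝 μ) :=
    continuous_fst.tendsto _
  have l2 : Tendsto (fun p : S.FiniteEnergy ω × S.FiniteEnergy ω => p.2) (𝓝 (μ, ν)) (𝓝 ν) :=
    continuous_snd.tendsto _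
  have lim := tendsto_rpow_estimate (((tendsto_energyDist_self hω hvol horth μ).comp l1).max
    ((tendsto_energyDist_self hω hvol horth ν).comp l2)) hα.le (mainConst m)
    (R ^ (1 - ((2 : ℝ) ^ (m + 1))⁻¹))
  rw [max_self, Real.zero_rpow hα.ne', mul_zero, zero_mul] at lim
  change Tendsto _ _ (𝓝 (energyDist hω μ ν))
  rw [← tendsto_sub_nhds_zero_iff]
  refine squeeze_zero_norm' ?_ lim
  filter_upwards [l1.eventually (FiniteEnergy.continuous_J.continuousAt.eventually
    (gt_mem_nhds hμR)), l2.eventually (FiniteEnergy.continuous_J.continuousAt.eventually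
    (gt_mem_nhds hνR))] with p h1 h2
  rw [norm_sub_rev, Real.norm_eq_abs]
  exact abs_energyDist_sub_le hω hvol horth hR hμR.le h1.le hνR.le h2.le

include hω in
theorem dense_MA : Dense {μ : S.FiniteEnergy ω | ∃ φ ∈ S.psh ω, μ.radon = S.MA ω φ} := by
  intro μ
  have h := isMaximizing_maxSeq hω μ
  refine mem_closure_of_tendsto (f := fun i => feMA hω hvol (h.1 i)) (b := atTop)
    (FiniteEnergy.tendsto_of_testFun (fun f => h.tendsto_MA hω hvol horth f) ?_)
    (Eventually.of_forall fun i => ⟨_, h.1 i, rfl⟩)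
  simpa only [FiniteEnergy.J_eq_dirichlet hω (h.1 _) (feMA_radon hω hvol (h.1 _))] using
    h.tendsto_J hω hvol horth

theorem extendsDirichlet_energyDist : S.ExtendsDirichlet ω (energyDist hω) :=
  ⟨continuous_energyDist hω hvol horth, fun φ hφ ψ hψ μ ν hμ hν => by
    rw [energyDist_eq_relJ hω hvol horth hψ hν, FiniteEnergy.relJ_of_MA hω hφ hμ]⟩

theorem ExtendsDirichlet.eq_energyDist {d : S.FiniteEnergy ω → S.FiniteEnergy ω → ℝ}
    (h : S.ExtendsDirichlet ω d) : d = energyDist hω := by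
  have hd := (dense_MA hω hvol horth).prod (dense_MA hω hvol horth)
  have := Continuous.ext_on hd h.1 (continuous_energyDist hω hvol horth) (by
    rintro ⟨μ, ν⟩ ⟨⟨φ, hφ, hμ⟩, ⟨ψ, hψ, hν⟩⟩
    exact (h.2 φ hφ ψ hψ μ ν hμ hν).trans
      ((extendsDirichlet_energyDist hω hvol horth).2 φ hφ ψ hψ μ ν hμ hν).symm)
  ext μ ν
  exact congrFun this (μ, ν)

theorem quasiMetric_topology_eq :
    (isQuasiMetricWith_energyDist hω hvol horth).uniformSpace.toTopologicalSpace =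
      S.strongTopology ω := by
  set hd := isQuasiMetricWith_energyDist hω hvol horth
  have hb : ∀ μ, (@nhds _ hd.uniformSpace.toTopologicalSpace μ).HasBasis (fun ε : ℝ => 0 < ε)
      fun ε => {ν | energyDist hω μ ν < ε} := hd.hasBasis_nhds
  refine TopologicalSpace.ext_nhds fun μ => le_antisymm ?_ ?_
  · refine tendsto_of_energyDist hω hvol horth (μs := id) (μ := μ) ?_
    refine Metric.tendsto_nhds.2 fun ε hε => ?_
    refine Filter.mem_of_superset ((hb μ).mem_of_mem hε) fun ν hν => ?_
    change dist (energyDist hω μ ν) 0 < ε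
    rw [Real.dist_eq, sub_zero, abs_of_nonneg (energyDist_nonneg hω _ _)]
    exact hν
  · refine (hb μ).ge_iff.2 fun ε hε => ?_
    exact (tendsto_energyDist_self hω hvol horth μ).eventually (gt_mem_nhds hε)

theorem quasiMetric_complete :
    @CompleteSpace _ (isQuasiMetricWith_energyDist hω hvol horth).uniformSpace := by
  have hC := mainConst_pos m
  refine (isQuasiMetricWith_energyDist hω hvol horth).completeSpace_of_forall
    fun f hf1 hcauchy => ?_
  obtain ⟨ν, hν⟩ := exists_clusterPt_of_compactSpace (map FiniteEnergy.prob f)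
  -- a Cauchy filter is close to a Monge--Ampère measure, and this passes to the weak cluster
  -- point `ν` because the energy is weakly lower semicontinuous
  have key : ∀ ε : ℝ, 0 < ε → ∃ ψ ∈ S.psh ω, (∀ᶠ μ in f, μ.relJ ψ < ε) ∧
      ∀ φ ∈ S.psh ω, S.energy ω φ - ν.1 φ ≤ ε + (S.energy ω ψ - ν.1 ψ) := by
    intro ε hε
    have hε' : 0 < ε / (2 * mainConst m) := by positivity
    obtain ⟨t, ht, hts⟩ := hcauchy _ hε'
    obtain ⟨μ₀, hμ₀⟩ := hf1.nonempty_of_mem ht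
    obtain ⟨ψ, hψ, hψε⟩ := μ₀.exists_relJ_lt hω hε'
    have hlt : ∀ μ ∈ t, μ.relJ ψ < ε := by
      intro μ hμ
      have h1 := energyDist_triangle hω μ (feMA hω hvol hψ) μ₀
      rw [energyDist_eq_relJ (ν := feMA hω hvol hψ) hω hvol horth hψ rfl,
        energyDist_eq_relJ (ν := feMA hω hvol hψ) hω hvol horth hψ rfl] at h1
      have h2 := hts μ hμ μ₀ hμ₀
      refine h1.trans_lt ?_
      calc _ < mainConst m * (ε / (2 * mainConst m) + ε / (2 * mainConst m)) := by gcongr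
        _ = ε := by field_simp; ring
    refine ⟨ψ, hψ, Filter.mem_of_superset ht hlt, fun φ hφ => ?_⟩
    have hclosed : IsClosed {κ : RadonProb X |
        S.energy ω φ - κ.1 φ ≤ ε + (S.energy ω ψ - κ.1 ψ)} :=
      isClosed_le (continuous_const.sub (RadonProb.continuous_apply _))
        (continuous_const.add (continuous_const.sub (RadonProb.continuous_apply _)))
    refine hclosed.mem_of_mapClusterPt hν (Filter.mem_of_superset ht fun μ hμ => ?_)
    have h1 := hlt μ hμ
    have h2 := μ.energy_sub_le_J hω hφ
    rw [FiniteEnergy.relJ] at h1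
    change S.energy ω φ - μ.radon φ ≤ ε + (S.energy ω ψ - μ.radon ψ)
    linarith
  have hfin : S.measureEnergy ω ν 0 < ⊤ := by
    obtain ⟨ψ, -, -, h⟩ := key 1 one_pos
    exact (measureEnergy_lt_top_iff hω).2 ⟨_, h⟩
  refine ⟨⟨ν, hfin⟩, fun ε hε => ?_⟩
  have hε' : 0 < ε / (2 * (mainConst m * (1 + mainConst m))) := by positivity
  obtain ⟨ψ, hψ, h1, h2⟩ := key _ hε'
  have h3 : (⟨ν, hfin⟩ : S.FiniteEnergy ω).relJ ψ ≤
      ε / (2 * (mainConst m * (1 + mainConst m))) := by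
    have : Nonempty (S.psh ω) := ⟨⟨0, zero_mem_psh hω⟩⟩
    rw [FiniteEnergy.relJ, FiniteEnergy.J_eq_iSup _ hω]
    have := ciSup_le (f := fun φ : S.psh ω => S.energy ω φ.1 - ν.1 (φ.1 : C(X, ℝ)))
      fun φ => h2 φ.1 φ.2
    exact sub_le_iff_le_add.2 this
  filter_upwards [h1] with μ hμ
  have h4 := energyDist_triangle hω ⟨ν, hfin⟩ μ (feMA hω hvol hψ)
  have h5 := energyDist_symm_le hω (feMA hω hvol hψ) μ
  rw [energyDist_eq_relJ (ν := feMA hω hvol hψ) hω hvol horth hψ rfl] at h4 h5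
  have h6 : energyDist hω ⟨ν, hfin⟩ μ ≤ mainConst m *
      (ε / (2 * (mainConst m * (1 + mainConst m))) +
        mainConst m * (ε / (2 * (mainConst m * (1 + mainConst m))))) := by
    refine h4.trans ?_
    have := h5.trans (mul_le_mul_of_nonneg_left hμ.le hC.le)
    gcongr
  have h7 : mainConst m * (ε / (2 * (mainConst m * (1 + mainConst m))) +
        mainConst m * (ε / (2 * (mainConst m * (1 + mainConst m))))) = ε / 2 := by
    field_simp
  change energyDist hω ⟨ν, hfin⟩ μ < ε
  linarith

end

end PluripotentialData

namespace PluripotentialData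

variable {X : Type*} [TopologicalSpace X] [CompactSpace X]
  {Z : Type*} [AddCommGroup Z] [Module ℝ Z] [PartialOrder Z] [IsOrderedAddMonoid Z]
  [IsOrderedModule ℝ Z]
variable {m : ℕ} {S : PluripotentialData X Z (m + 1)} {ω ω' : Z} {τ : S.testFun}

/-! ### Dependence on the reference form -/

theorem exists_eq_twist (h : S.bcClass ω' = S.bcClass ω) : ∃ τ : S.testFun, ω' = S.twist ω τ := by
  obtain ⟨τ, hτ⟩ := (Submodule.Quotient.eq _).1 h
  exact ⟨τ, by rw [twist, hτ, add_sub_cancel]⟩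

theorem eq_twist_neg (h : ω' = S.twist ω τ) : ω = S.twist ω' (-τ) := by
  rw [h, twist, twist, map_neg, add_neg_cancel_right]

theorem twist_change (h : ω' = S.twist ω τ) (φ : S.testFun) :
    S.twist ω' φ = S.twist ω (φ + τ) := by
  rw [h, twist, twist, twist, map_add, add_assoc, add_comm (S.ddc τ)]

theorem mem_psh_change (h : ω' = S.twist ω τ) {φ : S.testFun} :
    φ ∈ S.psh ω' ↔ φ + τ ∈ S.psh ω := by
  change 0 ≤ S.twist ω' φ ↔ 0 ≤ S.twist ω (φ + τ)
  rw [twist_change h]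

theorem vol_change (h : ω' = S.twist ω τ) : S.vol ω' = S.vol ω := by
  rw [← S.integ_twistForm_pow_one ω τ, twistForm, ← h, integ_wedge_const]
  rfl

theorem MA_change (h : ω' = S.twist ω τ) (φ : S.testFun) : S.MA ω' φ = S.MA ω (φ + τ) := by
  rw [MA, MA, vol_change h, twist_change h]

theorem energy_change (h : ω' = S.twist ω τ) (φ : S.testFun) :
    S.energy ω' φ = S.energy ω (φ + τ) - S.energy ω τ := by
  rw [energy_sub, energy_eq_avg, avg, avg, vol_change h, twistForm, twist_change h,
    add_sub_cancel_right, h]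
  rfl

theorem dirichlet_change (h : ω' = S.twist ω τ) (φ ψ : S.testFun) :
    S.dirichlet ω' φ ψ = S.dirichlet ω (φ + τ) (ψ + τ) := by
  rw [dirichlet, dirichlet, energy_change h, energy_change h, MA_change h, add_sub_add_right_eq_sub]
  ring

theorem HasOrthogonality.change (h : ω' = S.twist ω τ) (ho : S.HasOrthogonality ω) :
    S.HasOrthogonality ω' := by
  have hsub : ∀ {φ : S.testFun}, φ ∈ S.psh ω → φ - τ ∈ S.psh ω' := fun hφ => by
    rwa [mem_psh_change h, sub_add_cancel]
  refine ⟨fun φ hφ ψ hψ f hf => ?_, fun f ε hε => ?_⟩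
  · obtain ⟨σ, hσ, hσf⟩ := ho.1 _ ((mem_psh_change h).1 hφ) _ ((mem_psh_change h).1 hψ) (f + τ)
      (fun x => by
        have := hf x
        change max (φ.1 x + τ.1 x) (ψ.1 x + τ.1 x) < f.1 x + τ.1 x
        rw [max_add_add_right]
        linarith)
    refine ⟨σ - τ, hsub hσ, fun x => ?_⟩
    obtain ⟨h1, h2⟩ := hσf x
    change max (φ.1 x + τ.1 x) (ψ.1 x + τ.1 x) ≤ σ.1 x at h1
    change σ.1 x < f.1 x + τ.1 x at h2
    change max (φ.1 x) (ψ.1 x) ≤ σ.1 x - τ.1 x ∧ σ.1 x - τ.1 x < f.1 x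
    rw [max_add_add_right] at h1
    constructor <;> linarith
  · obtain ⟨φ₀, hφ₀, hlt, hφ⟩ := ho.2 (f + τ) ε hε
    refine ⟨φ₀ - τ, hsub hφ₀, fun x => ?_, fun φ hφ' hx => ?_⟩
    · have h2 : φ₀.1 x < f.1 x + τ.1 x := hlt x
      change φ₀.1 x - τ.1 x < f.1 x
      linarith
    · have := hφ (φ + τ) ((mem_psh_change h).1 hφ') fun x => by
        obtain ⟨h1, h2⟩ := hx x
        change φ₀.1 x - τ.1 x ≤ φ.1 x at h1
        change φ₀.1 x ≤ φ.1 x + τ.1 x ∧ φ.1 x + τ.1 x < f.1 x + τ.1 x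
        constructor <;> linarith
      rwa [add_sub_add_right_eq_sub, ← MA_change h] at this

theorem measureEnergy_change (h : ω' = S.twist ω τ) (μ : RadonProb X) (ψ : S.testFun) :
    S.measureEnergy ω' μ ψ = S.measureEnergy ω μ (ψ + τ) := by
  refine Equiv.iSup_congr ((Equiv.addRight τ).subtypeEquiv fun φ => mem_psh_change h) fun φ => ?_
  congr 1
  change S.energy ω (φ.1 + τ) - S.energy ω (ψ + τ) +
    μ.1 ((ψ + τ - (φ.1 + τ) : S.testFun) : C(X, ℝ)) = _
  rw [energy_change h, energy_change h, add_sub_add_right_eq_sub]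
  ring

/-- A measure of finite energy with respect to `ω`, as a measure of finite energy with respect
to a cohomologous form. -/
def FiniteEnergy.change (hω : 0 ≤ ω) (h : ω' = S.twist ω τ) (μ : S.FiniteEnergy ω) :
    S.FiniteEnergy ω' where
  prob := μ.prob
  finite := by
    rw [measureEnergy_change h, μ.measureEnergy_eq hω]
    exact EReal.coe_lt_top _

theorem FiniteEnergy.change_J (hω : 0 ≤ ω) (h : ω' = S.twist ω τ) (μ : S.FiniteEnergy ω) :
    (μ.change hω h).J = μ.relJ τ := by
  change (S.measureEnergy ω' μ.prob 0).toReal = _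
  rw [measureEnergy_change h, μ.measureEnergy_eq hω, EReal.toReal_coe, zero_add]

theorem FiniteEnergy.continuous_change (hω : 0 ≤ ω) (h : ω' = S.twist ω τ) :
    Continuous (FiniteEnergy.change hω h) := by
  refine continuous_iff_continuousAt.2 fun μ => FiniteEnergy.tendsto_of_testFun (fun f => ?_) ?_
  · exact (continuous_radon (f : C(X, ℝ))).continuousAt
  · simp only [change_J]
    exact (continuous_relJ τ).continuousAt

/-- Cohomologous reference forms define the same space of measures of finite energy, with the
same strong topology. -/
def FiniteEnergy.changeHomeomorph (hω : 0 ≤ ω) (hω' : 0 ≤ ω') (h : ω' = S.twist ω τ) :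
    S.FiniteEnergy ω ≃ₜ S.FiniteEnergy ω' where
  toFun := FiniteEnergy.change hω h
  invFun := FiniteEnergy.change hω' (eq_twist_neg h)
  left_inv _ := rfl
  right_inv _ := rfl
  continuous_toFun := FiniteEnergy.continuous_change hω h
  continuous_invFun := FiniteEnergy.continuous_change hω' (eq_twist_neg h)

theorem ExtendsDirichlet.change (hω : 0 ≤ ω) (h : ω' = S.twist ω τ)
    {d' : S.FiniteEnergy ω' → S.FiniteEnergy ω' → ℝ} (hd' : S.ExtendsDirichlet ω' d') :
    S.ExtendsDirichlet ω fun μ ν => d' (μ.change hω h) (ν.change hω h) := by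
  have hc := FiniteEnergy.continuous_change hω h
  refine ⟨hd'.1.comp ((hc.comp continuous_fst).prodMk (hc.comp continuous_snd)),
    fun φ hφ ψ hψ μ ν hμ hν => ?_⟩
  have hsub : ∀ {φ : S.testFun}, φ ∈ S.psh ω → φ - τ ∈ S.psh ω' := fun hφ => by
    rwa [mem_psh_change h, sub_add_cancel]
  have hMA : ∀ (κ : S.FiniteEnergy ω) (χ : S.testFun), κ.radon = S.MA ω χ →
      (κ.change hω h).radon = S.MA ω' (χ - τ) := fun κ χ hκ => by
    rw [MA_change h, sub_add_cancel]
    exact hκ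
  have := hd'.2 _ (hsub hφ) _ (hsub hψ) _ _ (hMA μ φ hμ) (hMA ν ψ hν)
  rwa [dirichlet_change h, sub_add_cancel, sub_add_cancel] at this

end PluripotentialData

open PluripotentialData in
theorem theoremA (n : ℕ) (hn : 1 ≤ n) :
    -- a constant that depends only on the dimension
    ∃ C : ℝ, 0 < C ∧
      ∀ (X : Type u) [TopologicalSpace X] [CompactSpace X] [T2Space X]
        (Z : Type v) [AddCommGroup Z] [Module ℝ Z] [PartialOrder Z] [IsOrderedAddMonoid Z]
        [IsOrderedModule ℝ Z] (S : PluripotentialData X Z n) (ω : Z),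
        0 ≤ ω → S.bcClass ω ∈ S.Pos → S.HasOrthogonality ω →
        -- `MA_ω` maps `D_ω` to `M¹_ω`
        (∀ φ ∈ S.psh ω, ∃ μ : S.FiniteEnergy ω, μ.radon = S.MA ω φ) ∧
        -- the Monge--Ampère measures of a maximizing sequence converge strongly
        (∀ (μ : S.FiniteEnergy ω) (ψ : ℕ → S.testFun), S.IsMaximizing μ ψ →
          ∀ μs : ℕ → S.FiniteEnergy ω, (∀ i, (μs i).radon = S.MA ω (ψ i)) →
            Tendsto μs atTop (𝓝 μ)) ∧
        -- the image of `MA_ω` is dense in the strong topology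
        Dense {μ : S.FiniteEnergy ω | ∃ φ ∈ S.psh ω, μ.radon = S.MA ω φ} ∧
        ∃ d : S.FiniteEnergy ω → S.FiniteEnergy ω → ℝ,
          -- existence and uniqueness of the continuous extension of the Dirichlet functional
          S.ExtendsDirichlet ω d ∧
          (∀ d' : S.FiniteEnergy ω → S.FiniteEnergy ω → ℝ, S.ExtendsDirichlet ω d' → d' = d) ∧
          -- relation to the energy of a measure
          (∀ (μ ν : S.FiniteEnergy ω), ∀ ψ ∈ S.psh ω, ν.radon = S.MA ω ψ →
            (d μ ν : EReal) = S.measureEnergy ω μ.prob ψ) ∧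
          (∀ (μ ν : S.FiniteEnergy ω), ν.radon = S.MA ω 0 → d μ ν = μ.J) ∧
          -- `d` is a quasi-metric, its topology is the strong topology, and it is complete
          (∃ hd : IsQuasiMetricWith C d,
            hd.uniformSpace.toTopologicalSpace = S.strongTopology ω ∧
            @CompleteSpace _ hd.uniformSpace) ∧
          -- Hölder continuity of `d`
          (∀ (R : ℝ) (μ μ' ν ν' : S.FiniteEnergy ω), 0 < R →
            μ.J ≤ R → μ'.J ≤ R → ν.J ≤ R → ν'.J ≤ R →
            |d μ ν - d μ' ν'| ≤
              C * max (d μ μ') (d ν ν') ^ ((2 : ℝ) ^ n)⁻¹ * R ^ (1 - ((2 : ℝ) ^ n)⁻¹)) ∧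
          -- Hölder estimate for integrals
          (∀ (R : ℝ) (μ ν : S.FiniteEnergy ω), 0 < R → μ.J ≤ R → ν.J ≤ R →
            ∀ φ ∈ S.pshLe ω R, ∀ ψ ∈ S.pshLe ω R,
            |(μ.radon - ν.radon) ((φ - ψ : S.testFun) : C(X, ℝ))| ≤
              C * S.dirichlet ω φ ψ ^ ((2 : ℝ) ^ n)⁻¹ * d μ ν ^ ((1 : ℝ) / 2) *
                R ^ ((1 : ℝ) / 2 - ((2 : ℝ) ^ n)⁻¹)) ∧
          -- `M¹_ω`, its strong topology and `d` depend only on the class of `ω`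
          (∀ ω' : Z, 0 ≤ ω' → S.bcClass ω' = S.bcClass ω →
            S.HasOrthogonality ω' ∧
            ∃ e : S.FiniteEnergy ω ≃ₜ S.FiniteEnergy ω',
              (∀ μ, (e μ).prob = μ.prob) ∧
              ∀ d' : S.FiniteEnergy ω' → S.FiniteEnergy ω' → ℝ,
                S.ExtendsDirichlet ω' d' ↔ ∀ μ ν, d' (e μ) (e ν) = d μ ν) := by
  obtain ⟨m, rfl⟩ : ∃ m, n = m + 1 := ⟨n - 1, by omega⟩
  refine ⟨mainConst m, mainConst_pos m, ?_⟩
  intro X _ _ _ Z _ _ _ _ _ S ω hω hpos horth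
  have hvol := S.vol_pos hpos
  refine ⟨fun φ hφ => ⟨feMA hω hvol hφ, rfl⟩, fun μ ψ hψ μs hμs => ?_, dense_MA hω hvol horth,
    energyDist hω, extendsDirichlet_energyDist hω hvol horth,
    fun d' hd' => hd'.eq_energyDist hω hvol horth, fun μ ν ψ hψ hν => ?_,
    fun μ ν hν => energyDist_eq_J hω hvol horth hν,
    ⟨isQuasiMetricWith_energyDist hω hvol horth, quasiMetric_topology_eq hω hvol horth,
      quasiMetric_complete hω hvol horth⟩,
    fun R μ μ' ν ν' hR hμ hμ' hν hν' => abs_energyDist_sub_le hω hvol horth hR hμ hμ' hν hν',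
    fun R μ ν hR hμ hν φ hφ ψ hψ => abs_radon_sub_sub_le hω hvol horth hR hμ hν hφ hψ,
    fun ω' hω' hclass => ?_⟩
  · refine FiniteEnergy.tendsto_of_testFun (fun f => ?_) ?_
    · simpa only [hμs] using hψ.tendsto_MA hω hvol horth f
    · simpa only [FiniteEnergy.J_eq_dirichlet hω (hψ.1 _) (hμs _)] using
        hψ.tendsto_J hω hvol horth
  · rw [energyDist_eq_relJ hω hvol horth hψ hν, μ.measureEnergy_eq hω]
  · obtain ⟨τ, hτ⟩ := exists_eq_twist hclass
    refine ⟨horth.change hτ, FiniteEnergy.changeHomeomorph hω hω' hτ, fun μ => rfl,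
      fun d' => ⟨fun hd' μ ν => ?_, fun hd' => ?_⟩⟩
    · exact congrFun (congrFun ((hd'.change hω hτ).eq_energyDist hω hvol horth) μ) ν
    · have := (extendsDirichlet_energyDist hω hvol horth).change hω' (eq_twist_neg hτ)
      refine Eq.mp (congrArg _ ?_) this
      ext μ ν
      exact (hd' (μ.change hω' (eq_twist_neg hτ)) (ν.change hω' (eq_twist_neg hτ))).symm

end
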